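/- Let $n,p$ be non-negative integers, $X\in\mathbb R^{n\times p}$ a design matrix whose columns have mean zero, $Y\in\mathbb R^n$ a response vector that is not constant (so $n\ge 2$), and $\lambda>0$. Consider the Bayesian lasso model $$Y\mid\mu,\beta,\sigma^2\sim N_n(\mu 1_n+X\beta,\sigma^2I_n),\qquad \beta\mid\sigma^2,\tau\sim N_p(0,\sigma^2D_\tau),\qquad \tau_j\overset{iid}{\sim}\mathrm{Exponential}(\lambda^2/2),$$ with $D_\tau=\mathrm{diag}(\tau_1,\dots,\tau_p)$ and the improper prior density $1/\sigma^2$ on $(\sigma^2,\mu)$. Let $F$ be the joint posterior distribution of $(\beta,\sigma^2)$ given $Y$, obtained by integrating out $\mu$ and $\tau$. Put $\tilde Y=Y-\bar Y1_n$, $A_\tau=X^TX+D_\tau^{-1}$ and $C_\tau=\tilde Y^T(I_n-XA_\tau^{-1}X^T)\tilde Y$. The two-step (blocked) Gibbs sampler is the Markov chain on $\mathbb R^p\times(0,\infty)$ that moves from $(\beta_0,\sigma_0^2)$ to $(\beta_1,\sigma_1^2)$ as follows: draw $\tau_1,\dots,\tau_p$ independently, with $1/\tau_j$ inverse Gaussian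 with mean $\lambda\sigma_0/|\beta_{0,j}|$ and shape $\lambda^2$ (if $\beta_{0,j}=0$, $\tau_j$ is gamma with shape $1/2$ and rate $\lambda^2/2$); then draw $\sigma_1^2\mid\tau\sim\mathrm{InverseGamma}((n-1)/2,\,C_\tau/2)$ and $\beta_1\mid\sigma_1^2,\tau\sim N_p(A_\tau^{-1}X^T\tilde Y,\,\sigma_1^2A_\tau^{-1})$. Let $F_k(\beta_0,\sigma_0^2)$ be the distribution of its $k$-th iterate when started at $(\beta_0,\sigma_0^2)$. Let $0<\gamma<1$, $b=\dfrac{(n+3)p\,(16\gamma+(n+3))}{64\gamma}$, $d>\dfrac{2b}{1-\gamma}$ and $0<r<1$, and set $$\varepsilon=\exp(-p\sqrt d),\qquad U=1+2(\gamma d+b),\qquad \alpha=\frac{1+d}{1+2b+\gamma d}.$$ Then the transition rule above is a Markov kernel, $F$ is a (proper) probability distribution, $F$ is stationary for the chain, and for every starting point $(\beta_0,\sigma_0^2)\in\mathbb R^p\times(0,\infty)$ and every $k\ge1$, $$d_{TV}\bigl(F_k(\beta_0,\sigma_0^2),F\bigr)\le(1-\varepsilon)^{rk}+\left(\frac{U^r}{\alpha^{1-r}}\right)^k\left(1+\frac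 b{1-\gamma}+\frac{\lambda^2\|\beta_0\|_2^2}{\sigma_0^2}\right),$$ where $d_{TV}(P,Q)=\sup_A|P(A)-Q(A)|$. -/

import Mathlib

open MeasureTheory ProbabilityTheory
open scoped ENNReal NNReal

noncomputable section

namespace BayesianLasso

variable {n p : ℕ}

/-- The state space `ℝᵖ × ℝ₊` of the chain; a point is `(β, σ²)`. -/
abbrev State (p : ℕ) : Type := (Fin p → ℝ) × Set.Ioi (0 : ℝ)

/-- Lebesgue measure on `ℝ₊ = (0, ∞)`. -/
def posVolume : Measure (Set.Ioi (0 : ℝ)) := Measure.comap Subtype.val volume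

instance : SigmaFinite posVolume :=
  SigmaFinite.of_map _ measurable_subtype_coe.aemeasurable (by
    rw [posVolume, map_comap_subtype_coe measurableSet_Ioi]; infer_instance)

/-- Lebesgue measure on `ℝᵖ × ℝ₊`. -/
def stateVolume (p : ℕ) : Measure (State p) := (volume : Measure (Fin p → ℝ)).prod posVolume

instance : SigmaFinite (stateVolume p) := by
  unfold stateVolume; infer_instance

/-- The centred response `Ỹ = Y - Ȳ 1`. -/
def centered (Y : Fin n → ℝ) : Fin n → ℝ := fun i => Y i - (∑ l, Y l) / n

/-- `A_τ = XᵀX + D_τ⁻¹` with `D_τ = diag(τ₁, …, τ_p)`. -/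
def precMatrix (X : Matrix (Fin n) (Fin p) ℝ) (τ : Fin p → ℝ) : Matrix (Fin p) (Fin p) ℝ :=
  X.transpose * X + Matrix.diagonal τ⁻¹

/-- `A_τ⁻¹ Xᵀ Ỹ`. -/
def betaMean (X : Matrix (Fin n) (Fin p) ℝ) (Y : Fin n → ℝ) (τ : Fin p → ℝ) : Fin p → ℝ :=
  ((precMatrix X τ)⁻¹ * X.transpose).mulVec (centered Y)

/-- `C_τ = Ỹᵀ (I - X A_τ⁻¹ Xᵀ) Ỹ`. -/
def residual (X : Matrix (Fin n) (Fin p) ℝ) (Y : Fin n → ℝ) (τ : Fin p → ℝ) : ℝ :=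
  dotProduct (centered Y)
    ((1 - X * (precMatrix X τ)⁻¹ * X.transpose).mulVec (centered Y))

/-- Density at `s > 0` of the inverse gamma distribution with shape `a` and scale `b`. -/
def invGammaPDF (a b s : ℝ) : ℝ :=
  b ^ a / Real.Gamma a * s ^ (-a - 1) * Real.exp (-b / s)

/-- Density of the normal distribution on `ℝᵖ` with mean `m` and positive definite precision
matrix (inverse covariance matrix) `P`. -/
def normalPDF (m : Fin p → ℝ) (P : Matrix (Fin p) (Fin p) ℝ) (x : Fin p → ℝ) : ℝ :=
  √P.det / √(2 * Real.pi) ^ p * Real.exp (-(dotProduct (x - m) (P.mulVec (x - m))) / 2)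

/-- Density of `τ ∣ β, σ², Y` for the Bayesian lasso: the `τ_j` are independent and positive, and
`1/τ_j` is inverse Gaussian with mean `λσ/|β_j|` and shape `λ²` (for `β_j = 0`: `τ_j` is gamma with
shape `1/2` and rate `λ²/2`). Here `s = σ²`. -/
def tauPDF (lam : ℝ) (β : Fin p → ℝ) (s : ℝ) (τ : Fin p → ℝ) : ℝ :=
  ∏ j, if 0 < τ j then
      lam / √(2 * Real.pi * τ j) *
        Real.exp (lam * |β j| / √s - β j ^ 2 / (2 * s * τ j) - lam ^ 2 * τ j / 2)
    else 0

/-- Density of `(β, σ²) ∣ τ, Y`, drawn as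
`σ² ∣ τ, Y ∼ Inverse-Gamma((n - 1)/2, C_τ/2)` and then
`β ∣ σ², τ, Y ∼ N_p(A_τ⁻¹XᵀỸ, σ² A_τ⁻¹)`. -/
def blockPDF (X : Matrix (Fin n) (Fin p) ℝ) (Y : Fin n → ℝ) (τ : Fin p → ℝ) (x : State p) : ℝ :=
  invGammaPDF (((n : ℝ) - 1) / 2) (residual X Y τ / 2) x.2 *
    normalPDF (betaMean X Y τ) ((x.2 : ℝ)⁻¹ • precMatrix X τ) x.1

theorem measurable_tauPDF (lam : ℝ) :
    Measurable (Function.uncurry fun (x : State p) (τ : Fin p → ℝ) =>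
      ENNReal.ofReal (tauPDF lam x.1 x.2 τ)) := by
  refine ENNReal.measurable_ofReal.comp ?_
  unfold tauPDF
  refine Finset.measurable_prod _ fun j _ => Measurable.ite ?_ ?_ measurable_const
  · exact measurableSet_lt measurable_const (by fun_prop)
  · fun_prop

theorem measurable_inv_precMatrix (X : Matrix (Fin n) (Fin p) ℝ) (i j : Fin p) :
    Measurable fun τ : Fin p → ℝ => (precMatrix X τ)⁻¹ i j := by
  have hinv : Measurable fun τ : Fin p → ℝ => τ⁻¹ := by fun_prop
  have hA : Continuous fun v : Fin p → ℝ => X.transpose * X + Matrix.diagonal v := by fun_prop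
  have hd : Measurable fun τ : Fin p → ℝ => (precMatrix X τ).det :=
    hA.matrix_det.measurable.comp hinv
  have ha : Measurable fun τ : Fin p → ℝ => (precMatrix X τ).adjugate i j :=
    (hA.matrix_adjugate.matrix_elem i j).measurable.comp hinv
  simp only [Matrix.inv_def, Ring.inverse_eq_inv', Matrix.smul_apply, smul_eq_mul]
  exact hd.inv.mul ha

theorem measurable_blockPDF (X : Matrix (Fin n) (Fin p) ℝ) (Y : Fin n → ℝ) :
    Measurable (Function.uncurry fun (τ : Fin p → ℝ) (x : State p) =>
      ENNReal.ofReal (blockPDF X Y τ x)) := by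
  have hI := measurable_inv_precMatrix X
  have hA : ∀ i j, Measurable fun τ : Fin p → ℝ => precMatrix X τ i j := fun i j => by
    unfold precMatrix
    simp only [Matrix.add_apply, Matrix.diagonal_apply, Pi.inv_apply]
    split_ifs <;> fun_prop
  have hm : ∀ j, Measurable fun τ : Fin p → ℝ => betaMean X Y τ j := fun j => by
    simp only [betaMean, Matrix.mulVec, dotProduct, Matrix.mul_apply]
    refine Finset.measurable_sum _ fun i _ => Measurable.mul_const ?_ _
    exact Finset.measurable_sum _ fun c _ => (hI j c).mul_const _
  have hr : Measurable fun τ : Fin p → ℝ => residual X Y τ := by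
    simp only [residual, Matrix.mulVec, dotProduct, Matrix.mul_apply, Matrix.sub_apply]
    refine Finset.measurable_sum _ fun i _ => Measurable.const_mul ?_ _
    refine Finset.measurable_sum _ fun l _ => Measurable.mul_const ?_ _
    refine Measurable.const_sub ?_ _
    refine Finset.measurable_sum _ fun a _ => Measurable.mul_const ?_ _
    exact Finset.measurable_sum _ fun c _ => (hI c a).const_mul _
  have hd : Measurable fun z : (Fin p → ℝ) × State p =>
      ((z.2.2 : ℝ)⁻¹ • precMatrix X z.1).det := by
    simp only [Matrix.det_apply, Matrix.smul_apply, smul_eq_mul]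
    refine Finset.measurable_sum _ fun σ _ => Measurable.const_smul ?_ _
    refine Finset.measurable_prod _ fun i _ => Measurable.mul ?_ ((hA _ i).comp measurable_fst)
    fun_prop
  refine ENNReal.measurable_ofReal.comp ?_
  unfold blockPDF
  refine Measurable.mul ?_ ?_
  · have hs : Measurable fun z : (Fin p → ℝ) × State p => (z.2.2 : ℝ) := by fun_prop
    have hC : Measurable fun z : (Fin p → ℝ) × State p => residual X Y z.1 / 2 :=
      (hr.comp measurable_fst).div_const 2
    exact (((hC.pow_const _).div_const _).mul (hs.pow_const _)).mul ((hC.neg.div hs).exp)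
  · have hx : ∀ j, Measurable fun z : (Fin p → ℝ) × State p =>
        z.2.1 j - betaMean X Y z.1 j := fun j =>
      (by fun_prop : Measurable fun z : (Fin p → ℝ) × State p => z.2.1 j).sub
        ((hm j).comp measurable_fst)
    have hq : Measurable fun z : (Fin p → ℝ) × State p =>
        dotProduct (z.2.1 - betaMean X Y z.1)
          (((z.2.2 : ℝ)⁻¹ • precMatrix X z.1).mulVec (z.2.1 - betaMean X Y z.1)) := by
      simp only [Matrix.mulVec, dotProduct, Matrix.smul_apply, smul_eq_mul, Pi.sub_apply]
      refine Finset.measurable_sum _ fun i _ => (hx i).mul ?_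
      refine Finset.measurable_sum _ fun j _ => Measurable.mul ?_ (hx j)
      exact Measurable.mul (by fun_prop) ((hA i j).comp measurable_fst)
    exact (hd.sqrt.div_const _).mul ((hq.neg.div_const 2).exp)

/-- The first Gibbs step: draw `τ` given `(β, σ²)`. -/
def tauKernel (p : ℕ) (lam : ℝ) : Kernel (State p) (Fin p → ℝ) :=
  Kernel.withDensity (Kernel.const _ volume) fun x τ => ENNReal.ofReal (tauPDF lam x.1 x.2 τ)

/-- The second Gibbs step: draw the block `(β, σ²)` given `τ`. -/
def blockKernel (X : Matrix (Fin n) (Fin p) ℝ) (Y : Fin n → ℝ) : Kernel (Fin p → ℝ) (State p) :=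
  Kernel.withDensity (Kernel.const _ (stateVolume p)) fun τ x => ENNReal.ofReal (blockPDF X Y τ x)

theorem tauKernel_apply (lam : ℝ) (x : State p) :
    tauKernel p lam x = volume.withDensity fun τ => ENNReal.ofReal (tauPDF lam x.1 x.2 τ) := by
  rw [tauKernel, Kernel.withDensity_apply _ (measurable_tauPDF lam), Kernel.const_apply]

theorem blockKernel_apply (X : Matrix (Fin n) (Fin p) ℝ) (Y : Fin n → ℝ) (τ : Fin p → ℝ) :
    blockKernel X Y τ =
      (stateVolume p).withDensity fun x => ENNReal.ofReal (blockPDF X Y τ x) := by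
  rw [blockKernel, Kernel.withDensity_apply _ (measurable_blockPDF X Y), Kernel.const_apply]

/-- Transition kernel on `ℝᵖ × ℝ₊` of the two-step Gibbs sampler: from `(β₀, σ₀²)` draw `τ`, then
draw `(β₁, σ₁²)` given `τ`. -/
def gibbsKernel (X : Matrix (Fin n) (Fin p) ℝ) (Y : Fin n → ℝ) (lam : ℝ) :
    Kernel (State p) (State p) :=
  blockKernel X Y ∘ₖ tauKernel p lam

/-- Likelihood times prior, in all parameters: `Y ∣ β, σ² ∼ N_n(μ 1 + Xβ, σ² I)`,
`β ∣ σ², τ ∼ N_p(0, σ² D_τ)`, independent `τ_j ∼ Exponential(λ²/2)`, and the improper prior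
density `1/σ²` on `(σ², μ)`. -/
def jointDensity (X : Matrix (Fin n) (Fin p) ℝ) (Y : Fin n → ℝ) (lam : ℝ)
    (x : State p) (τ : Fin p → ℝ) (μ : ℝ) : ℝ≥0∞ :=
  (∏ i, gaussianPDF (μ + X.mulVec x.1 i) (x.2 : ℝ).toNNReal (Y i)) *
    (∏ j, gaussianPDF 0 ((x.2 : ℝ) * τ j).toNNReal (x.1 j)) *
    (∏ j, exponentialPDF (lam ^ 2 / 2) (τ j)) * ENNReal.ofReal (1 / x.2)

/-- The unnormalised posterior density of `(β, σ²)`: integrate out `τ` and `μ`. -/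
def marginalDensity (X : Matrix (Fin n) (Fin p) ℝ) (Y : Fin n → ℝ) (lam : ℝ) (x : State p) :
    ℝ≥0∞ :=
  ∫⁻ τ : Fin p → ℝ, ∫⁻ μ : ℝ, jointDensity X Y lam x τ μ

/-- The joint posterior distribution of `(β, σ²)` given `Y`. -/
def posterior (X : Matrix (Fin n) (Fin p) ℝ) (Y : Fin n → ℝ) (lam : ℝ) : Measure (State p) :=
  (∫⁻ x, marginalDensity X Y lam x ∂(stateVolume p))⁻¹ •
    (stateVolume p).withDensity (marginalDensity X Y lam)

/-- Total variation distance `sup_A |P(A) - Q(A)|` of two probability measures. -/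
def tvDist {S : Type*} [MeasurableSpace S] (P Q : Measure S) : ℝ :=
  ⨆ A : {A : Set S // MeasurableSet A}, |P.real A.1 - Q.real A.1|

end BayesianLasso

end

noncomputable section

namespace BayesianLasso

variable {n p : ℕ}

/-! ### Two copies of a chain under a pairwise drift or overlap condition. -/

section Coupling

/-! Write `v_j = λ|β_j|/σ`, `c = (n+3)/4`, `W = (c/n)² Σ v_j²` and `w = (c²/n) Σ (v_j + 1)`. The
argument needs two facts about the Gibbs kernel `P`.

Drift: `PW ≤ w`. Given `τ`, the mean of `Σ β_j²/σ²` is at most `n Σ τ_j`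
(`lintegral_sum_stdCoef_sq_le`), and `λ²τ_j` has mean `1 + v_j` (`lintegral_mul_tauPDF`).

Overlap: the old state influences the new one only through `τ`, so a common part of two
`τ`-densities, pushed through the block step, is a common part of the two transition laws. Its mass
is at least `exp(-Σ (1 + (9/32) max))`, the maximum being that of the two values of `v_j`
(`exists_common_component`).

These combine in a dichotomy for pairs of states (`drift_or_overlap`): either `1 + W + W` exceeds
its one-step bound `1 + w + w` by the factor `α`, or that bound is at most `U` and the overlap is at
least `ε`. Completing the square shows that the pairs failing the first alternative lie in a ball in
the `v`-coordinates, and on this ball both sums are controlled by Cauchy-Schwarz type estimates.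

No coupled process is built. For a fixed event, `abs_pow_sub_pow_le` runs an induction on the
function `x ↦ P^k(x, A)`: a step of the first kind gains `1/α`, a step of the second kind gains `1 -
ε` at the price of `U`. A free integer `j` splits the two gains, and `j + 1 = ⌈rk⌉` gives the stated
rate (`exists_split_le`). Averaging the second starting point over the posterior brings in its mean
of `W`, at most `b/(1-γ)`; only here is `w` replaced by the weaker bound `γW + b`.

Stationarity holds because posterior density times `τ`-density equals a function of `τ` times the
block density (`tauMarginal_spec`). Properness is seen by integrating out `(β, σ²)` first: the
result decays exponentially in `τ`, because the residual shrinks at most like `1/(1 + Σ τ_j)`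
(`exists_inv_residual_le`). -/

theorem exists_center {S : Type*} [Nonempty S] (g W : S → ℝ) (a : ℝ)
    (h : ∀ x y, |g x - g y| ≤ 2 * a + W x + W y) :
    ∃ c, ∀ x, |g x - c| ≤ a + W x := by
  have hle : ∀ x y, g x - a - W x ≤ g y + a + W y := fun x y => by
    have := (abs_le.1 (h x y)).2; linarith
  have hbdd : BddAbove (Set.range fun x => g x - a - W x) := by
    obtain ⟨y⟩ := ‹Nonempty S›
    exact ⟨_, by rintro _ ⟨x, rfl⟩; exact hle x y⟩
  refine ⟨⨆ x, (g x - a - W x), fun x => abs_le.2 ⟨?_, ?_⟩⟩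
  · have := ciSup_le (fun z => hle z x); linarith
  · have := le_ciSup hbdd x
    linarith

variable {S : Type*} [MeasurableSpace S]

theorem integral_le_of_lintegral_ofReal_le {μ : Measure S} {f : S → ℝ} (hf : Measurable f)
    (hf0 : ∀ x, 0 ≤ f x) {c : ℝ} (hc : 0 ≤ c)
    (h : ∫⁻ x, ENNReal.ofReal (f x) ∂μ ≤ ENNReal.ofReal c) :
    Integrable f μ ∧ ∫ x, f x ∂μ ≤ c := by
  constructor
  · refine ⟨hf.aestronglyMeasurable, ?_⟩
    rw [hasFiniteIntegral_iff_ofReal (ae_of_all _ hf0)]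
    exact h.trans_lt ENNReal.ofReal_lt_top
  · rw [integral_eq_lintegral_of_nonneg_ae (ae_of_all _ hf0) hf.aestronglyMeasurable]
    exact ENNReal.toReal_le_of_le_ofReal hc h

theorem abs_integral_le_of_abs_le (μ : Measure S) [IsFiniteMeasure μ] (f W : S → ℝ) (a b : ℝ)
    (hW : Integrable W μ) (h : ∀ x, |f x| ≤ a + b * W x) :
    |∫ x, f x ∂μ| ≤ a * μ.real Set.univ + b * ∫ x, W x ∂μ := by
  have hi : Integrable (fun x => a + b * W x) μ := (integrable_const _).add (hW.const_mul _)
  calc |∫ x, f x ∂μ| = ‖∫ x, f x ∂μ‖ := rfl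
    _ ≤ ∫ x, (a + b * W x) ∂μ := norm_integral_le_of_norm_le hi (ae_of_all _ h)
    _ = _ := by
      rw [integral_add (integrable_const _) (hW.const_mul _), integral_const, integral_const_mul,
        smul_eq_mul, mul_comm a]

/-- One-step estimate with a common component `μ` of the two transition laws. -/
theorem abs_integral_sub_le_of_common (P Q μ : Measure S) [IsProbabilityMeasure P]
    [IsProbabilityMeasure Q] (hP : μ ≤ P) (hQ : μ ≤ Q) (g W : S → ℝ) (hg : Measurable g)
    (hg0 : ∀ x, 0 ≤ g x) (hg1 : ∀ x, g x ≤ 1) (hW0 : ∀ x, 0 ≤ W x)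
    (hWP : Integrable W P) (hWQ : Integrable W Q) (a b : ℝ) (hb : 0 ≤ b)
    (h : ∀ x y, |g x - g y| ≤ a + b * (1 + W x + W y)) :
    |∫ x, g x ∂P - ∫ x, g x ∂Q| ≤
      a * (1 - μ.real Set.univ) + b * (1 + ∫ x, W x ∂P + ∫ x, W x ∂Q) := by
  have : Nonempty S := P.nonempty_of_neZero
  have hμf : IsFiniteMeasure μ := isFiniteMeasure_of_le P hP
  -- A bound on all differences `g x - g y` becomes a bound on `g - c` with half the constant, so
  -- each of the two leftover measures contributes half of `a`.
  obtain ⟨c, hc⟩ := exists_center g (fun x => b * W x) ((a + b) / 2) (fun x y => by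
    have := h x y; linarith)
  have key : ∀ (ρ : Measure S) [IsProbabilityMeasure ρ], μ ≤ ρ → Integrable W ρ →
      |∫ x, (g x - c) ∂ρ - ∫ x, (g x - c) ∂μ| ≤
        (a + b) / 2 * (1 - μ.real Set.univ) + b * ∫ x, W x ∂ρ := by
    intro ρ _ hR hWR
    have hsub : (ρ - μ) + μ = ρ := Measure.sub_add_cancel_of_le hR
    have hgR : Integrable (fun x => g x - c) ρ := by
      refine (Integrable.sub ?_ (integrable_const _))
      exact Integrable.of_bound hg.aestronglyMeasurable 1
        (ae_of_all _ fun x => by rw [Real.norm_of_nonneg (hg0 x)]; exact hg1 x)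
    have h1 : ρ - μ ≤ ρ := Measure.sub_le
    have e1 : ∫ x, (g x - c) ∂ρ = ∫ x, (g x - c) ∂(ρ - μ) + ∫ x, (g x - c) ∂μ := by
      conv_lhs => rw [← hsub]
      exact integral_add_measure (hgR.mono_measure h1) (hgR.mono_measure hR)
    have e2 : (ρ - μ).real Set.univ = 1 - μ.real Set.univ := by
      have : ρ.real Set.univ = (ρ - μ).real Set.univ + μ.real Set.univ := by
        conv_lhs => rw [← hsub]
        exact measureReal_add_apply
      rw [probReal_univ] at this; linarith
    have e3 : ∫ x, W x ∂(ρ - μ) ≤ ∫ x, W x ∂ρ :=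
      integral_mono_measure h1 (ae_of_all _ hW0) hWR
    rw [e1, add_sub_cancel_right]
    refine (abs_integral_le_of_abs_le (ρ - μ) _ W _ b (hWR.mono_measure h1) hc).trans ?_
    rw [e2]
    gcongr
  have kP := key P hP hWP
  have kQ := key Q hQ hWQ
  have hgi : ∀ (ρ : Measure S) [IsProbabilityMeasure ρ], Integrable g ρ := fun ρ _ =>
    Integrable.of_bound hg.aestronglyMeasurable 1
      (ae_of_all _ fun x => by rw [Real.norm_of_nonneg (hg0 x)]; exact hg1 x)
  have eP : ∫ x, (g x - c) ∂P = ∫ x, g x ∂P - c := by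
    rw [integral_sub (hgi P) (integrable_const _)]; simp
  have eQ : ∫ x, (g x - c) ∂Q = ∫ x, g x ∂Q - c := by
    rw [integral_sub (hgi Q) (integrable_const _)]; simp
  have e : ∫ x, g x ∂P - ∫ x, g x ∂Q = (∫ x, (g x - c) ∂P - ∫ x, (g x - c) ∂μ) -
      (∫ x, (g x - c) ∂Q - ∫ x, (g x - c) ∂μ) := by rw [eP, eQ]; ring
  rw [e]
  have hm0 : 0 ≤ μ.real Set.univ := measureReal_nonneg
  refine (abs_sub _ _).trans ((add_le_add kP kQ).trans ?_)
  -- The two halves add up to `(a + b)(1 - μ(S))`; the gain `-b μ(S)` is dropped.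
  nlinarith [mul_nonneg hb hm0]

instance isMarkovKernel_pow (P : Kernel S S) [IsMarkovKernel P] (k : ℕ) :
    IsMarkovKernel (P ^ k) := by
  induction k with
  | zero => rw [pow_zero]; exact inferInstanceAs (IsMarkovKernel Kernel.id)
  | succ k ih => rw [pow_succ]; exact inferInstanceAs (IsMarkovKernel ((P ^ k) ∘ₖ P))

/-- The first step of the chain decomposes its `(k + 1)`-step transition probabilities. -/
theorem real_pow_succ (P : Kernel S S) [IsMarkovKernel P] (k : ℕ) (x : S) {A : Set S}
    (hA : MeasurableSet A) :
    ((P ^ (k + 1)) x).real A = ∫ y, ((P ^ k) y).real A ∂(P x) := by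
  have : (P ^ (k + 1)) x A = ∫⁻ y, (P ^ k) y A ∂(P x) := by
    rw [pow_succ]; exact Kernel.comp_apply' _ _ _ hA
  rw [measureReal_def, this, ← integral_toReal]
  · rfl
  · exact ((P ^ k).measurable_coe hA).aemeasurable
  · exact ae_of_all _ fun y => measure_lt_top _ _

/-- Rosenthal's bound for two copies of a chain, with a bivariate drift condition and a
minorization that may depend on the pair of states. -/
theorem abs_pow_sub_pow_le (P : Kernel S S) [IsMarkovKernel P] (W w : S → ℝ)
    (hW : Measurable W) (hW0 : ∀ x, 0 ≤ W x) (hw0 : ∀ x, 0 ≤ w x)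
    (hdrift : ∀ x, ∫⁻ y, ENNReal.ofReal (W y) ∂(P x) ≤ ENNReal.ofReal (w x))
    {ε U α : ℝ} (hε1 : ε ≤ 1) (hα : 0 < α) (hα1 : 1 ≤ α) (hU : 1 ≤ U)
    (hpair : ∀ x y, α * (1 + w x + w y) ≤ 1 + W x + W y ∨
      (1 + w x + w y ≤ U ∧ ∃ μ : Measure S, μ ≤ P x ∧ μ ≤ P y ∧ ε ≤ μ.real Set.univ))
    {A : Set S} (hA : MeasurableSet A) (k j : ℕ) (x y : S) :
    |((P ^ k) x).real A - ((P ^ k) y).real A| ≤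
      (1 - ε) ^ (j + 1) + (α * U) ^ j / α ^ k * (1 + W x + W y) := by
  have hαU : 1 ≤ α * U := one_le_mul_of_one_le_of_one_le hα1 hU
  have hU0 : 0 < U := by linarith
  have hPint : ∀ x, Integrable W (P x) ∧ ∫ y, W y ∂(P x) ≤ w x := fun x =>
    integral_le_of_lintegral_ofReal_le hW hW0 (hw0 x) (hdrift x)
  have hε0 : 0 ≤ 1 - ε := by linarith
  induction k generalizing j x y with
  | zero =>
    have h1 : |((P ^ 0) x).real A - ((P ^ 0) y).real A| ≤ 1 := by
      have a1 := measureReal_nonneg (μ := (P ^ 0) x) (s := A)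
      have a2 := measureReal_nonneg (μ := (P ^ 0) y) (s := A)
      have a3 := measureReal_le_one (μ := (P ^ 0) x) (s := A)
      have a4 := measureReal_le_one (μ := (P ^ 0) y) (s := A)
      rw [abs_le]; constructor <;> linarith
    have h2 : 0 ≤ (1 - ε) ^ (j + 1) := pow_nonneg hε0 _
    have h3 : 1 ≤ (α * U) ^ j := one_le_pow₀ hαU
    have := hW0 x
    have := hW0 y
    simp only [pow_zero, div_one] at *
    nlinarith
  | succ k ih =>
    rw [real_pow_succ P k x hA, real_pow_succ P k y hA]
    have hgm : Measurable fun z => ((P ^ k) z).real A :=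
      ((P ^ k).measurable_coe hA).ennreal_toReal
    have hg0 : ∀ z, 0 ≤ ((P ^ k) z).real A := fun z => measureReal_nonneg
    have hg1 : ∀ z, ((P ^ k) z).real A ≤ 1 := fun z => measureReal_le_one
    have hx := hPint x
    have hy := hPint y
    have hB : ∀ i : ℕ, 0 ≤ (α * U) ^ i / α ^ k := fun i => by positivity
    have hp : ∀ i, 0 ≤ (1 - ε) ^ i := fun i => pow_nonneg hε0 _
    rcases hpair x y with hout | ⟨hin, μ, hμx, hμy, hμ⟩
    -- The contracting case uses no overlap: the common component is zero and `j` is unchanged.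
    · have := abs_integral_sub_le_of_common (P x) (P y) 0 (Measure.zero_le _) (Measure.zero_le _)
        _ W hgm hg0 hg1 hW0 hx.1 hy.1 _ _ (hB _) (ih j)
      refine this.trans ?_
      refine add_le_add (by simp) ?_
      have e : (α * U) ^ j / α ^ (k + 1) * (1 + W x + W y)
          = (α * U) ^ j / α ^ k * ((1 + W x + W y) / α) := by
        rw [pow_succ]; field_simp
      rw [e]
      refine mul_le_mul_of_nonneg_left ?_ (hB j)
      rw [le_div_iff₀ hα]
      nlinarith [hx.2, hy.2]
    · have hc : ∀ (a b : ℝ), 0 ≤ a → 0 ≤ b → (∀ x y, |((P ^ k) x).real A - ((P ^ k) y).real A| ≤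
          a + b * (1 + W x + W y)) →
          |∫ z, ((P ^ k) z).real A ∂(P x) - ∫ z, ((P ^ k) z).real A ∂(P y)| ≤
            a * (1 - ε) + b * U := by
        intro a b ha hb hab
        refine (abs_integral_sub_le_of_common (P x) (P y) μ hμx hμy
          _ W hgm hg0 hg1 hW0 hx.1 hy.1 a b hb hab).trans ?_
        have : 1 + ∫ z, W z ∂(P x) + ∫ z, W z ∂(P y) ≤ U := by linarith [hx.2, hy.2]
        gcongr
      have h1W : 1 ≤ 1 + W x + W y := by linarith [hW0 x, hW0 y]
      cases j with
      | zero =>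
        -- For `j = 0` only one factor `1 - ε` is owed, so the trivial bound 1 on differences of
        -- probabilities replaces the induction hypothesis.
        have := hc 1 0 zero_le_one le_rfl (fun u v => by
          rw [abs_le]
          constructor <;> linarith [hg0 u, hg0 v, hg1 u, hg1 v])
        refine this.trans ?_
        have h2 : 0 ≤ (α * U) ^ 0 / α ^ (k + 1) * (1 + W x + W y) := by positivity
        simp only [zero_add, pow_one]
        linarith
      | succ j =>
        -- One overlap step is paid for by lowering `j`; the missing factor `α` in the denominator
        -- is compensated by the extra `αU` in the numerator.
        have := hc _ _ (hp _) (hB _) (ih j)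
        refine this.trans ?_
        refine add_le_add (le_of_eq (by ring)) ?_
        have e : (α * U) ^ (j + 1) / α ^ (k + 1) = (α * U) ^ j / α ^ k * U := by
          rw [pow_succ, pow_succ]; field_simp
        rw [e]
        refine le_mul_of_one_le_right ?_ h1W
        have := hB j
        positivity

/-- A geometric drift condition bounds the stationary mean of the drift function. -/
theorem lintegral_le_of_invariant (P : Kernel S S) [IsMarkovKernel P] (π : Measure S)
    [IsProbabilityMeasure π] (hinv : P.Invariant π) (W : S → ℝ) (hW : Measurable W)
    (hW0 : ∀ x, 0 ≤ W x) {γ b : ℝ} (hγ0 : 0 ≤ γ) (hγ1 : γ < 1) (hb : 0 ≤ b)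
    (hdrift : ∀ x, ∫⁻ y, ENNReal.ofReal (W y) ∂(P x) ≤ ENNReal.ofReal (γ * W x + b)) :
    ∫⁻ x, ENNReal.ofReal (W x) ∂π ≤ ENNReal.ofReal (b / (1 - γ)) := by
  have hγ : 0 < 1 - γ := by linarith
  -- Integrability of `W` under `π` is not known in advance, so stationarity is applied to the
  -- bounded function `min(W, N)`.
  have trunc : ∀ N : ℝ, b / (1 - γ) ≤ N →
      ∫⁻ x, ENNReal.ofReal ({x | W x ≤ N}.indicator W x) ∂π ≤ ENNReal.ofReal (b / (1 - γ)) := by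
    intro N hN
    have hN0 : 0 ≤ N := le_trans (by positivity) hN
    have hbN : b ≤ (1 - γ) * N := by rwa [div_le_iff₀ hγ, mul_comm] at hN
    have hset : MeasurableSet {x | W x ≤ N} := measurableSet_le hW measurable_const
    have hint : ∀ f : S → ℝ, Measurable f → (∀ x, 0 ≤ f x) → (∀ x, f x ≤ N) → Integrable f π :=
      fun f hf h0 h1 => Integrable.of_bound hf.aestronglyMeasurable N
        (ae_of_all _ fun x => by rw [Real.norm_of_nonneg (h0 x)]; exact h1 x)
    have m1 : Measurable fun x => min (W x) N := hW.min measurable_const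
    have m2 : Measurable fun x => min (γ * W x + b) N :=
      ((hW.const_mul γ).add_const b).min measurable_const
    have n2 : ∀ x, 0 ≤ γ * W x + b := fun x => by have := hW0 x; positivity
    have i1 := hint _ m1 (fun x => le_min (hW0 x) hN0) (fun x => min_le_right _ _)
    have i2 := hint _ m2 (fun x => le_min (n2 x) hN0) (fun x => min_le_right _ _)
    have i3 := hint ({x | W x ≤ N}.indicator W) (hW.indicator hset)
      (fun x => Set.indicator_nonneg (fun x _ => hW0 x) x)
      (fun x => by
        by_cases hx : W x ≤ N
        · rw [Set.indicator_of_mem (by exact hx)]; exact hx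
        · rw [Set.indicator_of_notMem (by exact hx)]; exact hN0)
    have h12 : ∫ x, min (W x) N ∂π ≤ ∫ x, min (γ * W x + b) N ∂π := by
      rw [← ENNReal.ofReal_le_ofReal_iff (integral_nonneg fun x => le_min (n2 x) hN0),
        ofReal_integral_eq_lintegral_ofReal i1 (ae_of_all _ fun x => le_min (hW0 x) hN0),
        ofReal_integral_eq_lintegral_ofReal i2 (ae_of_all _ fun x => le_min (n2 x) hN0)]
      calc ∫⁻ x, ENNReal.ofReal (min (W x) N) ∂π
          = ∫⁻ x, ENNReal.ofReal (min (W x) N) ∂(π.bind P) := by rw [hinv.def]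
        _ = ∫⁻ x, ∫⁻ y, ENNReal.ofReal (min (W y) N) ∂(P x) ∂π :=
            Measure.lintegral_bind P.measurable.aemeasurable m1.ennreal_ofReal.aemeasurable
        _ ≤ _ := by
            refine lintegral_mono fun x => ?_
            rw [ENNReal.ofReal_min]
            refine le_min ((lintegral_mono fun y => ?_).trans (hdrift x)) ?_
            · exact ENNReal.ofReal_le_ofReal (min_le_left _ _)
            · refine (lintegral_mono fun y => ENNReal.ofReal_le_ofReal (min_le_right _ N)).trans ?_
              simp
    -- Where `W ≤ N`, the choice `N ≥ b/(1-γ)` gives `γW + b ≤ N`, so both truncations are inactive;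
    -- elsewhere the difference of the minima is nonnegative.
    have h3 : ∫ x, ((1 - γ) * {x | W x ≤ N}.indicator W x - b) ∂π ≤
        ∫ x, (min (W x) N - min (γ * W x + b) N) ∂π := by
      refine integral_mono ((i3.const_mul _).sub (integrable_const _)) (i1.sub i2) fun x => ?_
      by_cases hx : W x ≤ N
      · simp only [Set.indicator_of_mem (show x ∈ {x | W x ≤ N} from hx)]
        rw [min_eq_left hx, min_eq_left (by nlinarith)]
        linarith
      · simp only [Set.indicator_of_notMem (show x ∉ {x | W x ≤ N} from hx)]
        rw [min_eq_right (not_le.1 hx).le]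
        have := min_le_right (γ * W x + b) N
        linarith
    rw [integral_sub (i3.const_mul _) (integrable_const _), integral_sub i1 i2,
      integral_const_mul] at h3
    simp only [integral_const, probReal_univ, one_smul] at h3
    rw [← ofReal_integral_eq_lintegral_ofReal i3
      (ae_of_all _ fun x => Set.indicator_nonneg (fun x _ => hW0 x) x)]
    refine ENNReal.ofReal_le_ofReal ?_
    rw [le_div_iff₀ hγ]
    linarith
  have hmono : Monotone fun (N : ℕ) x => ENNReal.ofReal ({x | W x ≤ N}.indicator W x) := by
    intro M N hMN x
    refine ENNReal.ofReal_le_ofReal (Set.indicator_le_indicator_of_subset ?_ hW0 x)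
    intro y hy
    exact le_trans (show W y ≤ M from hy) (by exact_mod_cast hMN)
  have hmeas : ∀ N : ℕ, Measurable fun x => ENNReal.ofReal ({x | W x ≤ N}.indicator W x) :=
    fun N => (hW.indicator (measurableSet_le hW measurable_const)).ennreal_ofReal
  have htend := lintegral_tendsto_of_tendsto_of_monotone
    (f := fun (N : ℕ) x => ENNReal.ofReal ({x | W x ≤ N}.indicator W x))
    (F := fun x => ENNReal.ofReal (W x)) (μ := π) (fun N => (hmeas N).aemeasurable)
    (ae_of_all _ fun x M N hMN => hmono hMN x)
    (ae_of_all _ fun x => by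
      refine tendsto_const_nhds.congr' ?_
      obtain ⟨N₀, hN₀⟩ := exists_nat_ge (W x)
      filter_upwards [Filter.eventually_ge_atTop N₀] with N hN
      rw [Set.indicator_of_mem]
      exact hN₀.trans (by exact_mod_cast hN))
  refine le_of_tendsto htend ?_
  obtain ⟨N₀, hN₀⟩ := exists_nat_ge (b / (1 - γ))
  filter_upwards [Filter.eventually_ge_atTop N₀] with N hN
  exact trunc N (hN₀.trans (by exact_mod_cast hN))

theorem invariant_pow {P : Kernel S S} {π : Measure S} (hinv : P.Invariant π) (k : ℕ) :
    (P ^ k).Invariant π := by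
  induction k with
  | zero => rw [pow_zero]; exact Measure.bind_dirac
  | succ k ih => rw [pow_succ]; exact ih.comp hinv

/-- Stationarity writes `π(A)` as the `π`-average of `P^k(y, A)`, so the two-point bound is
integrated in `y`. -/
theorem abs_pow_sub_invariant_le (P : Kernel S S) [IsMarkovKernel P] (π : Measure S)
    [IsProbabilityMeasure π] (hinv : P.Invariant π) (W : S → ℝ) (hW : Measurable W)
    (hW0 : ∀ x, 0 ≤ W x) {A : Set S} (hA : MeasurableSet A) (k : ℕ) {M a b : ℝ} (hM : 0 ≤ M)
    (hb : 0 ≤ b) (hWπ : ∫⁻ x, ENNReal.ofReal (W x) ∂π ≤ ENNReal.ofReal M)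
    (h : ∀ x y, |((P ^ k) x).real A - ((P ^ k) y).real A| ≤ a + b * (1 + W x + W y)) (x : S) :
    |((P ^ k) x).real A - π.real A| ≤ a + b * (1 + M + W x) := by
  obtain ⟨hi, hle⟩ := integral_le_of_lintegral_ofReal_le hW hW0 hM hWπ
  have hmeas : Measurable fun z => ((P ^ k) z).real A :=
    ((P ^ k).measurable_coe hA).ennreal_toReal
  have hπ : π.real A = ∫ y, ((P ^ k) y).real A ∂π := by
    have : π A = ∫⁻ y, (P ^ k) y A ∂π := by
      conv_lhs => rw [← (invariant_pow hinv k).def]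
      exact Measure.bind_apply hA (P ^ k).aemeasurable
    rw [measureReal_def, this, ← integral_toReal]
    · rfl
    · exact ((P ^ k).measurable_coe hA).aemeasurable
    · exact ae_of_all _ fun y => measure_lt_top _ _
  have hgi : Integrable (fun z => ((P ^ k) z).real A) π :=
    Integrable.of_bound hmeas.aestronglyMeasurable 1
      (ae_of_all _ fun x => by
        rw [Real.norm_of_nonneg measureReal_nonneg]; exact measureReal_le_one)
  have e : ((P ^ k) x).real A - π.real A =
      ∫ y, (((P ^ k) x).real A - ((P ^ k) y).real A) ∂π := by
    rw [integral_sub (integrable_const _) hgi, hπ]; simp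
  rw [e]
  refine (abs_integral_le_of_abs_le π _ W (a + b * (1 + W x)) b hi fun y => ?_).trans ?_
  · exact (h x y).trans (le_of_eq (by ring))
  · rw [probReal_univ]
    have := mul_le_mul_of_nonneg_left hle hb
    linarith

end Coupling

/-! ### Real inequalities behind the drift-or-overlap dichotomy. -/

/-- The hypothesis is a quadratic inequality in `E` that fails below its positive root, and that
root grows like `x√2/4 ≈ 0.354x`. The left side of the conclusion grows only like `0.34x`, with a
constant below 1.67. Used with `x = αn` and `E = √(d/p)` to bound the overlap exponent. -/
theorem le_of_quadratic_growth {x E : ℝ} (hx : 0 ≤ x) (hE : 0 < E)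
    (h : (x + 3) * (E + √2) * (√2 / 4) ≤ E ^ 2) :
    1 + 9 / 32 * (x / 2 + (x + 10 / 3) * (√2 / 2)) ≤ E := by
  have hs : √2 ^ 2 = 2 := Real.sq_sqrt (by norm_num)
  have s1 : 1.414 ≤ √2 := Real.le_sqrt_of_sq_le (by norm_num)
  have s2 : √2 ≤ 1.415 := Real.sqrt_le_iff.2 ⟨by norm_num, by norm_num⟩
  set s := √2
  by_contra hlt
  push Not at hlt
  have hT : 1 + 9 / 32 * (x / 2 + (x + 10 / 3) * (s / 2)) ≤ 0.34 * x + 1.67 := by nlinarith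
  have hE1 : (x + 3) * (s / 4) < E := by
    by_contra hle
    push Not at hle
    have : 0 < (x + 3) * s * (s / 4) := by positivity
    nlinarith
  have hTE : E < 0.34 * x + 1.67 := hlt.trans_le hT
  set T := 0.34 * x + 1.67 with hTdef
  -- Beyond `(x+3)s/4` the quadratic is increasing in `E`, so its sign at `E` carries over to the
  -- larger `T`, where it is checked numerically.
  have h1 : (x + 3) * (T + s) * (s / 4) ≤ T ^ 2 := by nlinarith
  have h2 : 0.3535 * x + 1.0605 ≤ (x + 3) * (s / 4) := by nlinarith
  have h3 : (0.3535 * x + 1.0605) * (T + 1.414) ≤ (x + 3) * (s / 4) * (T + s) := by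
    have : 0 ≤ T := by positivity
    gcongr
  nlinarith

/-- The mean exceeds `x` by at most the root mean square deviation `q`; Young's inequality, applied
term by term, takes the place of Cauchy-Schwarz. -/
theorem sum_le_of_sum_sq_le {ι : Type*} (t : Finset ι) (f : ι → ℝ) {x q : ℝ} (hq : 0 < q)
    {m : ℝ} (h : ∑ j ∈ t, (f j - x) ^ 2 ≤ m * q ^ 2) (hm : t.card = m) :
    ∑ j ∈ t, f j ≤ m * (x + q) := by
  have hj : ∀ j ∈ t, f j ≤ x + q / 2 + (f j - x) ^ 2 * (1 / (2 * q)) := fun j _ => by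
    have : (f j - x) ^ 2 * (1 / (2 * q)) = (f j - x) ^ 2 / (2 * q) := by ring
    rw [this, ← sub_le_iff_le_add', le_div_iff₀ (by positivity)]
    nlinarith [sq_nonneg (f j - x - q)]
  refine (Finset.sum_le_sum hj).trans ?_
  rw [Finset.sum_add_distrib, Finset.sum_const, nsmul_eq_mul, hm, ← Finset.sum_mul]
  have : (∑ j ∈ t, (f j - x) ^ 2) * (1 / (2 * q)) ≤ m * q ^ 2 * (1 / (2 * q)) := by gcongr
  have e : m * q ^ 2 * (1 / (2 * q)) = m * (q / 2) := by field_simp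
  rw [e] at this
  linarith

/-- The constants of the drift condition in terms of `E = √(d / p)`. -/
theorem drift_constants_bounds {m k γ b d U α E : ℝ} (hm : 0 < m) (hk : 0 < k) (hγ0 : 0 < γ)
    (hb : b = m * k ^ 2 / (4 * γ) + m * k) (hd : d = m * E ^ 2)
    (hU : U = 1 + 2 * (γ * d + b)) (hα : α = (1 + d) / (1 + 2 * b + γ * d)) (hα1 : 1 ≤ α) :
    α * k * (2 + √2 * E) ≤ E ^ 2 ∧ 1 + 2 * m * k + 2 * k * m * E ≤ U := by
  have hs : √2 ^ 2 = 2 := Real.sq_sqrt (by norm_num)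
  have hs0 : 0 ≤ √2 := Real.sqrt_nonneg 2
  set s := √2
  have hb0 : 0 < b := by rw [hb]; positivity
  have hd0 : 0 ≤ d := by rw [hd]; positivity
  -- AM-GM removes `γ` from both conclusions: `y = √2` fits the combination `2b + γd` in `α`, and `y
  -- = 1` fits `b + γd` in `U`.
  have amgm : ∀ y : ℝ, k * y * E ≤ k ^ 2 * y ^ 2 / (4 * γ) + γ * E ^ 2 := fun y => by
    rw [← sub_le_iff_le_add, le_div_iff₀ (by positivity)]
    nlinarith [sq_nonneg (k * y - 2 * γ * E)]
  constructor
  · have h1 : α * (1 + 2 * b + γ * d) = 1 + d := by rw [hα]; field_simp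
    have h2 : m * (k * (2 + s * E)) ≤ 2 * b + γ * d := by
      have := mul_le_mul_of_nonneg_left (amgm s) hm.le
      rw [hb, hd]
      have e : m * (k ^ 2 * s ^ 2 / (4 * γ) + γ * E ^ 2) =
        2 * (m * k ^ 2 / (4 * γ)) + γ * (m * E ^ 2) := by rw [hs]; ring
      nlinarith
    have h3 : α * (m * (k * (2 + s * E))) ≤ m * E ^ 2 := by
      have := mul_le_mul_of_nonneg_left h2 (by linarith : 0 ≤ α)
      nlinarith
    have : m * (α * k * (2 + s * E)) ≤ m * E ^ 2 := by linarith
    exact le_of_mul_le_mul_left this hm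
  · have := mul_le_mul_of_nonneg_left (amgm 1) hm.le
    rw [hU, hd, hb]
    have e : m * (k ^ 2 * 1 ^ 2 / (4 * γ) + γ * E ^ 2) =
      m * k ^ 2 / (4 * γ) + γ * (m * E ^ 2) := by ring
    linarith

/-- Dividing the failed drift inequality by `(k/N)²` leaves a quadratic in `(v, w)` with linear
coefficient `αN = x`. Completing the square places the pair in a ball whose centre has all
coordinates `x/2`. -/
theorem sum_sq_le_of_lt {N k α x : ℝ} (hN : 2 ≤ N) (hp : (1 : ℝ) ≤ p) (hk : k = (N + 3) / 4)
    (hα : 1 ≤ α) (hx : x = α * N) (v w : Fin p → ℝ)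
    (h : 1 + (k / N) ^ 2 * ∑ j, v j ^ 2 + (k / N) ^ 2 * ∑ j, w j ^ 2 <
      α * (1 + k ^ 2 / N * ∑ j, (v j + 1) + k ^ 2 / N * ∑ j, (w j + 1))) :
    ∑ j, ((v j - x / 2) ^ 2 + (w j - x / 2) ^ 2) ≤ p * ((x + 10 / 3) ^ 2 / 2) := by
  have hN0 : N ≠ 0 := by positivity
  have hk0 : 0 < k := by rw [hk]; linarith
  have hx0 : 0 ≤ x := by rw [hx]; positivity
  have e1 : ∑ j, ((v j - x / 2) ^ 2 + (w j - x / 2) ^ 2) = ∑ j, v j ^ 2 + ∑ j, w j ^ 2 -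
      x * (∑ j, (v j + 1) + ∑ j, (w j + 1)) + p * (x ^ 2 / 2 + 2 * x) := by
    have hc : (p : ℝ) = ∑ _j : Fin p, (1 : ℝ) := by simp
    rw [hc, Finset.sum_mul, ← Finset.sum_add_distrib, ← Finset.sum_add_distrib, Finset.mul_sum,
      ← Finset.sum_sub_distrib, ← Finset.sum_add_distrib]
    exact Finset.sum_congr rfl fun j _ => by ring
  rw [e1]
  generalize ∑ j, v j ^ 2 = a at *
  generalize ∑ j, w j ^ 2 = b at *
  generalize ∑ j, (v j + 1) = s at *
  generalize ∑ j, (w j + 1) = t at *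
  have e2 : (k / N) ^ 2 * (a + b - x * (s + t)) ≤ α := by
    have : (k / N) ^ 2 * (x * (s + t)) = α * (k ^ 2 / N * (s + t)) := by
      rw [hx]; field_simp
    rw [mul_sub, this]
    linarith
  have e3 : a + b - x * (s + t) ≤ 4 / 3 * x := by
    have hkN : 0 < (k / N) ^ 2 := by positivity
    refine le_of_mul_le_mul_left (e2.trans ?_) hkN
    -- This is `(N+3)² ≥ 12N`, with equality at `N = 3`. With `k = (N+3)/4` the constant terms
    -- therefore cost at most `4x/3`, and `2x + 4x/3` is the cross term of `(x + 10/3)²/2`.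
    have : 3 ≤ 4 * (k ^ 2 / N) := by
      rw [← mul_div_assoc, le_div_iff₀ (by linarith), hk]
      linarith [sq_nonneg (N - 3)]
    have e : (k / N) ^ 2 * (4 / 3 * x) = α * (4 * (k ^ 2 / N)) / 3 := by
      rw [hx]; field_simp
    rw [e]
    linarith [mul_le_mul_of_nonneg_left this (by linarith : 0 ≤ α)]
  have e4 : 4 / 3 * x ≤ p * (4 / 3 * x) := le_mul_of_one_le_left (by positivity) hp
  have e5 : (p : ℝ) * ((x + 10 / 3) ^ 2 / 2) =
    p * (x ^ 2 / 2 + 2 * x) + p * (4 / 3 * x) + p * (50 / 9) := by ring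
  linarith

/-- The claim is `z ≤ E - 2/3`. A larger `z` would violate the quadratic bound as soon as `E ≥ 1`,
and `z ≥ 5/4` rules out `E < 1`. -/
theorem two_mul_add_le_of_mul_le_sq {z E : ℝ} (hE : 0 ≤ E) (hz : 5 / 4 ≤ z)
    (h : z * (2 + √2 * E) ≤ E ^ 2) : 2 * z + 10 / 3 ≤ 2 + 2 * E := by
  have hs : 1.4 ≤ √2 := Real.le_sqrt_of_sq_le (by norm_num)
  have h1 : z * (2 + 1.4 * E) ≤ E ^ 2 := by
    refine le_trans ?_ h
    gcongr
  have hE1 : 1 ≤ E := by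
    by_contra hlt
    push Not at hlt
    nlinarith [mul_nonneg (by linarith : 0 ≤ z) hE]
  by_contra hlt
  push Not at hlt
  have : (E - 2 / 3) * (2 + 1.4 * E) ≤ z * (2 + 1.4 * E) := by
    gcongr
    linarith
  nlinarith

/-- Either the drift towards small values dominates, or the pair lies in a bounded region, where
the drift bound is at most `U` and the overlap exponent is at most `p √d`. -/
theorem drift_or_overlap {N γ b d U α : ℝ} (hN : 2 ≤ N) (hγ0 : 0 < γ) (hγ1 : γ < 1)
    (hb : b = ((N + 3) * p) * (16 * γ + (N + 3)) / (64 * γ)) (hd : 2 * b / (1 - γ) < d)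
    (hU : U = 1 + 2 * (γ * d + b)) (hα : α = (1 + d) / (1 + 2 * b + γ * d))
    (v w : Fin p → ℝ) :
    α * (1 + ((N + 3) / 4) ^ 2 / N * ∑ j, (v j + 1) + ((N + 3) / 4) ^ 2 / N * ∑ j, (w j + 1)) ≤
        1 + (((N + 3) / 4) / N) ^ 2 * ∑ j, v j ^ 2 + (((N + 3) / 4) / N) ^ 2 * ∑ j, w j ^ 2 ∨
      (1 + ((N + 3) / 4) ^ 2 / N * ∑ j, (v j + 1) + ((N + 3) / 4) ^ 2 / N * ∑ j, (w j + 1) ≤ U ∧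
        ∑ j, (1 + 9 / 32 * max (v j) (w j)) ≤ p * √d) := by
  obtain ⟨k, hk⟩ : ∃ k, k = (N + 3) / 4 := ⟨_, rfl⟩
  rw [← hk]
  have hγ : 0 < 1 - γ := by linarith
  have hp0 : (0 : ℝ) ≤ p := Nat.cast_nonneg p
  have hb0 : 0 ≤ b := by rw [hb]; positivity
  have hd0 : 0 < d := lt_of_le_of_lt (by positivity) hd
  have hα1 : 1 ≤ α := by
    rw [div_lt_iff₀ hγ] at hd
    rw [hα, le_div_iff₀ (by positivity)]
    linarith
  -- With no coefficients all sums are empty and the second alternative is immediate; below, `1 ≤ p`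
  -- is needed.
  rcases Nat.eq_zero_or_pos p with rfl | hp
  · right
    simp only [Finset.univ_eq_empty, Finset.sum_empty, Nat.cast_zero, zero_mul, mul_zero, add_zero,
      le_refl, and_true]
    rw [hU]
    have : 0 ≤ γ * d := by positivity
    linarith
  have hp1 : (1 : ℝ) ≤ p := by exact_mod_cast hp
  by_cases hout : α * (1 + k ^ 2 / N * ∑ j, (v j + 1) + k ^ 2 / N * ∑ j, (w j + 1)) ≤
        1 + (k / N) ^ 2 * ∑ j, v j ^ 2 + (k / N) ^ 2 * ∑ j, w j ^ 2
  · exact Or.inl hout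
  right
  push Not at hout
  have hk0 : 0 < k := by rw [hk]; linarith
  obtain ⟨E, hE⟩ : ∃ E, E = √(d / p) := ⟨_, rfl⟩
  have hE0 : 0 < E := by rw [hE]; positivity
  have hdE : d = p * E ^ 2 := by rw [hE, Real.sq_sqrt (by positivity)]; field_simp
  obtain ⟨hαE, hUE⟩ := drift_constants_bounds (by linarith : (0 : ℝ) < p) hk0 hγ0
    (by rw [hb, hk]; field_simp; ring) hdE hU hα hα1
  have hEd : E ≤ √d := by
    rw [hE]
    exact Real.sqrt_le_sqrt (div_le_self hd0.le hp1)
  obtain ⟨x, hx⟩ : ∃ x, x = α * N := ⟨_, rfl⟩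
  have hx0 : 0 ≤ x := by rw [hx]; positivity
  -- the region is a ball
  have hball := sum_sq_le_of_lt hN hp1 hk hα1 hx v w hout
  have hs : √2 ^ 2 = 2 := Real.sq_sqrt (by norm_num)
  have hs0 : 0 < √2 := by positivity
  constructor
  -- The deviation of `v_j + w_j` from `x` satisfies `(s + t)² ≤ 2(s² + t²)`, so the radius of the
  -- ball gives root mean square deviation `x + 10/3`.
  · have hsum : ∑ j, (v j + w j) ≤ p * (2 * x + 10 / 3) := by
      have := sum_le_of_sum_sq_le Finset.univ (fun j : Fin p => v j + w j) (x := x)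
        (q := x + 10 / 3) (m := p) (by linarith) (by
          have h2 : ∑ j, (v j + w j - x) ^ 2 ≤
              2 * ∑ j, ((v j - x / 2) ^ 2 + (w j - x / 2) ^ 2) := by
            rw [Finset.mul_sum]
            exact Finset.sum_le_sum fun j _ => by linarith [sq_nonneg (v j - w j)]
          linarith) (by simp)
      linarith
    have e : ∑ j, (v j + 1) + ∑ j, (w j + 1) = ∑ j, (v j + w j) + 2 * p := by
      simp only [Finset.sum_add_distrib]
      simp; ring
    have h1 : 1 + k ^ 2 / N * ∑ j, (v j + 1) + k ^ 2 / N * ∑ j, (w j + 1) ≤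
        1 + k ^ 2 / N * (p * (2 * x + 16 / 3)) := by
      rw [add_assoc, ← mul_add, e]
      gcongr
      linarith
    refine h1.trans (le_trans ?_ hUE)
    have h2 : k ^ 2 / N * (p * (2 * x + 16 / 3)) = p * k * (2 * (α * k) + 16 / 3 * (k / N)) := by
      rw [hx]; field_simp
    -- The extreme case is `N = 2`. It turns `(16/3)(k/N)` into the `10/3` that
    -- `two_mul_add_le_of_mul_le_sq` can absorb.
    have h3 : k / N ≤ 5 / 8 := by
      rw [div_le_iff₀ (by linarith), hk]; linarith
    have h4 : 2 * (α * k) + 10 / 3 ≤ 2 + 2 * E :=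
      two_mul_add_le_of_mul_le_sq hE0.le (by
        have : 5 / 4 ≤ k := by rw [hk]; linarith
        linarith [mul_le_mul_of_nonneg_right hα1 hk0.le]) hαE
    have : p * k * (2 * (α * k) + 16 / 3 * (k / N)) ≤ p * k * (2 + 2 * E) :=
      mul_le_mul_of_nonneg_left (by linarith) (by positivity)
    linarith
  · have hmax : ∑ j, max (v j) (w j) ≤ p * (x / 2 + (x + 10 / 3) * (√2 / 2)) := by
      refine sum_le_of_sum_sq_le Finset.univ (fun j : Fin p => max (v j) (w j)) (x := x / 2)
        (q := (x + 10 / 3) * (√2 / 2)) (m := p) (by positivity) ?_ (by simp)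
      have e : ((x + 10 / 3) * (√2 / 2)) ^ 2 = (x + 10 / 3) ^ 2 / 2 := by
        rw [mul_pow, div_pow, hs]; ring
      rw [e]
      refine le_trans (Finset.sum_le_sum fun j _ => ?_) hball
      rcases max_choice (v j) (w j) with h | h <;> rw [h]
      · exact le_add_of_nonneg_right (sq_nonneg _)
      · exact le_add_of_nonneg_left (sq_nonneg _)
    have hgrow := le_of_quadratic_growth hx0 hE0 (by
      have h1 : x + 3 ≤ 4 * (α * k) := by rw [hx, hk]; linarith
      have h2 : α * k * (2 + √2 * E) = 4 * (α * k) * (E + √2) * (√2 / 4) := by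
        linear_combination (-(α * k)) * hs
      rw [h2] at hαE
      refine le_trans ?_ hαE
      gcongr)
    rw [Finset.sum_add_distrib, ← Finset.mul_sum]
    simp only [Finset.sum_const, Finset.card_univ, Fintype.card_fin, nsmul_eq_mul, mul_one]
    calc (p : ℝ) + 9 / 32 * ∑ j, max (v j) (w j)
        ≤ p + 9 / 32 * (p * (x / 2 + (x + 10 / 3) * (√2 / 2))) := by gcongr
      _ = p * (1 + 9 / 32 * (x / 2 + (x + 10 / 3) * (√2 / 2))) := by ring
      _ ≤ p * √d := by
        gcongr
        exact hgrow.trans hEd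

/-! ### Total mass and mean of the density of a single `τ_j`. -/

-- The antiderivatives used below involve `u/√t`, whose value at `t = 0` is a junk value, so `G` is
-- redefined at 0 by its limit before the fundamental theorem applies.
open Filter Topology in
theorem lintegral_Ioi_zero_of_hasDerivAt {G g : ℝ → ℝ} {l₀ l : ℝ}
    (hderiv : ∀ t, 0 < t → HasDerivAt G (g t) t) (hg : ∀ t, 0 < t → 0 ≤ g t)
    (h0 : Tendsto G (𝓝[>] 0) (𝓝 l₀)) (h1 : Tendsto G atTop (𝓝 l)) :
    ∫⁻ t in Set.Ioi 0, ENNReal.ofReal (g t) = ENNReal.ofReal (l - l₀) := by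
  have hc : ContinuousWithinAt (Function.update G 0 l₀) (Set.Ici 0) 0 := by
    rw [continuousWithinAt_update_same, Set.Ici_sdiff_left]
    exact h0
  have hd : ∀ t ∈ Set.Ioi (0 : ℝ), HasDerivAt (Function.update G 0 l₀) (g t) t := by
    intro t ht
    refine (hderiv t ht).congr_of_eventuallyEq ?_
    filter_upwards [eventually_ne_nhds (ne_of_gt ht)] with s hs
    exact Function.update_of_ne hs _ _
  have ht : Tendsto (Function.update G 0 l₀) atTop (𝓝 l) := by
    refine h1.congr' ?_
    filter_upwards [eventually_gt_atTop 0] with s hs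
    exact (Function.update_of_ne hs.ne' _ _).symm
  rw [← ofReal_integral_eq_lintegral_ofReal (integrableOn_Ioi_deriv_of_nonneg hc hd hg ht)
    ((ae_restrict_iff' measurableSet_Ioi).2 (ae_of_all _ hg)),
    integral_Ioi_of_hasDerivAt_of_nonneg hc hd hg ht, Function.update_self]

local notation "φ" => gaussianPDFReal 0 1
local notation "Φ" => cdf (gaussianReal 0 1)

theorem gaussianPDFReal_std (z : ℝ) : φ z = (√(2 * Real.pi))⁻¹ * Real.exp (-(z ^ 2) / 2) := by
  simp [gaussianPDFReal]

theorem hasDerivAt_cdf_std (z : ℝ) : HasDerivAt Φ (φ z) z := by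
  have hcont : Continuous φ := by
    have : φ = fun z => (√(2 * Real.pi))⁻¹ * Real.exp (-(z ^ 2) / 2) :=
      funext gaussianPDFReal_std
    rw [this]; fun_prop
  have hi := integrable_gaussianPDFReal 0 1
  have h : ∀ x, Φ x = ∫ y in Set.Iic x, φ y := fun x => by
    rw [cdf_eq_real, measureReal_def, gaussianReal_apply_eq_integral _ one_ne_zero,
      ENNReal.toReal_ofReal (integral_nonneg fun y => gaussianPDFReal_nonneg _ _ _)]
  have h' : (Φ : ℝ → ℝ) = fun x => (∫ y in (0 : ℝ)..x, φ y) + Φ 0 := by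
    funext x
    rw [← intervalIntegral.integral_Iic_sub_Iic hi.integrableOn hi.integrableOn, h, h]
    ring
  rw [h']
  exact (intervalIntegral.integral_hasDerivAt_right hi.intervalIntegrable
    (hcont.stronglyMeasurableAtFilter _ _) hcont.continuousAt).add_const _

/-- Density of `τ` when `1/τ` is inverse Gaussian with mean `a / u` and shape `a²`. -/
def tauFactor (a u t : ℝ) : ℝ :=
  if 0 < t then a / √(2 * Real.pi * t) * Real.exp (a * u - u ^ 2 / (2 * t) - a ^ 2 * t / 2) else 0

theorem tauFactor_nonneg {a : ℝ} (ha : 0 ≤ a) (u t : ℝ) : 0 ≤ tauFactor a u t := by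
  unfold tauFactor; split_ifs <;> positivity

theorem measurable_tauFactor (a u : ℝ) : Measurable (tauFactor a u) := by
  unfold tauFactor
  refine Measurable.ite measurableSet_Ioi ?_ measurable_const
  fun_prop

/-- The exponent is the perfect square `-(a√t - u/√t)²/2`, which makes the density accessible to
antiderivatives built from the normal distribution function. -/
theorem tauFactor_eq {a u t : ℝ} (ht : 0 < t) :
    tauFactor a u t = a / √t * φ (a * √t - u / √t) := by
  rw [tauFactor, if_pos ht, gaussianPDFReal_std, Real.sqrt_mul (by positivity)]
  have hr : 0 < √t := Real.sqrt_pos.2 ht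
  have e : -((a * √t - u / √t) ^ 2) / 2 = a * u - u ^ 2 / (2 * t) - a ^ 2 * t / 2 := by
    have : (a * √t - u / √t) ^ 2 = a ^ 2 * t - 2 * a * u + u ^ 2 / t := by
      rw [sub_sq, mul_pow, div_pow, Real.sq_sqrt ht.le]; field_simp
    rw [this]; field_simp; ring
  rw [e]; field_simp

theorem exp_mul_gaussianPDFReal {a u t : ℝ} (ht : 0 < t) :
    Real.exp (2 * (a * u)) * φ (a * √t + u / √t) = φ (a * √t - u / √t) := by
  rw [gaussianPDFReal_std, gaussianPDFReal_std, mul_left_comm, ← Real.exp_add]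
  congr 2
  have hr : 0 < √t := Real.sqrt_pos.2 ht
  field_simp; ring

theorem gaussianPDFReal_neg (z : ℝ) : φ (-z) = φ z := by
  rw [gaussianPDFReal_std, gaussianPDFReal_std, neg_sq]

theorem hasDerivAt_arg (a u : ℝ) {t : ℝ} (ht : 0 < t) :
    HasDerivAt (fun t => a * √t - u / √t) ((a + u / t) / (2 * √t)) t := by
  have hr : 0 < √t := Real.sqrt_pos.2 ht
  have h := Real.hasDerivAt_sqrt ht.ne'
  refine ((h.const_mul a).sub ((hasDerivAt_const t u).div h hr.ne')).congr_deriv ?_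
  rw [Real.sq_sqrt ht.le]
  field_simp
  ring

section Antiderivatives

variable (a u : ℝ)

open Filter Topology

theorem tendsto_arg_atTop {a : ℝ} (ha : 0 < a) :
    Tendsto (fun t => a * √t - u / √t) atTop atTop := by
  have h1 : Tendsto (fun t => a * √t) atTop atTop :=
    Real.tendsto_sqrt_atTop.const_mul_atTop ha
  have h2 : Tendsto (fun t : ℝ => -(u / √t)) atTop (𝓝 0) := by
    simpa using (tendsto_const_nhds.div_atTop Real.tendsto_sqrt_atTop).neg
  simpa [sub_eq_add_neg] using h1.atTop_add h2

theorem tendsto_sqrt_zero : Tendsto (fun t : ℝ => √t) (𝓝[>] 0) (𝓝 0) := by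
  have : Tendsto (fun t : ℝ => √t) (𝓝 0) (𝓝 (√0)) := Real.continuous_sqrt.tendsto 0
  rw [Real.sqrt_zero] at this
  exact this.mono_left nhdsWithin_le_nhds

theorem tendsto_arg_zero {u : ℝ} (hu : 0 < u) :
    Tendsto (fun t => a * √t - u / √t) (𝓝[>] 0) atBot := by
  have h1 : Tendsto (fun t => a * √t) (𝓝[>] 0) (𝓝 0) := by
    simpa using tendsto_sqrt_zero.const_mul a
  have hs : Tendsto (fun t : ℝ => √t) (𝓝[>] 0) (𝓝[>] 0) :=
    tendsto_nhdsWithin_iff.2 ⟨tendsto_sqrt_zero, by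
      filter_upwards [self_mem_nhdsWithin] with t ht
      exact Real.sqrt_pos.2 ht⟩
  have h2 : Tendsto (fun t : ℝ => -(u / √t)) (𝓝[>] 0) atBot := by
    refine tendsto_neg_atTop_atBot.comp ?_
    simp only [div_eq_mul_inv]
    exact (tendsto_inv_nhdsGT_zero.comp hs).const_mul_atTop hu
  simpa [sub_eq_add_neg] using h1.add_atBot h2

theorem gaussianPDFReal_std_le (z : ℝ) : φ z ≤ 1 := by
  rw [gaussianPDFReal_std]
  refine mul_le_one₀ (inv_le_one_of_one_le₀ ?_) (Real.exp_nonneg _) (Real.exp_le_one_iff.2 ?_)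
  · rw [Real.one_le_sqrt]; linarith [Real.pi_gt_three]
  · have := sq_nonneg z; linarith

/-- `∫ f = 1` and `∫ a² t f = 1 + a u` for the density `f = tauFactor a u`, through a common
antiderivative. -/
theorem lintegral_tauFactor_affine {a u : ℝ} (ha : 0 < a) (hu : 0 ≤ u) {c : ℝ} (hc : 0 ≤ c) :
    ∫⁻ t in Set.Ioi 0, ENNReal.ofReal ((1 + c * (a ^ 2 * t)) * tauFactor a u t) =
      ENNReal.ofReal (1 + c * (1 + a * u)) := by
  -- The antiderivative combines the normal distribution function at `±a√t - u/√t`, as in the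
  -- inverse Gaussian distribution function, with a multiple of `√t φ` that accounts for the linear
  -- weight. The factor `exp(2au)` in `k₂` turns both derivatives into multiples of the same
  -- Gaussian density.
  set k₁ := 1 + c * (1 + a * u)
  set k₂ := (1 + c * (1 - a * u)) * Real.exp (2 * (a * u)) with hk₂
  have key := lintegral_Ioi_zero_of_hasDerivAt (l₀ := 0) (l := k₁)
    (G := fun t => k₁ * Φ (a * √t - u / √t) - k₂ * Φ (-a * √t - u / √t) -
      c * (2 * a * (√t * φ (a * √t - u / √t))))
    (g := fun t => (1 + c * (a ^ 2 * t)) * tauFactor a u t) ?_ ?_ ?_ ?_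
  · rw [key, sub_zero]
  · intro t ht
    have hr : 0 < √t := Real.sqrt_pos.2 ht
    have hsq : √t ^ 2 = t := Real.sq_sqrt ht.le
    have hφ : HasDerivAt φ (-(a * √t - u / √t) * φ (a * √t - u / √t)) (a * √t - u / √t) := by
      have hf : φ = fun z => (√(2 * Real.pi))⁻¹ * Real.exp (-(z ^ 2) / 2) :=
        funext gaussianPDFReal_std
      rw [hf]
      refine (((((hasDerivAt_id' _).pow 2).neg.div_const 2).exp).const_mul _).congr_deriv ?_
      push_cast
      ring
    have d1 := (hasDerivAt_cdf_std _).comp t (hasDerivAt_arg a u ht)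
    have d2 := (hasDerivAt_cdf_std _).comp t (hasDerivAt_arg (-a) u ht)
    have d3 := (Real.hasDerivAt_sqrt ht.ne').mul (hφ.comp t (hasDerivAt_arg a u ht))
    refine (((d1.const_mul k₁).sub (d2.const_mul k₂)).sub
      ((d3.const_mul (2 * a)).const_mul c)).congr_deriv ?_
    have e2 : φ (-a * √t - u / √t) = φ (a * √t + u / √t) := by
      rw [← gaussianPDFReal_neg]; congr 1; ring
    have e3 : k₂ * (φ (-a * √t - u / √t) * ((-a + u / t) / (2 * √t))) =
        (1 + c * (1 - a * u)) * (φ (a * √t - u / √t) * ((-a + u / t) / (2 * √t))) := by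
      rw [e2, ← exp_mul_gaussianPDFReal ht, hk₂]; ring
    rw [e3, tauFactor_eq ht]
    simp only [Function.comp]
    generalize φ (a * √t - u / √t) = y
    generalize √t = r at *
    subst hsq
    field_simp
    ring
  · intro t ht
    exact mul_nonneg (by positivity) (tauFactor_nonneg ha.le _ _)
  · have h3 : Tendsto (fun t => c * (2 * a * (√t * φ (a * √t - u / √t)))) (𝓝[>] 0) (𝓝 0) := by
      have : Tendsto (fun t => √t * φ (a * √t - u / √t)) (𝓝[>] 0) (𝓝 0) :=
        squeeze_zero (fun t => mul_nonneg (Real.sqrt_nonneg _) (gaussianPDFReal_nonneg _ _ _))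
          (fun t => mul_le_of_le_one_right (Real.sqrt_nonneg _) (gaussianPDFReal_std_le _))
          tendsto_sqrt_zero
      simpa using (this.const_mul (2 * a)).const_mul c
    -- For `u = 0` the arguments tend to 0 instead of `-∞`; the limit is still 0 because then `k₁ =
    -- k₂`.
    rcases hu.eq_or_lt with rfl | hu
    · have hcont : Continuous Φ := continuous_iff_continuousAt.2 fun z =>
        (hasDerivAt_cdf_std z).continuousAt
      have h : ∀ b : ℝ, Tendsto (fun t => Φ (b * √t - 0 / √t)) (𝓝[>] 0) (𝓝 (Φ 0)) := fun b => by
        refine (hcont.tendsto 0).comp ?_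
        simpa using tendsto_sqrt_zero.const_mul b
      have := (((h a).const_mul k₁).sub ((h (-a)).const_mul k₂)).sub h3
      have e : k₁ * Φ 0 - k₂ * Φ 0 - 0 = 0 := by simp [k₁, k₂]
      rwa [e] at this
    · have h : ∀ b : ℝ, Tendsto (fun t => Φ (b * √t - u / √t)) (𝓝[>] 0) (𝓝 0) := fun b =>
        (tendsto_cdf_atBot _).comp (tendsto_arg_zero b hu)
      have := (((h a).const_mul k₁).sub ((h (-a)).const_mul k₂)).sub h3
      simpa using this
  · have h1 : Tendsto (fun t => Φ (a * √t - u / √t)) atTop (𝓝 1) :=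
      (tendsto_cdf_atTop _).comp (tendsto_arg_atTop u ha)
    have h2 : Tendsto (fun t => Φ (-a * √t - u / √t)) atTop (𝓝 0) := by
      refine (tendsto_cdf_atBot _).comp ?_
      have := tendsto_neg_atTop_atBot.comp (tendsto_arg_atTop (-u) ha)
      refine this.congr fun t => ?_
      simp only [Function.comp]; ring
    have h3 : Tendsto (fun t => √t * φ (a * √t - u / √t)) atTop (𝓝 0) := by
      have hz := tendsto_arg_atTop u ha
      have h4 : Tendsto (fun z : ℝ => z * φ z) atTop (𝓝 0) := by
        have := (Real.tendsto_pow_mul_exp_neg_atTop_nhds_zero 1).comp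
          (tendsto_id (α := ℝ) (x := atTop))
        refine squeeze_zero' (g := fun z : ℝ => Real.exp (1 / 2) * (z ^ 1 * Real.exp (-z)))
          ?_ ?_ ?_
        · filter_upwards [eventually_ge_atTop 0] with z hz
          exact mul_nonneg hz (gaussianPDFReal_nonneg _ _ _)
        · filter_upwards [eventually_ge_atTop 0] with z hz
          rw [mul_left_comm, ← Real.exp_add, pow_one]
          refine mul_le_mul_of_nonneg_left ?_ hz
          rw [gaussianPDFReal_std]
          have hs : (√(2 * Real.pi))⁻¹ ≤ 1 := inv_le_one_of_one_le₀ (by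
            rw [Real.one_le_sqrt]; linarith [Real.pi_gt_three])
          refine (mul_le_of_le_one_left (Real.exp_nonneg _) hs).trans (Real.exp_le_exp.2 ?_)
          nlinarith [sq_nonneg (z - 1)]
        · simpa using (Real.tendsto_pow_mul_exp_neg_atTop_nhds_zero 1).const_mul
            (Real.exp (1 / 2))
      have h5 := h4.comp hz
      -- Once `a√t ≥ 2u/√t`, the argument `z` satisfies `√t ≤ 2z/a`, so the decay of `zφ(z)`
      -- suffices.
      refine squeeze_zero' (g := fun t => 2 / a * ((a * √t - u / √t) * φ (a * √t - u / √t)))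
        ?_ ?_ ?_
      · exact Eventually.of_forall fun t =>
          mul_nonneg (Real.sqrt_nonneg _) (gaussianPDFReal_nonneg _ _ _)
      · filter_upwards [(tendsto_arg_atTop (2 * u) ha).eventually_ge_atTop 0] with t ht
        rw [← mul_assoc]
        refine mul_le_mul_of_nonneg_right ?_ (gaussianPDFReal_nonneg _ _ _)
        have e : 2 / a * (a * √t - u / √t) = √t + (a * √t - 2 * u / √t) / a := by
          field_simp; ring
        rw [e]
        have := div_nonneg ht ha.le
        linarith
      · simpa using h5.const_mul (2 / a)
    have := ((h1.const_mul k₁).sub (h2.const_mul k₂)).sub ((h3.const_mul (2 * a)).const_mul c)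
    simpa using this

end Antiderivatives

theorem lintegral_eq_setLIntegral_tauFactor (a u : ℝ) (g : ℝ → ℝ≥0∞) :
    ∫⁻ t, g t * ENNReal.ofReal (tauFactor a u t) =
      ∫⁻ t in Set.Ioi 0, g t * ENNReal.ofReal (tauFactor a u t) := by
  rw [← lintegral_indicator measurableSet_Ioi]
  congr 1
  funext t
  by_cases ht : 0 < t
  · rw [Set.indicator_of_mem (by exact ht)]
  · rw [Set.indicator_of_notMem (by exact ht), tauFactor, if_neg ht]; simp

theorem lintegral_tauFactor {a u : ℝ} (ha : 0 < a) (hu : 0 ≤ u) :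
    ∫⁻ t, ENNReal.ofReal (tauFactor a u t) = 1 := by
  have h1 := lintegral_eq_setLIntegral_tauFactor a u 1
  have h2 := lintegral_tauFactor_affine ha hu le_rfl
  simp only [Pi.one_apply, one_mul, zero_mul, add_zero, ENNReal.ofReal_one] at h1 h2
  rw [h1, h2]

theorem lintegral_mul_tauFactor {a u : ℝ} (ha : 0 < a) (hu : 0 ≤ u) :
    ∫⁻ t, ENNReal.ofReal (a ^ 2 * t) * ENNReal.ofReal (tauFactor a u t) =
      ENNReal.ofReal (1 + a * u) := by
  have h2 := lintegral_tauFactor_affine ha hu zero_le_one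
  have h3 : ∫⁻ t in Set.Ioi 0, ENNReal.ofReal ((1 + 1 * (a ^ 2 * t)) * tauFactor a u t) =
      ∫⁻ t in Set.Ioi 0, (ENNReal.ofReal (tauFactor a u t) +
        ENNReal.ofReal (a ^ 2 * t) * ENNReal.ofReal (tauFactor a u t)) := by
    refine setLIntegral_congr_fun measurableSet_Ioi fun t ht => ?_
    have ht' : (0 : ℝ) < t := ht
    have := tauFactor_nonneg ha.le u t
    rw [← ENNReal.ofReal_mul (by positivity), ← ENNReal.ofReal_add this (by positivity)]
    congr 1; ring
  rw [h3, lintegral_add_left (measurable_tauFactor a u).ennreal_ofReal] at h2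
  have h1 := lintegral_eq_setLIntegral_tauFactor a u 1
  simp only [Pi.one_apply, one_mul] at h1
  rw [← h1, lintegral_tauFactor ha hu, one_mul,
    ← lintegral_eq_setLIntegral_tauFactor a u fun t => ENNReal.ofReal (a ^ 2 * t),
    ENNReal.ofReal_add zero_le_one (by positivity), ENNReal.ofReal_one] at h2
  exact (ENNReal.add_right_inj ENNReal.one_ne_top).1 h2

/-! ### A common minorant of the densities of a single `τ_j`. -/

/-- The part of the density for `u = 0` that lies below all `tauFactor a u` with `a u ≤ m`. -/
def tauCommon (a m t : ℝ) : ℝ :=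
  if m / (2 * a ^ 2) < t then tauFactor a 0 t else 0

theorem measurable_tauCommon (a m : ℝ) : Measurable (tauCommon a m) :=
  Measurable.ite measurableSet_Ioi (measurable_tauFactor a 0) measurable_const

/-- Relative to `u = 0` the exponent changes by `au - u²/(2t)`, which is nonnegative exactly when `u
= 0` or `u ≤ 2at`; the cutoff `t > m/(2a²)` guarantees the latter. -/
theorem tauCommon_le {a u m : ℝ} (ha : 0 < a) (hu : 0 ≤ u) (hm : a * u ≤ m) (t : ℝ) :
    tauCommon a m t ≤ tauFactor a u t := by
  unfold tauCommon
  split_ifs with h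
  · unfold tauFactor
    split_ifs with ht
    · gcongr ?_ * Real.exp ?_
      have h1 : u ^ 2 / (2 * t) ≤ a * u := by
        rw [div_lt_iff₀ (by positivity)] at h
        rw [div_le_iff₀ (by positivity)]
        have : a * u ≤ t * (2 * a ^ 2) := hm.trans h.le
        have h2 : u ≤ t * (2 * a) := by
          refine le_of_mul_le_mul_left ?_ ha
          linarith
        nlinarith
      simp only [mul_zero, ne_eq, OfNat.ofNat_ne_zero, not_false_eq_true, zero_pow, zero_div]
      linarith
    · exact le_rfl
  · exact tauFactor_nonneg ha.le u t

/-- The factor `1/√t` is traded for a slightly faster exponential: `0.21 a √(2πt) ≤ exp(a²t/16)`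
lowers the integrand to a pure exponential of rate `9a²/16`, and at the cutoff `m/(2a²)` this rate
produces the exponent `9m/32`. -/
theorem le_lintegral_tauCommon {a m : ℝ} (ha : 0 < a) (hm : 0 ≤ m) :
    ENNReal.ofReal (Real.exp (-(1 + 9 / 32 * m))) ≤ ∫⁻ t, ENNReal.ofReal (tauCommon a m t) := by
  have hneg : -(9 / 16 * a ^ 2) < 0 := by
    have : 0 < a ^ 2 := by positivity
    linarith
  have hpt : ∀ t ∈ Set.Ioi (m / (2 * a ^ 2)),
      0.21 * a ^ 2 * Real.exp (-(9 / 16 * a ^ 2) * t) ≤ tauCommon a m t := by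
    intro t ht
    have ht0 : 0 < t := lt_of_le_of_lt (by positivity) ht
    rw [tauCommon, if_pos (by exact ht), tauFactor, if_pos ht0]
    have e : a * 0 - 0 ^ 2 / (2 * t) - a ^ 2 * t / 2 = a ^ 2 * t / 16 + -(9 / 16 * a ^ 2) * t := by
      ring
    rw [e, Real.exp_add, ← mul_assoc]
    refine mul_le_mul_of_nonneg_right ?_ (Real.exp_nonneg _)
    have hs : 0 < √(2 * Real.pi * t) := by positivity
    rw [div_mul_eq_mul_div, le_div_iff₀ hs]
    have key : 0.21 * a * √(2 * Real.pi * t) ≤ Real.exp (a ^ 2 * t / 16) := by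
      refine le_of_sq_le_sq ?_ (Real.exp_nonneg _)
      rw [mul_pow, Real.sq_sqrt (by positivity), ← Real.exp_nat_mul]
      have h2 := Real.quadratic_le_exp_of_nonneg (show 0 ≤ (2 : ℕ) * (a ^ 2 * t / 16) by positivity)
      refine le_trans ?_ h2
      have hpi := Real.pi_lt_d2
      have h3 : (0.21 * a) ^ 2 * (2 * Real.pi * t) ≤ (0.21 * a) ^ 2 * (2 * 3.15 * t) := by gcongr
      refine h3.trans ?_
      push_cast
      nlinarith [sq_nonneg (a ^ 2 * t / 8 - 1.217)]
    nlinarith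
  have hint := integrableOn_exp_mul_Ioi hneg (m / (2 * a ^ 2))
  calc ENNReal.ofReal (Real.exp (-(1 + 9 / 32 * m)))
      ≤ ENNReal.ofReal (∫ t in Set.Ioi (m / (2 * a ^ 2)),
          0.21 * a ^ 2 * Real.exp (-(9 / 16 * a ^ 2) * t)) := by
        refine ENNReal.ofReal_le_ofReal ?_
        rw [integral_const_mul, integral_exp_mul_Ioi hneg]
        have e1 : -(9 / 16 * a ^ 2) * (m / (2 * a ^ 2)) = -(9 / 32 * m) := by field_simp; ring
        rw [e1, neg_add, Real.exp_add]
        have e2 : 0.21 * a ^ 2 * (-Real.exp (-(9 / 32 * m)) / -(9 / 16 * a ^ 2)) =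
            (0.21 * 16 / 9) * Real.exp (-(9 / 32 * m)) := by field_simp
        rw [e2]
        refine mul_le_mul_of_nonneg_right ?_ (Real.exp_nonneg _)
        -- The constant is `0.21 · 16/9 ≈ 0.373`, just above `1/e`; this explains the summand 1 in
        -- the exponent.
        refine Real.exp_neg_one_lt_d9.le.trans (by norm_num)
    _ = ∫⁻ t in Set.Ioi (m / (2 * a ^ 2)),
          ENNReal.ofReal (0.21 * a ^ 2 * Real.exp (-(9 / 16 * a ^ 2) * t)) :=
        ofReal_integral_eq_lintegral_ofReal (hint.const_mul _)
          (ae_of_all _ fun t => by positivity)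
    _ ≤ ∫⁻ t in Set.Ioi (m / (2 * a ^ 2)), ENNReal.ofReal (tauCommon a m t) :=
        setLIntegral_mono (measurable_tauCommon a m).ennreal_ofReal
          fun t ht => ENNReal.ofReal_le_ofReal (hpt t ht)
    _ ≤ _ := setLIntegral_le_lintegral _ _

/-! ### The `τ` step, and drift and overlap of the composed kernel. -/

theorem lintegral_pi_prod : ∀ {p : ℕ} (f : Fin p → ℝ → ℝ≥0∞), (∀ j, Measurable (f j)) →
    ∫⁻ τ : Fin p → ℝ, ∏ j, f j (τ j) = ∏ j, ∫⁻ t, f j t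
  | 0, f, _ => by simp [volume_pi]
  | p + 1, f, hf => by
    have hm : Measurable fun z : ℝ × (Fin p → ℝ) => f 0 z.1 * ∏ j : Fin p, f j.succ (z.2 j) :=
      ((hf 0).comp measurable_fst).mul (Finset.measurable_prod _ fun j _ =>
        (hf j.succ).comp ((measurable_pi_apply j).comp measurable_snd))
    have h := (volume_preserving_piFinSuccAbove (fun _ : Fin (p + 1) => ℝ) 0).lintegral_comp hm
    have e : ∀ τ : Fin (p + 1) → ℝ, ∏ j, f j (τ j) =
        f 0 ((MeasurableEquiv.piFinSuccAbove (fun _ : Fin (p + 1) => ℝ) 0) τ).1 *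
          ∏ j : Fin p, f j.succ
            (((MeasurableEquiv.piFinSuccAbove (fun _ : Fin (p + 1) => ℝ) 0) τ).2 j) := fun τ => by
      rw [Fin.prod_univ_succ]
      simp [MeasurableEquiv.piFinSuccAbove, Fin.insertNthEquiv]
      rfl
    simp_rw [e]
    rw [h, Measure.volume_eq_prod, lintegral_prod_mul (f := f 0)
      (g := fun z : Fin p → ℝ => ∏ j, f j.succ (z j)) (hf 0).aemeasurable
      (Finset.measurable_prod _ fun j _ =>
        (hf j.succ).comp (measurable_pi_apply j)).aemeasurable,
      lintegral_pi_prod (fun j => f j.succ) fun j => hf j.succ, Fin.prod_univ_succ]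

/-- The standardized coefficient `|β_j| / σ`. -/
def stdCoef (x : State p) (j : Fin p) : ℝ := |x.1 j| / √(x.2 : ℝ)

theorem stdCoef_nonneg (x : State p) (j : Fin p) : 0 ≤ stdCoef x j := by
  unfold stdCoef; positivity

theorem stdCoef_sq (x : State p) (j : Fin p) : stdCoef x j ^ 2 = x.1 j ^ 2 / (x.2 : ℝ) := by
  rw [stdCoef, div_pow, sq_abs, Real.sq_sqrt (le_of_lt x.2.2)]

theorem measurable_stdCoef (j : Fin p) : Measurable fun x : State p => stdCoef x j := by
  unfold stdCoef; fun_prop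

theorem tauPDF_eq_prod (lam : ℝ) (x : State p) (τ : Fin p → ℝ) :
    tauPDF lam x.1 x.2 τ = ∏ j, tauFactor lam (stdCoef x j) (τ j) := by
  refine Finset.prod_congr rfl fun j _ => ?_
  unfold tauFactor
  split_ifs with h
  · have hs : (0 : ℝ) < x.2 := x.2.2
    congr 2
    rw [stdCoef_sq, stdCoef]
    field_simp
  · rfl

theorem ofReal_tauPDF (lam : ℝ) (hlam : 0 ≤ lam) (x : State p) (τ : Fin p → ℝ) :
    ENNReal.ofReal (tauPDF lam x.1 x.2 τ) =
      ∏ j, ENNReal.ofReal (tauFactor lam (stdCoef x j) (τ j)) := by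
  rw [tauPDF_eq_prod, ENNReal.ofReal_prod_of_nonneg fun j _ => tauFactor_nonneg hlam _ _]

theorem lintegral_tauPDF {lam : ℝ} (hlam : 0 < lam) (x : State p) :
    ∫⁻ τ, ENNReal.ofReal (tauPDF lam x.1 x.2 τ) = 1 := by
  simp_rw [ofReal_tauPDF lam hlam.le]
  rw [lintegral_pi_prod _ fun j => (measurable_tauFactor _ _).ennreal_ofReal]
  exact Finset.prod_eq_one fun j _ => lintegral_tauFactor hlam (stdCoef_nonneg x j)

theorem lintegral_mul_tauPDF {lam : ℝ} (hlam : 0 < lam) (x : State p) (j : Fin p) :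
    ∫⁻ τ, ENNReal.ofReal (lam ^ 2 * τ j) * ENNReal.ofReal (tauPDF lam x.1 x.2 τ) =
      ENNReal.ofReal (1 + lam * stdCoef x j) := by
  have e : ∀ τ : Fin p → ℝ,
      ENNReal.ofReal (lam ^ 2 * τ j) * ENNReal.ofReal (tauPDF lam x.1 x.2 τ) =
      ∏ i, (if i = j then ENNReal.ofReal (lam ^ 2 * τ i) else 1) *
        ENNReal.ofReal (tauFactor lam (stdCoef x i) (τ i)) := fun τ => by
    rw [ofReal_tauPDF lam hlam.le, Finset.prod_mul_distrib, Finset.prod_ite_eq']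
    simp
  simp_rw [e]
  rw [lintegral_pi_prod (fun i t => (if i = j then ENNReal.ofReal (lam ^ 2 * t) else 1) *
    ENNReal.ofReal (tauFactor lam (stdCoef x i) t)) fun i => ?_]
  · rw [Finset.prod_eq_single j]
    · simpa using lintegral_mul_tauFactor hlam (stdCoef_nonneg x j)
    · intro i _ hij
      simpa [hij] using lintegral_tauFactor hlam (stdCoef_nonneg x i)
    · simp
  · refine Measurable.mul ?_ (measurable_tauFactor _ _).ennreal_ofReal
    split_ifs <;> fun_prop

theorem tauPDF_eq_zero {lam : ℝ} {β : Fin p → ℝ} {s : ℝ} {τ : Fin p → ℝ} (h : ¬ ∀ j, 0 < τ j) :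
    tauPDF lam β s τ = 0 := by
  push Not at h
  obtain ⟨j, hj⟩ := h
  exact Finset.prod_eq_zero (Finset.mem_univ j) (if_neg hj.not_gt)

theorem measurable_ofReal_tauPDF (lam : ℝ) (x : State p) :
    Measurable fun τ => ENNReal.ofReal (tauPDF lam x.1 x.2 τ) :=
  (measurable_tauPDF lam).comp measurable_prodMk_left

theorem lintegral_gibbsKernel (X : Matrix (Fin n) (Fin p) ℝ) (Y : Fin n → ℝ) (lam : ℝ)
    (x : State p) {g : State p → ℝ≥0∞} (hg : Measurable g) :
    ∫⁻ y, g y ∂(gibbsKernel X Y lam x) =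
      ∫⁻ τ, ENNReal.ofReal (tauPDF lam x.1 x.2 τ) * ∫⁻ y, g y ∂(blockKernel X Y τ) := by
  rw [gibbsKernel, Kernel.lintegral_comp _ _ _ hg, tauKernel_apply,
    lintegral_withDensity_eq_lintegral_mul _ (measurable_ofReal_tauPDF lam x) hg.lintegral_kernel]
  rfl

theorem isMarkovKernel_gibbsKernel {X : Matrix (Fin n) (Fin p) ℝ} {Y : Fin n → ℝ} {lam : ℝ}
    (hlam : 0 < lam)
    (hblock : ∀ τ : Fin p → ℝ, (∀ j, 0 < τ j) → IsProbabilityMeasure (blockKernel X Y τ)) :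
    IsMarkovKernel (gibbsKernel X Y lam) := by
  refine ⟨fun x => ⟨?_⟩⟩
  have h := lintegral_gibbsKernel X Y lam x (g := 1) measurable_one
  simp only [Pi.one_apply, lintegral_one] at h
  rw [h, ← lintegral_tauPDF hlam x]
  refine lintegral_congr fun τ => ?_
  by_cases hτ : ∀ j, 0 < τ j
  · have := hblock τ hτ
    simp
  · simp [tauPDF_eq_zero hτ]

/-- A bound on the block step that is linear in `τ` is averaged with the exact mean of `λ²τ_j`. -/
theorem lintegral_gibbsKernel_le {X : Matrix (Fin n) (Fin p) ℝ} {Y : Fin n → ℝ} {lam : ℝ}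
    (hlam : 0 < lam) {W : State p → ℝ} (hW : Measurable W) {K : ℝ} (hK : 0 ≤ K)
    (hblock : ∀ τ : Fin p → ℝ, (∀ j, 0 < τ j) →
      ∫⁻ y, ENNReal.ofReal (W y) ∂(blockKernel X Y τ) ≤ ENNReal.ofReal (K * ∑ j, lam ^ 2 * τ j))
    (x : State p) :
    ∫⁻ y, ENNReal.ofReal (W y) ∂(gibbsKernel X Y lam x) ≤
      ENNReal.ofReal (K * ∑ j, (lam * stdCoef x j + 1)) := by
  rw [lintegral_gibbsKernel X Y lam x hW.ennreal_ofReal]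
  calc ∫⁻ τ, ENNReal.ofReal (tauPDF lam x.1 x.2 τ) *
        ∫⁻ y, ENNReal.ofReal (W y) ∂(blockKernel X Y τ)
      ≤ ∫⁻ τ, ENNReal.ofReal K * ∑ j, ENNReal.ofReal (lam ^ 2 * τ j) *
          ENNReal.ofReal (tauPDF lam x.1 x.2 τ) := by
        refine lintegral_mono fun τ => ?_
        by_cases hτ : ∀ j, 0 < τ j
        · refine (mul_le_mul_right (hblock τ hτ) _).trans (le_of_eq ?_)
          rw [ENNReal.ofReal_mul hK, ENNReal.ofReal_sum_of_nonneg fun j _ => by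
            have := hτ j; positivity, ← Finset.sum_mul]
          ring
        · simp [tauPDF_eq_zero hτ]
    _ = ENNReal.ofReal K * ∑ j, ENNReal.ofReal (1 + lam * stdCoef x j) := by
        have hm : ∀ j : Fin p, Measurable fun τ : Fin p → ℝ => ENNReal.ofReal (lam ^ 2 * τ j) *
            ENNReal.ofReal (tauPDF lam x.1 x.2 τ) := fun j =>
          Measurable.mul (by fun_prop) (measurable_ofReal_tauPDF lam x)
        rw [lintegral_const_mul _ (Finset.measurable_sum _ fun j _ => hm j),
          lintegral_finsetSum _ fun j _ => hm j]
        simp_rw [lintegral_mul_tauPDF hlam x]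
    _ = _ := by
        rw [ENNReal.ofReal_mul hK, ENNReal.ofReal_sum_of_nonneg fun j _ => by
          have := stdCoef_nonneg x j; positivity]
        simp_rw [add_comm]

/-- The witness is the product of the one-dimensional minorants, each cut off at the larger of the
two values of `λ|β_j|/σ`, pushed through the block kernel. Where the block kernel is Markov this
preserves mass, so the overlap factorizes over `j`. -/
theorem exists_common_component {X : Matrix (Fin n) (Fin p) ℝ} {Y : Fin n → ℝ} {lam : ℝ}
    (hlam : 0 < lam)
    (hblock : ∀ τ : Fin p → ℝ, (∀ j, 0 < τ j) → IsProbabilityMeasure (blockKernel X Y τ))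
    (x y : State p) :
    ∃ μ : Measure (State p), μ ≤ gibbsKernel X Y lam x ∧ μ ≤ gibbsKernel X Y lam y ∧
      Real.exp (-∑ j, (1 + 9 / 32 * max (lam * stdCoef x j) (lam * stdCoef y j))) ≤
        μ.real Set.univ := by
  have := isMarkovKernel_gibbsKernel hlam hblock
  set m : Fin p → ℝ := fun j => max (lam * stdCoef x j) (lam * stdCoef y j) with hm
  have hm0 : ∀ j, 0 ≤ m j := fun j =>
    le_max_of_le_left (mul_nonneg hlam.le (stdCoef_nonneg x j))
  set q : (Fin p → ℝ) → ℝ≥0∞ := fun τ => ∏ j, ENNReal.ofReal (tauCommon lam (m j) (τ j)) with hq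
  have hqm : Measurable q := Finset.measurable_prod _ fun j _ =>
    (measurable_tauCommon _ _).ennreal_ofReal.comp (measurable_pi_apply j)
  have hqle : ∀ z : State p, (∀ j, lam * stdCoef z j ≤ m j) → ∀ τ,
      q τ ≤ ENNReal.ofReal (tauPDF lam z.1 z.2 τ) := fun z hz τ => by
    rw [ofReal_tauPDF lam hlam.le]
    exact Finset.prod_le_prod' fun j _ =>
      ENNReal.ofReal_le_ofReal (tauCommon_le hlam (stdCoef_nonneg z j) (hz j) _)
  have happ : ∀ A, MeasurableSet A → (volume.withDensity q).bind (blockKernel X Y) A =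
      ∫⁻ τ, q τ * blockKernel X Y τ A := fun A hA => by
    rw [Measure.bind_apply hA (blockKernel X Y).aemeasurable,
      lintegral_withDensity_eq_lintegral_mul _ hqm ((blockKernel X Y).measurable_coe hA)]
    rfl
  have hle : ∀ z : State p, (∀ j, lam * stdCoef z j ≤ m j) →
      (volume.withDensity q).bind (blockKernel X Y) ≤ gibbsKernel X Y lam z := fun z hz => by
    refine Measure.le_iff.2 fun A hA => ?_
    rw [happ A hA]
    have h := lintegral_gibbsKernel X Y lam z (g := A.indicator 1) (measurable_one.indicator hA)
    simp only [lintegral_indicator_one hA] at h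
    rw [h]
    exact lintegral_mono fun τ => mul_le_mul_left (hqle z hz τ) _
  refine ⟨(volume.withDensity q).bind (blockKernel X Y), hle x fun j => le_max_left _ _,
    hle y fun j => le_max_right _ _, ?_⟩
  have hfin := isFiniteMeasure_of_le _ (hle x fun j => le_max_left _ _)
  rw [measureReal_def, ← ENNReal.ofReal_le_iff_le_toReal (measure_ne_top _ _),
    happ _ MeasurableSet.univ]
  calc ENNReal.ofReal (Real.exp (-∑ j, (1 + 9 / 32 * m j)))
      = ∏ j, ENNReal.ofReal (Real.exp (-(1 + 9 / 32 * m j))) := by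
        rw [← Finset.sum_neg_distrib, Real.exp_sum,
          ENNReal.ofReal_prod_of_nonneg fun j _ => Real.exp_nonneg _]
    _ ≤ ∏ j, ∫⁻ t, ENNReal.ofReal (tauCommon lam (m j) t) :=
        Finset.prod_le_prod' fun j _ => le_lintegral_tauCommon hlam (hm0 j)
    _ = ∫⁻ τ, q τ := (lintegral_pi_prod _ fun j => (measurable_tauCommon _ _).ennreal_ofReal).symm
    _ = _ := by
        refine lintegral_congr fun τ => ?_
        by_cases hτ : ∀ j, 0 < τ j
        · have := hblock τ hτ
          simp
        -- Outside the positive orthant the block kernel need not have mass 1, but `q` vanishes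
        -- there because the `τ`-density above it does.
        · have : q τ = 0 := le_antisymm (by
            simpa [tauPDF_eq_zero hτ] using hqle x (fun j => le_max_left _ _) τ) zero_le
          simp [this]

/-! ### Moments of the multivariate normal density. -/

section Normal

open Matrix

open scoped MatrixOrder in
theorem exists_eq_transpose_mul_self {P : Matrix (Fin p) (Fin p) ℝ} (hP : P.PosDef) :
    ∃ B : Matrix (Fin p) (Fin p) ℝ, P = Bᵀ * B ∧ B.det ≠ 0 := by
  obtain ⟨B, hB⟩ := CStarAlgebra.nonneg_iff_eq_star_mul_self.mp hP.posSemidef.nonneg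
  rw [star_eq_conjTranspose, conjTranspose_eq_transpose_of_trivial] at hB
  refine ⟨B, hB, fun h0 => ?_⟩
  have := hP.det_pos
  rw [hB, det_mul, h0, mul_zero] at this
  exact lt_irrefl _ this

/-- The standard normal distribution on `ℝᵖ`. -/
abbrev stdNormal (p : ℕ) : Measure (Fin p → ℝ) := Measure.pi fun _ => gaussianReal 0 1

theorem stdNormal_eq_withDensity :
    stdNormal p = volume.withDensity fun z => ∏ j, gaussianPDF 0 1 (z j) := by
  refine Measure.pi_eq fun s hs => ?_
  have hm : ∀ j, Measurable fun t => (s j).indicator (gaussianPDF 0 1) t := fun j =>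
    (measurable_gaussianPDF 0 1).indicator (hs j)
  rw [withDensity_apply _ (MeasurableSet.univ_pi hs), ← lintegral_indicator
    (MeasurableSet.univ_pi hs)]
  have e : ∀ z : Fin p → ℝ, (Set.univ.pi s).indicator (fun z => ∏ j, gaussianPDF 0 1 (z j)) z =
      ∏ j, (s j).indicator (gaussianPDF 0 1) (z j) := fun z => by
    by_cases hz : z ∈ Set.univ.pi s
    · rw [Set.indicator_of_mem hz]
      exact Finset.prod_congr rfl fun j _ => (Set.indicator_of_mem (hz j (Set.mem_univ j)) _).symm
    · rw [Set.indicator_of_notMem hz]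
      simp only [Set.mem_pi, Set.mem_univ, true_implies, not_forall] at hz
      obtain ⟨j, hj⟩ := hz
      exact (Finset.prod_eq_zero (Finset.mem_univ j) (Set.indicator_of_notMem hj _)).symm
  simp_rw [e]
  rw [lintegral_pi_prod _ hm]
  refine Finset.prod_congr rfl fun j _ => ?_
  rw [gaussianReal_of_var_ne_zero _ one_ne_zero, withDensity_apply _ (hs j),
    lintegral_indicator (hs j)]

/-- Substituting `x = m + B⁻¹z` turns the quadratic form into `Σ z_j²`, and the Jacobian cancels
`√det(BᵀB) = |det B|`. -/
theorem lintegral_mul_normalPDF (m : Fin p → ℝ) (B : Matrix (Fin p) (Fin p) ℝ) (hB : B.det ≠ 0)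
    {g : (Fin p → ℝ) → ℝ≥0∞} (hg : Measurable g) :
    ∫⁻ x, g x * ENNReal.ofReal (normalPDF m (Bᵀ * B) x) =
      ∫⁻ z, g (m + B⁻¹ *ᵥ z) ∂(stdNormal p) := by
  have hBu : IsUnit B.det := isUnit_iff_ne_zero.2 hB
  have hmulVec : ∀ M : Matrix (Fin p) (Fin p) ℝ, Measurable fun z : Fin p → ℝ => M *ᵥ z :=
    fun M => (Continuous.matrix_mulVec continuous_const continuous_id).measurable
  have hn : Measurable fun x => ENNReal.ofReal (normalPDF m (Bᵀ * B) x) := by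
    unfold normalPDF
    refine (Measurable.const_mul (Real.measurable_exp.comp ?_) _).ennreal_ofReal
    have h1 : Continuous fun x : Fin p → ℝ => (x - m) ⬝ᵥ ((Bᵀ * B) *ᵥ (x - m)) := by fun_prop
    exact h1.measurable.neg.div_const 2
  have hF : Measurable fun x => g x * ENNReal.ofReal (normalPDF m (Bᵀ * B) x) := hg.mul hn
  have hmap := Real.map_matrix_volume_pi_eq_smul_volume_pi (M := B⁻¹) (by
    rw [det_nonsing_inv, Ring.inverse_eq_inv']; exact inv_ne_zero hB)
  rw [det_nonsing_inv, Ring.inverse_eq_inv', inv_inv] at hmap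
  have h1 : ∫⁻ z, g (m + B⁻¹ *ᵥ z) * ENNReal.ofReal (normalPDF m (Bᵀ * B) (m + B⁻¹ *ᵥ z)) =
      ENNReal.ofReal |B.det| * ∫⁻ x, g x * ENNReal.ofReal (normalPDF m (Bᵀ * B) x) := by
    rw [← lintegral_add_left_eq_self (fun x => g x * ENNReal.ofReal (normalPDF m (Bᵀ * B) x)) m,
      ← smul_eq_mul (ENNReal.ofReal |B.det|), ← lintegral_smul_measure, ← hmap,
      lintegral_map (f := fun x => g (m + x) * ENNReal.ofReal (normalPDF m (Bᵀ * B) (m + x)))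
        (hF.comp (measurable_const_add m)) (toLin' B⁻¹).continuous_of_finiteDimensional.measurable]
    rfl
  have h2 : ∀ z, normalPDF m (Bᵀ * B) (m + B⁻¹ *ᵥ z) =
      |B.det| * ∏ j, gaussianPDFReal 0 1 (z j) := fun z => by
    have e1 : (m + B⁻¹ *ᵥ z - m) ⬝ᵥ ((Bᵀ * B) *ᵥ (m + B⁻¹ *ᵥ z - m)) = ∑ j, z j ^ 2 := by
      rw [add_sub_cancel_left, ← mulVec_mulVec, dotProduct_mulVec, ← mulVec_transpose,
        transpose_transpose, mulVec_mulVec, mul_nonsing_inv _ hBu, one_mulVec]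
      simp [dotProduct, sq]
    rw [normalPDF, e1, det_mul, det_transpose, Real.sqrt_mul_self_eq_abs]
    simp only [gaussianPDFReal_std]
    rw [Finset.prod_mul_distrib, ← Real.exp_sum, Finset.prod_const, Finset.card_univ,
      Fintype.card_fin, ← Finset.sum_div, Finset.sum_neg_distrib]
    rw [inv_pow]
    ring
  rw [stdNormal_eq_withDensity]
  have hφ : Measurable fun z : Fin p → ℝ => ∏ j, gaussianPDF 0 1 (z j) :=
    Finset.measurable_prod _ fun j _ => (measurable_gaussianPDF 0 1).comp (measurable_pi_apply j)
  have hgz : Measurable fun z => g (m + B⁻¹ *ᵥ z) := hg.comp ((hmulVec _).const_add m)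
  rw [lintegral_withDensity_eq_lintegral_mul _ hφ hgz]
  have hdet : ENNReal.ofReal |B.det| ≠ 0 := by simpa using hB
  rw [← ENNReal.mul_right_inj hdet ENNReal.ofReal_ne_top, ← h1,
    ← lintegral_const_mul _ (hφ.mul hgz)]
  refine lintegral_congr fun z => ?_
  rw [h2, ENNReal.ofReal_mul (abs_nonneg _),
    ENNReal.ofReal_prod_of_nonneg fun j _ => gaussianPDFReal_nonneg _ _ _]
  simp only [Pi.mul_apply, gaussianPDF]
  ring

theorem lintegral_normalPDF (m : Fin p → ℝ) {P : Matrix (Fin p) (Fin p) ℝ} (hP : P.PosDef) :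
    ∫⁻ x, ENNReal.ofReal (normalPDF m P x) = 1 := by
  obtain ⟨B, rfl, hB⟩ := exists_eq_transpose_mul_self hP
  simpa using lintegral_mul_normalPDF m B hB (g := 1) measurable_one

theorem lintegral_sq_stdNormal (c : ℝ) (a : Fin p → ℝ) :
    ∫⁻ z, ENNReal.ofReal ((c + a ⬝ᵥ z) ^ 2) ∂(stdNormal p) =
      ENNReal.ofReal (c ^ 2 + ∑ l, a l ^ 2) := by
  have hl : ∀ l, MemLp (fun t : ℝ => a l * t) 2 (gaussianReal 0 1) := fun l =>
    (memLp_id_gaussianReal (μ := 0) (v := 1) 2).const_mul (a l)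
  have hlp : ∀ l, MemLp (fun z : Fin p → ℝ => a l * z l) 2 (stdNormal p) := fun l =>
    (hl l).comp_measurePreserving (measurePreserving_eval (fun _ => gaussianReal 0 1) l)
  have hs : MemLp (fun z : Fin p → ℝ => a ⬝ᵥ z) 2 (stdNormal p) :=
    memLp_finsetSum Finset.univ fun l _ => hlp l
  have hvar : Var[fun z : Fin p → ℝ => a ⬝ᵥ z; stdNormal p] = ∑ l, a l ^ 2 := by
    have h := variance_sum_pi hl
    have e : (fun z : Fin p → ℝ => a ⬝ᵥ z) = ∑ l, fun z : Fin p → ℝ => a l * z l := by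
      funext z; simp [dotProduct]
    rw [e, h]
    refine Finset.sum_congr rfl fun l _ => ?_
    rw [variance_const_mul]
    have := variance_id_gaussianReal (μ := 0) (v := 1)
    rw [show Var[fun t : ℝ => t; gaussianReal 0 1] = 1 from this, mul_one]
  have hmean : ∫ z, a ⬝ᵥ z ∂(stdNormal p) = 0 := by
    simp only [dotProduct]
    rw [integral_finsetSum _ fun l _ => (hlp l).integrable one_le_two]
    refine Finset.sum_eq_zero fun l _ => ?_
    rw [integral_const_mul]
    have : ∫ z : Fin p → ℝ, z l ∂(stdNormal p) = 0 := by
      have h : (stdNormal p).map (fun z => z l) = gaussianReal 0 1 :=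
        (measurePreserving_eval (fun _ : Fin p => gaussianReal 0 1) l).map_eq
      have h2 : ∫ t : ℝ, t ∂((stdNormal p).map fun z => z l) = ∫ z, z l ∂(stdNormal p) :=
        integral_map (measurable_pi_apply l).aemeasurable
          (measurable_id (α := ℝ)).aestronglyMeasurable
      rw [← h2, h, integral_id_gaussianReal]
    rw [this, mul_zero]
  have hcs : MemLp (fun z : Fin p → ℝ => c + a ⬝ᵥ z) 2 (stdNormal p) := (memLp_const c).add hs
  have h2 := variance_eq_sub hcs
  rw [variance_const_add hs.1, hvar, integral_add (integrable_const _) (hs.integrable one_le_two),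
    hmean] at h2
  simp only [integral_const, probReal_univ, one_smul, add_zero, Pi.pow_apply] at h2
  rw [← ofReal_integral_eq_lintegral_ofReal hcs.integrable_sq (ae_of_all _ fun z => sq_nonneg _)]
  congr 1
  linarith

theorem lintegral_sq_mul_normalPDF (m : Fin p → ℝ) {P : Matrix (Fin p) (Fin p) ℝ} (hP : P.PosDef)
    (j : Fin p) :
    ∫⁻ x, ENNReal.ofReal (x j ^ 2) * ENNReal.ofReal (normalPDF m P x) =
      ENNReal.ofReal (m j ^ 2 + P⁻¹ j j) := by
  obtain ⟨B, rfl, hB⟩ := exists_eq_transpose_mul_self hP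
  rw [lintegral_mul_normalPDF m B hB (by fun_prop)]
  have h := lintegral_sq_stdNormal (m j) (B⁻¹ j)
  rw [Matrix.mul_inv_rev, ← transpose_nonsing_inv, mul_apply]
  simp only [transpose_apply, ← sq]
  exact h

end Normal

/-! ### Mass and inverse moment of the inverse gamma density. -/

section InverseGamma

theorem integral_invGamma {a b : ℝ} (ha : 0 < a) (hb : 0 < b) :
    ∫ s in Set.Ioi (0 : ℝ), s ^ (-a - 1) * Real.exp (-b / s) = Real.Gamma a / b ^ a := by
  have h := integral_comp_rpow_Ioi (fun y : ℝ => y ^ (a - 1) * Real.exp (-(b * y)))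
    (p := -1) (by norm_num)
  rw [Real.integral_rpow_mul_exp_neg_mul_Ioi ha hb] at h
  have e : (1 / b) ^ a * Real.Gamma a = Real.Gamma a / b ^ a := by
    rw [one_div, Real.inv_rpow hb.le]; ring
  rw [← e, ← h]
  refine setIntegral_congr_fun measurableSet_Ioi fun s hs => ?_
  have hs : (0 : ℝ) < s := hs
  simp only [abs_neg, abs_one, one_mul, smul_eq_mul]
  rw [← Real.rpow_mul hs.le, ← mul_assoc, ← Real.rpow_add hs, Real.rpow_neg_one]
  congr 2
  · ring
  · rw [neg_div]; rfl

theorem lintegral_invGamma {a b : ℝ} (ha : 0 < a) (hb : 0 < b) :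
    ∫⁻ s in Set.Ioi (0 : ℝ), ENNReal.ofReal (s ^ (-a - 1) * Real.exp (-b / s)) =
      ENNReal.ofReal (Real.Gamma a / b ^ a) := by
  have h := integral_invGamma ha hb
  have hi := Integrable.of_integral_ne_zero (by
    rw [h]; exact (div_pos (Real.Gamma_pos_of_pos ha) (Real.rpow_pos_of_pos hb a)).ne')
  rw [← h, ofReal_integral_eq_lintegral_ofReal hi]
  exact (ae_restrict_iff' measurableSet_Ioi).2 (ae_of_all _ fun s hs =>
    mul_nonneg (Real.rpow_nonneg (le_of_lt hs) _) (Real.exp_nonneg _))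

theorem lintegral_posVolume (f : ℝ → ℝ≥0∞) :
    ∫⁻ s, f (s : ℝ) ∂posVolume = ∫⁻ s in Set.Ioi (0 : ℝ), f s :=
  lintegral_subtype_comap measurableSet_Ioi f

theorem invGammaPDF_nonneg {a b s : ℝ} (ha : 0 < a) (hb : 0 ≤ b) (hs : 0 ≤ s) :
    0 ≤ invGammaPDF a b s := by
  have := Real.Gamma_pos_of_pos ha
  have := Real.rpow_nonneg hb a
  have := Real.rpow_nonneg hs (-a - 1)
  unfold invGammaPDF; positivity

theorem measurable_invGammaPDF (a b : ℝ) : Measurable (invGammaPDF a b) := by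
  unfold invGammaPDF; fun_prop

theorem lintegral_invGammaPDF {a b : ℝ} (ha : 0 < a) (hb : 0 < b) :
    ∫⁻ s, ENNReal.ofReal (invGammaPDF a b s) ∂posVolume = 1 := by
  have hΓ := Real.Gamma_pos_of_pos ha
  have hba := Real.rpow_pos_of_pos hb a
  rw [lintegral_posVolume fun s => ENNReal.ofReal (invGammaPDF a b s)]
  simp only [invGammaPDF, mul_assoc]
  simp_rw [ENNReal.ofReal_mul (div_pos hba hΓ).le]
  rw [lintegral_const_mul _ (by fun_prop), lintegral_invGamma ha hb,
    ← ENNReal.ofReal_mul (div_pos hba hΓ).le]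
  rw [div_mul_div_cancel₀ hΓ.ne', div_self hba.ne', ENNReal.ofReal_one]

/-- The factor `1/s` raises the shape to `a + 1`, so the value follows from `Γ(a+1) = aΓ(a)`. -/
theorem lintegral_inv_mul_invGammaPDF {a b : ℝ} (ha : 0 < a) (hb : 0 < b) :
    ∫⁻ s : Set.Ioi (0 : ℝ), ENNReal.ofReal (s : ℝ)⁻¹ * ENNReal.ofReal (invGammaPDF a b s)
      ∂posVolume = ENNReal.ofReal (a / b) := by
  have hΓ := Real.Gamma_pos_of_pos ha
  have hba := Real.rpow_pos_of_pos hb a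
  rw [lintegral_posVolume fun s => ENNReal.ofReal s⁻¹ * ENNReal.ofReal (invGammaPDF a b s)]
  have e : ∀ s ∈ Set.Ioi (0 : ℝ), ENNReal.ofReal s⁻¹ * ENNReal.ofReal (invGammaPDF a b s) =
      ENNReal.ofReal (b ^ a / Real.Gamma a) *
        ENNReal.ofReal (s ^ (-(a + 1) - 1) * Real.exp (-b / s)) := fun s hs => by
    have hs : (0 : ℝ) < s := hs
    rw [← ENNReal.ofReal_mul (by positivity), ← ENNReal.ofReal_mul (by positivity), invGammaPDF]
    congr 1
    rw [show -(a + 1) - 1 = (-a - 1) + (-1) by ring, Real.rpow_add hs, Real.rpow_neg_one]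
    ring
  rw [setLIntegral_congr_fun measurableSet_Ioi e, lintegral_const_mul _ (by fun_prop),
    lintegral_invGamma (by linarith) hb, ← ENNReal.ofReal_mul (by positivity),
    Real.Gamma_add_one ha.ne', Real.rpow_add hb, Real.rpow_one]
  congr 1
  field_simp

end InverseGamma

/-! ### Ridge regression identities and bounds. -/

section LinearAlgebra

open Matrix

variable (X : Matrix (Fin n) (Fin p) ℝ) (Y : Fin n → ℝ) {τ : Fin p → ℝ}

theorem posDef_precMatrix (hτ : ∀ j, 0 < τ j) : (precMatrix X τ).PosDef := by
  have h := posSemidef_conjTranspose_mul_self X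
  rw [conjTranspose_eq_transpose_of_trivial] at h
  exact PosDef.posSemidef_add h (PosDef.diagonal fun j => inv_pos.2 (hτ j))

theorem isUnit_det_precMatrix (hτ : ∀ j, 0 < τ j) : IsUnit (precMatrix X τ).det :=
  isUnit_iff_ne_zero.2 (posDef_precMatrix X hτ).det_pos.ne'

theorem transpose_precMatrix (τ : Fin p → ℝ) : (precMatrix X τ)ᵀ = precMatrix X τ := by
  simp [precMatrix, transpose_mul]

theorem dotProduct_precMatrix_mulVec (β : Fin p → ℝ) :
    β ⬝ᵥ (precMatrix X τ *ᵥ β) = (X *ᵥ β) ⬝ᵥ (X *ᵥ β) + ∑ j, β j ^ 2 / τ j := by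
  rw [precMatrix, add_mulVec, dotProduct_add, ← mulVec_mulVec, dotProduct_mulVec β Xᵀ,
    ← mulVec_transpose, transpose_transpose]
  congr 1
  simp only [dotProduct, mulVec_diagonal, Pi.inv_apply]
  exact Finset.sum_congr rfl fun j _ => by ring

theorem precMatrix_mulVec_betaMean (hτ : ∀ j, 0 < τ j) :
    precMatrix X τ *ᵥ betaMean X Y τ = Xᵀ *ᵥ centered Y := by
  rw [betaMean, mulVec_mulVec, ← Matrix.mul_assoc, mul_nonsing_inv _ (isUnit_det_precMatrix X hτ),
    Matrix.one_mul]

theorem residual_eq (τ : Fin p → ℝ) :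
    residual X Y τ = centered Y ⬝ᵥ centered Y - (Xᵀ *ᵥ centered Y) ⬝ᵥ betaMean X Y τ := by
  rw [residual, sub_mulVec, one_mulVec, dotProduct_sub, betaMean, Matrix.mul_assoc,
    ← mulVec_mulVec, dotProduct_mulVec (centered Y) X, ← mulVec_transpose]

/-- Completing the square in the exponent of the likelihood times the prior. -/
theorem complete_square (hτ : ∀ j, 0 < τ j) (β : Fin p → ℝ) :
    (centered Y - X *ᵥ β) ⬝ᵥ (centered Y - X *ᵥ β) + ∑ j, β j ^ 2 / τ j =
      residual X Y τ +
        (β - betaMean X Y τ) ⬝ᵥ (precMatrix X τ *ᵥ (β - betaMean X Y τ)) := by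
  have h1 := dotProduct_precMatrix_mulVec X (τ := τ) β
  have h2 := precMatrix_mulVec_betaMean X Y hτ
  have h3 := residual_eq X Y τ
  have h4 : betaMean X Y τ ⬝ᵥ (precMatrix X τ *ᵥ β) = (Xᵀ *ᵥ centered Y) ⬝ᵥ β := by
    rw [dotProduct_mulVec, ← mulVec_transpose, transpose_precMatrix, h2]
  have h5 : (X *ᵥ β) ⬝ᵥ centered Y = β ⬝ᵥ (Xᵀ *ᵥ centered Y) := by
    rw [dotProduct_mulVec, ← mulVec_transpose, transpose_transpose]
  rw [mulVec_sub, h2]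
  simp only [sub_dotProduct, dotProduct_sub]
  rw [h4, h3, h1, dotProduct_comm (centered Y) (X *ᵥ β), h5, dotProduct_comm (Xᵀ *ᵥ centered Y) β,
    dotProduct_comm (Xᵀ *ᵥ centered Y) (betaMean X Y τ)]
  ring

theorem residual_eq_add (hτ : ∀ j, 0 < τ j) :
    residual X Y τ = (centered Y - X *ᵥ betaMean X Y τ) ⬝ᵥ (centered Y - X *ᵥ betaMean X Y τ) +
      ∑ j, betaMean X Y τ j ^ 2 / τ j := by
  rw [complete_square X Y hτ, sub_self, zero_dotProduct, add_zero]

/-- The residual is the minimum over `β` of the penalized sum of squares, attained at `betaMean`. -/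
theorem residual_le (hτ : ∀ j, 0 < τ j) (β : Fin p → ℝ) :
    residual X Y τ ≤ (centered Y - X *ᵥ β) ⬝ᵥ (centered Y - X *ᵥ β) + ∑ j, β j ^ 2 / τ j := by
  rw [complete_square X Y hτ]
  have := (posDef_precMatrix X hτ).posSemidef.dotProduct_mulVec_nonneg (β - betaMean X Y τ)
  rw [star_trivial] at this
  linarith

/-- For `u = A⁻¹e_j` one has `uᵀAu = u_j`, while the diagonal part of `A` alone contributes at least
`u_j²/τ_j`. -/
theorem inv_precMatrix_apply_le (hτ : ∀ j, 0 < τ j) (j : Fin p) :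
    (precMatrix X τ)⁻¹ j j ≤ τ j := by
  set u := (precMatrix X τ)⁻¹ *ᵥ Pi.single j 1 with hu
  have huj : u j = (precMatrix X τ)⁻¹ j j := by simp [hu]
  have h1 : u ⬝ᵥ (precMatrix X τ *ᵥ u) = u j := by
    rw [hu, mulVec_mulVec, mul_nonsing_inv _ (isUnit_det_precMatrix X hτ), one_mulVec]
    simp
  rw [dotProduct_precMatrix_mulVec] at h1
  have h2 : u j ^ 2 / τ j ≤ ∑ i, u i ^ 2 / τ i :=
    Finset.single_le_sum (f := fun i => u i ^ 2 / τ i)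
      (fun i _ => div_nonneg (sq_nonneg _) (hτ i).le) (Finset.mem_univ j)
  have h3 : 0 ≤ (X *ᵥ u) ⬝ᵥ (X *ᵥ u) := Finset.sum_nonneg fun i _ => mul_self_nonneg _
  have h4 : u j ^ 2 / τ j ≤ u j := by linarith
  rw [← huj]
  rw [div_le_iff₀ (hτ j)] at h4
  have := hτ j
  by_contra hlt
  push Not at hlt
  nlinarith

theorem inv_precMatrix_apply_nonneg (hτ : ∀ j, 0 < τ j) (j : Fin p) :
    0 ≤ (precMatrix X τ)⁻¹ j j :=
  (posDef_precMatrix X hτ).inv.posSemidef.diag_nonneg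

/-- The penalty `Σ m_j²/τ_j` at the minimizer `m` is part of the residual, and each `τ_j` is at most
their sum. -/
theorem sum_sq_betaMean_le (hτ : ∀ j, 0 < τ j) :
    ∑ j, betaMean X Y τ j ^ 2 ≤ (∑ j, τ j) * residual X Y τ := by
  have hle : ∑ j, betaMean X Y τ j ^ 2 / τ j ≤ residual X Y τ := by
    rw [residual_eq_add X Y hτ]
    exact le_add_of_nonneg_left (Finset.sum_nonneg fun i _ => mul_self_nonneg _)
  have hτs : ∀ j, τ j ≤ ∑ i, τ i := fun j =>
    Finset.single_le_sum (fun i _ => (hτ i).le) (Finset.mem_univ j)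
  calc ∑ j, betaMean X Y τ j ^ 2 ≤ ∑ j, (∑ i, τ i) * (betaMean X Y τ j ^ 2 / τ j) := by
        refine Finset.sum_le_sum fun j _ => ?_
        have := mul_le_mul_of_nonneg_right (hτs j) (div_nonneg (sq_nonneg (betaMean X Y τ j))
          (hτ j).le)
        rwa [mul_div_cancel₀ _ (hτ j).ne'] at this
    _ = (∑ j, τ j) * ∑ j, betaMean X Y τ j ^ 2 / τ j := by rw [Finset.mul_sum]
    _ ≤ _ := mul_le_mul_of_nonneg_left hle (Finset.sum_nonneg fun i _ => (hτ i).le)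

variable {Y}

theorem centered_ne_zero (hY : ∃ i l, Y i ≠ Y l) : centered Y ≠ 0 := by
  rintro h
  obtain ⟨i, l, hil⟩ := hY
  have h1 := congrFun h i
  have h2 := congrFun h l
  simp only [centered, Pi.zero_apply] at h1 h2
  exact hil (by linarith)

theorem two_le_of_exists_ne (hY : ∃ i l, Y i ≠ Y l) : 2 ≤ n := by
  obtain ⟨i, l, hil⟩ := hY
  have : i ≠ l := fun h => hil (by rw [h])
  have h1 := i.2
  have h2 := l.2
  have h3 : (i : ℕ) ≠ l := fun h => this (Fin.ext h)
  omega

/-- A zero residual makes the penalty vanish, so `betaMean` is zero and the residual is `‖Ỹ‖²`,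
which is positive for a nonconstant response. -/
theorem residual_pos (hY : ∃ i l, Y i ≠ Y l) (hτ : ∀ j, 0 < τ j) : 0 < residual X Y τ := by
  have h1 : 0 ≤ (centered Y - X *ᵥ betaMean X Y τ) ⬝ᵥ (centered Y - X *ᵥ betaMean X Y τ) :=
    Finset.sum_nonneg fun i _ => mul_self_nonneg _
  have h2 : ∀ j ∈ Finset.univ, 0 ≤ betaMean X Y τ j ^ 2 / τ j := fun j _ =>
    div_nonneg (sq_nonneg _) (hτ j).le
  have h3 := Finset.sum_nonneg h2
  rw [residual_eq_add X Y hτ]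
  refine lt_of_le_of_ne (add_nonneg h1 h3) fun h0 => centered_ne_zero hY ?_
  have h4 : ∑ j, betaMean X Y τ j ^ 2 / τ j = 0 := by linarith
  have h5 : betaMean X Y τ = 0 := by
    funext j
    have := (Finset.sum_eq_zero_iff_of_nonneg h2).1 h4 j (Finset.mem_univ j)
    rcases div_eq_zero_iff.1 this with h | h
    · exact pow_eq_zero_iff two_ne_zero |>.1 h
    · exact absurd h (hτ j).ne'
  rw [h5, mulVec_zero, sub_zero] at h0
  simp only [Pi.zero_apply] at h0
  refine dotProduct_self_eq_zero.1 ?_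
  simpa using h0.symm

end LinearAlgebra

/-! ### The block step: total mass and second moment. -/

section Block

variable {X : Matrix (Fin n) (Fin p) ℝ} {Y : Fin n → ℝ} {τ : Fin p → ℝ}

theorem posDef_smul_precMatrix (X : Matrix (Fin n) (Fin p) ℝ) (hτ : ∀ j, 0 < τ j)
    (s : Set.Ioi (0 : ℝ)) : ((s : ℝ)⁻¹ • precMatrix X τ).PosDef := by
  have hs : (0 : ℝ) < (s : ℝ)⁻¹ := inv_pos.2 s.2
  exact (posDef_precMatrix X hτ).smul hs

theorem inv_smul_precMatrix (X : Matrix (Fin n) (Fin p) ℝ) (hτ : ∀ j, 0 < τ j)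
    (s : Set.Ioi (0 : ℝ)) : ((s : ℝ)⁻¹ • precMatrix X τ)⁻¹ = (s : ℝ) • (precMatrix X τ)⁻¹ := by
  refine Matrix.inv_eq_left_inv ?_
  have hs : (s : ℝ) ≠ 0 := (show (0 : ℝ) < s from s.2).ne'
  rw [Matrix.smul_mul, Matrix.mul_smul, smul_smul, mul_inv_cancel₀ hs, one_smul,
    Matrix.nonsing_inv_mul _ (isUnit_det_precMatrix X hτ)]

theorem lintegral_blockKernel (hY : ∃ i l, Y i ≠ Y l) (hτ : ∀ j, 0 < τ j)
    {g : State p → ℝ≥0∞} (hg : Measurable g) :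
    ∫⁻ x, g x ∂(blockKernel X Y τ) =
      ∫⁻ s : Set.Ioi (0 : ℝ),
        (∫⁻ β, g (β, s) * ENNReal.ofReal
          (normalPDF (betaMean X Y τ) ((s : ℝ)⁻¹ • precMatrix X τ) β)) *
          ENNReal.ofReal (invGammaPDF (((n : ℝ) - 1) / 2) (residual X Y τ / 2) s)
        ∂posVolume := by
  have hm : Measurable fun x => ENNReal.ofReal (blockPDF X Y τ x) :=
    (measurable_blockPDF X Y).of_uncurry_left
  rw [blockKernel_apply, lintegral_withDensity_eq_lintegral_mul _ hm hg, stateVolume,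
    lintegral_prod_symm _ (hm.mul hg).aemeasurable]
  refine lintegral_congr fun s => ?_
  have hn : (2 : ℝ) ≤ n := by exact_mod_cast two_le_of_exists_ne hY
  have hI : 0 ≤ invGammaPDF (((n : ℝ) - 1) / 2) (residual X Y τ / 2) s :=
    invGammaPDF_nonneg (by linarith) (by linarith [residual_pos X hY hτ]) (le_of_lt s.2)
  rw [← lintegral_mul_const' _ _ ENNReal.ofReal_ne_top]
  refine lintegral_congr fun β => ?_
  simp only [Pi.mul_apply, blockPDF]
  rw [ENNReal.ofReal_mul hI]
  ring

theorem isProbabilityMeasure_blockKernel (hY : ∃ i l, Y i ≠ Y l) (hτ : ∀ j, 0 < τ j) :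
    IsProbabilityMeasure (blockKernel X Y τ) := by
  have hn : (2 : ℝ) ≤ n := by exact_mod_cast two_le_of_exists_ne hY
  have h := lintegral_blockKernel (X := X) hY hτ (g := 1) measurable_one
  simp only [Pi.one_apply, lintegral_one, one_mul] at h
  refine ⟨h.trans ?_⟩
  simp_rw [lintegral_normalPDF _ (posDef_smul_precMatrix X hτ _), one_mul]
  exact lintegral_invGammaPDF (by linarith) (by linarith [residual_pos X hY hτ])

/-- Given `σ²` and `τ` the mean is `‖m‖²/σ² + tr A⁻¹`. The inverse variance has mean `(n-1)/C_τ`, so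
the first term contributes at most `(n-1) Σ τ_j` and the trace at most `Σ τ_j`. -/
theorem lintegral_sum_stdCoef_sq_le (hY : ∃ i l, Y i ≠ Y l) (hτ : ∀ j, 0 < τ j) :
    ∫⁻ x, ENNReal.ofReal (∑ j, stdCoef x j ^ 2) ∂(blockKernel X Y τ) ≤
      ENNReal.ofReal (n * ∑ j, τ j) := by
  have hn : (2 : ℝ) ≤ n := by exact_mod_cast two_le_of_exists_ne hY
  have hC := residual_pos X hY hτ
  have ha : 0 < ((n : ℝ) - 1) / 2 := by linarith
  have hb : 0 < residual X Y τ / 2 := by linarith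
  have hm : Measurable fun x : State p => ENNReal.ofReal (∑ j, stdCoef x j ^ 2) :=
    (Finset.measurable_sum _ fun j _ => (measurable_stdCoef j).pow_const 2).ennreal_ofReal
  rw [lintegral_blockKernel hY hτ hm]
  set I : ℝ → ℝ := invGammaPDF (((n : ℝ) - 1) / 2) (residual X Y τ / 2) with hI
  set m := betaMean X Y τ with hmdef
  set V := (precMatrix X τ)⁻¹ with hV
  have hV0 : ∀ j, 0 ≤ V j j := inv_precMatrix_apply_nonneg X hτ
  have hinner : ∀ s : Set.Ioi (0 : ℝ),
      ∫⁻ β, ENNReal.ofReal (∑ j, stdCoef ((β, s) : State p) j ^ 2) * ENNReal.ofReal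
        (normalPDF m ((s : ℝ)⁻¹ • precMatrix X τ) β) =
      ENNReal.ofReal (∑ j, m j ^ 2) * ENNReal.ofReal (s : ℝ)⁻¹ + ENNReal.ofReal (∑ j, V j j) := by
    intro s
    have hs : (0 : ℝ) < s := s.2
    have hnm : Measurable fun β => ENNReal.ofReal
        (normalPDF m ((s : ℝ)⁻¹ • precMatrix X τ) β) := by
      unfold normalPDF
      refine (Measurable.const_mul (Real.measurable_exp.comp ?_) _).ennreal_ofReal
      have h1 : Continuous fun x : Fin p → ℝ => dotProduct (x - m)
        (((s : ℝ)⁻¹ • precMatrix X τ).mulVec (x - m)) := by fun_prop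
      exact h1.measurable.neg.div_const 2
    have e : ∀ β : Fin p → ℝ, ENNReal.ofReal (∑ j, stdCoef ((β, s) : State p) j ^ 2) *
        ENNReal.ofReal (normalPDF m ((s : ℝ)⁻¹ • precMatrix X τ) β) =
        ENNReal.ofReal (s : ℝ)⁻¹ * ∑ j, ENNReal.ofReal (β j ^ 2) *
          ENNReal.ofReal (normalPDF m ((s : ℝ)⁻¹ • precMatrix X τ) β) := fun β => by
      rw [← Finset.sum_mul, ← ENNReal.ofReal_sum_of_nonneg fun j _ => sq_nonneg _, ← mul_assoc,
        ← ENNReal.ofReal_mul (p := (s : ℝ)⁻¹) (by positivity), Finset.mul_sum]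
      congr 2
      exact Finset.sum_congr rfl fun j _ => by rw [stdCoef_sq]; ring
    simp_rw [e]
    have hj : ∀ j : Fin p, Measurable fun β : Fin p → ℝ => ENNReal.ofReal (β j ^ 2) *
          ENNReal.ofReal (normalPDF m ((s : ℝ)⁻¹ • precMatrix X τ) β) := fun j =>
      Measurable.mul (by fun_prop) hnm
    rw [lintegral_const_mul _ (Finset.measurable_sum _ fun j _ => hj j),
      lintegral_finsetSum _ fun j _ => hj j]
    simp_rw [lintegral_sq_mul_normalPDF m (posDef_smul_precMatrix X hτ s),
      inv_smul_precMatrix X hτ s, ← hV, Matrix.smul_apply, smul_eq_mul]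
    rw [← ENNReal.ofReal_sum_of_nonneg fun j _ => by have := hV0 j; positivity,
      ← ENNReal.ofReal_mul (by positivity), ← ENNReal.ofReal_mul (by positivity),
      ← ENNReal.ofReal_add (by positivity) (Finset.sum_nonneg fun j _ => hV0 j),
      Finset.sum_add_distrib, ← Finset.mul_sum]
    congr 1
    field_simp
  simp_rw [hinner, add_mul, mul_assoc]
  have hIm : Measurable fun s : Set.Ioi (0 : ℝ) => ENNReal.ofReal (I s) :=
    ((measurable_invGammaPDF _ _).comp measurable_subtype_coe).ennreal_ofReal
  have hIm' : Measurable fun s : Set.Ioi (0 : ℝ) =>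
      ENNReal.ofReal (s : ℝ)⁻¹ * ENNReal.ofReal (I s) := Measurable.mul (by fun_prop) hIm
  rw [lintegral_add_left (hIm'.const_mul _), lintegral_const_mul _ hIm', lintegral_const_mul _ hIm,
    lintegral_inv_mul_invGammaPDF ha hb, lintegral_invGammaPDF ha hb, mul_one,
    ← ENNReal.ofReal_mul (by positivity),
    ← ENNReal.ofReal_add (by positivity) (Finset.sum_nonneg fun j _ => hV0 j)]
  refine ENNReal.ofReal_le_ofReal ?_
  have h1 : ∑ j, V j j ≤ ∑ j, τ j :=
    Finset.sum_le_sum fun j _ => inv_precMatrix_apply_le X hτ j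
  have h2 := sum_sq_betaMean_le X Y hτ
  have h3 : (∑ j, m j ^ 2) * (((n : ℝ) - 1) / 2 / (residual X Y τ / 2)) ≤ (n - 1) * ∑ j, τ j := by
    rw [div_div_div_cancel_right₀ two_ne_zero, mul_div_assoc', div_le_iff₀ hC]
    have := mul_le_mul_of_nonneg_right h2 (by linarith : (0 : ℝ) ≤ n - 1)
    linarith
  linarith

end Block

/-! ### Closed form of the posterior and factorization of the joint density. -/

section Posterior

open Matrix

/-- The unnormalised posterior density of `(β, σ²)` in closed form. -/
def posteriorDensity (X : Matrix (Fin n) (Fin p) ℝ) (Y : Fin n → ℝ) (lam : ℝ) (x : State p) : ℝ :=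
  (√(2 * Real.pi * x.2))⁻¹ ^ n * √(2 * Real.pi * x.2 / n) *
    Real.exp (-((centered Y - X *ᵥ x.1) ⬝ᵥ (centered Y - X *ᵥ x.1)) / (2 * x.2)) *
    (∏ j, lam / (2 * √(x.2 : ℝ)) * Real.exp (-(lam * stdCoef x j))) * (1 / x.2)

variable {X : Matrix (Fin n) (Fin p) ℝ} {Y : Fin n → ℝ} {lam : ℝ}

theorem posteriorDensity_pos (hn : 0 < n) (hlam : 0 < lam) (x : State p) :
    0 < posteriorDensity X Y lam x := by
  have hs : (0 : ℝ) < x.2 := x.2.2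
  have : (0 : ℝ) < n := by exact_mod_cast hn
  unfold posteriorDensity
  have : 0 < ∏ j, lam / (2 * √(x.2 : ℝ)) * Real.exp (-(lam * stdCoef x j)) :=
    Finset.prod_pos fun j _ => by positivity
  positivity

theorem measurable_posteriorDensity (X : Matrix (Fin n) (Fin p) ℝ) (Y : Fin n → ℝ) (lam : ℝ) :
    Measurable (posteriorDensity X Y lam) := by
  have h1 : Measurable fun x : State p =>
      (centered Y - X *ᵥ x.1) ⬝ᵥ (centered Y - X *ᵥ x.1) := by
    have : Continuous fun β : Fin p → ℝ => (centered Y - X *ᵥ β) ⬝ᵥ (centered Y - X *ᵥ β) := by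
      fun_prop
    exact this.measurable.comp measurable_fst
  have h2 : Measurable fun x : State p =>
      ∏ j, lam / (2 * √(x.2 : ℝ)) * Real.exp (-(lam * stdCoef x j)) :=
    Finset.measurable_prod _ fun j _ => by
      have := measurable_stdCoef j
      fun_prop
  unfold posteriorDensity
  refine Measurable.mul (Measurable.mul (Measurable.mul (by fun_prop) ?_) h2) (by fun_prop)
  exact (h1.neg.div (by fun_prop)).exp

theorem sum_centered (hn : n ≠ 0) (Y : Fin n → ℝ) : ∑ i, centered Y i = 0 := by
  simp only [centered, Finset.sum_sub_distrib, Finset.sum_const, Finset.card_univ,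
    Fintype.card_fin, nsmul_eq_mul]
  have : (n : ℝ) ≠ 0 := Nat.cast_ne_zero.2 hn
  field_simp
  ring

/-- The cross term vanishes because both the centred response and the columns of `X` sum to zero. -/
theorem sum_sq_sub_eq (hn : n ≠ 0) (hX : ∀ j, ∑ i, X i j = 0) (β : Fin p → ℝ) (μ : ℝ) :
    ∑ i, (Y i - (μ + (X *ᵥ β) i)) ^ 2 =
      n * (μ - (∑ l, Y l) / n) ^ 2 +
        (centered Y - X *ᵥ β) ⬝ᵥ (centered Y - X *ᵥ β) := by
  have h1 : ∑ i, (X *ᵥ β) i = 0 := by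
    simp only [mulVec, dotProduct]
    rw [Finset.sum_comm]
    simp_rw [← Finset.sum_mul, hX]
    simp
  have h2 := sum_centered hn Y
  set ybar := (∑ l, Y l) / n with hy
  have e : ∀ i, (Y i - (μ + (X *ᵥ β) i)) ^ 2 = (μ - ybar) ^ 2 -
      2 * (μ - ybar) * (centered Y i - (X *ᵥ β) i) +
      (centered Y - X *ᵥ β) i * (centered Y - X *ᵥ β) i := fun i => by
    simp only [Pi.sub_apply, centered, ← hy]; ring
  rw [Finset.sum_congr rfl fun i _ => e i, Finset.sum_add_distrib, Finset.sum_sub_distrib,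
    ← Finset.mul_sum, Finset.sum_sub_distrib, h1, h2]
  simp [dotProduct]

theorem lintegral_likelihood (hn : n ≠ 0) (hX : ∀ j, ∑ i, X i j = 0) (x : State p) :
    ∫⁻ μ : ℝ, ∏ i, gaussianPDF (μ + X.mulVec x.1 i) (x.2 : ℝ).toNNReal (Y i) =
      ENNReal.ofReal ((√(2 * Real.pi * x.2))⁻¹ ^ n * √(2 * Real.pi * x.2 / n) *
        Real.exp (-((centered Y - X *ᵥ x.1) ⬝ᵥ (centered Y - X *ᵥ x.1)) / (2 * x.2))) := by
  have hs : (0 : ℝ) < x.2 := x.2.2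
  have hn0 : (0 : ℝ) < n := by exact_mod_cast Nat.pos_of_ne_zero hn
  set s : ℝ := (x.2 : ℝ) with hsdef
  set Q := (centered Y - X *ᵥ x.1) ⬝ᵥ (centered Y - X *ᵥ x.1) with hQ
  have hsn : (s / n).toNNReal ≠ 0 := by
    simpa using div_pos hs hn0
  have e : ∀ μ : ℝ, ∏ i, gaussianPDF (μ + X.mulVec x.1 i) s.toNNReal (Y i) =
      ENNReal.ofReal ((√(2 * Real.pi * s))⁻¹ ^ n * √(2 * Real.pi * s / n) *
        Real.exp (-Q / (2 * s))) * gaussianPDF ((∑ l, Y l) / n) (s / n).toNNReal μ := fun μ => by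
    simp only [gaussianPDF]
    rw [← ENNReal.ofReal_prod_of_nonneg fun i _ => gaussianPDFReal_nonneg _ _ _,
      ← ENNReal.ofReal_mul (by positivity)]
    congr 1
    simp only [gaussianPDFReal, Real.coe_toNNReal _ hs.le, Real.coe_toNNReal _ (div_pos hs hn0).le]
    rw [Finset.prod_mul_distrib, ← Real.exp_sum, Finset.prod_const, Finset.card_univ,
      Fintype.card_fin, ← Finset.sum_div, Finset.sum_neg_distrib, sum_sq_sub_eq hn hX]
    have h1 : √(2 * Real.pi * (s / n)) = √(2 * Real.pi * s / n) := by rw [mul_div_assoc]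
    have h2 : 0 < √(2 * Real.pi * s / n) := by positivity
    rw [h1, ← hQ]
    have h3 : -(n * (μ - (∑ l, Y l) / n) ^ 2 + Q) / (2 * s) =
        -Q / (2 * s) + -(μ - (∑ l, Y l) / n) ^ 2 / (2 * (s / n)) := by
      field_simp; ring
    rw [h3, Real.exp_add]
    field_simp
  simp_rw [e]
  rw [lintegral_const_mul _ (measurable_gaussianPDF _ _), lintegral_gaussianPDF_eq_one _ hsn,
    mul_one]

/-- Pointwise form of the representation of the Laplace density as an exponential scale mixture of
normals: the Laplace density times the conditional density of `τ_j`. -/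
theorem gaussianPDF_mul_exponentialPDF (hlam : 0 < lam) (x : State p) (t : ℝ) (j : Fin p) :
    gaussianPDF 0 ((x.2 : ℝ) * t).toNNReal (x.1 j) * exponentialPDF (lam ^ 2 / 2) t =
      ENNReal.ofReal (lam / (2 * √(x.2 : ℝ)) * Real.exp (-(lam * stdCoef x j))) *
        ENNReal.ofReal (tauFactor lam (stdCoef x j) t) := by
  have hs : (0 : ℝ) < x.2 := x.2.2
  by_cases ht : 0 < t
  · rw [gaussianPDF, exponentialPDF_eq, if_pos ht.le, gaussianPDFReal,
      Real.coe_toNNReal _ (by positivity), ← ENNReal.ofReal_mul (by positivity),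
      ← ENNReal.ofReal_mul (by positivity), tauFactor, if_pos ht, stdCoef_sq]
    congr 1
    have h1 : √(2 * Real.pi * (x.2 * t)) = √(x.2 : ℝ) * √(2 * Real.pi * t) := by
      rw [← Real.sqrt_mul hs.le]; congr 1; ring
    have h2 : 0 < √(2 * Real.pi * t) := by positivity
    have h3 : 0 < √(x.2 : ℝ) := by positivity
    rw [h1]
    have h4 : lam * stdCoef x j - x.1 j ^ 2 / x.2 / (2 * t) - lam ^ 2 * t / 2 =
        lam * stdCoef x j + (-(x.1 j - 0) ^ 2 / (2 * (x.2 * t)) + -(lam ^ 2 / 2 * t)) := by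
      field_simp; ring
    rw [h4, Real.exp_add, Real.exp_add, Real.exp_neg (lam * stdCoef x j)]
    have := Real.exp_pos (lam * stdCoef x j)
    field_simp
  -- At `t = 0` the exponential density is positive; the product vanishes only because the Gaussian
  -- density with variance 0 is 0 by convention.
  · have h : ((x.2 : ℝ) * t).toNNReal = 0 :=
      Real.toNNReal_of_nonpos (mul_nonpos_of_nonneg_of_nonpos hs.le (not_lt.1 ht))
    rw [tauFactor, if_neg ht, h, gaussianPDF, gaussianPDFReal_zero_var]
    simp

theorem lintegral_jointDensity (hn : n ≠ 0) (hlam : 0 < lam) (hX : ∀ j, ∑ i, X i j = 0)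
    (x : State p) (τ : Fin p → ℝ) :
    ∫⁻ μ : ℝ, jointDensity X Y lam x τ μ =
      ENNReal.ofReal (posteriorDensity X Y lam x) * ENNReal.ofReal (tauPDF lam x.1 x.2 τ) := by
  have hs : (0 : ℝ) < x.2 := x.2.2
  have e : ∀ μ, jointDensity X Y lam x τ μ =
      (∏ i, gaussianPDF (μ + X.mulVec x.1 i) (x.2 : ℝ).toNNReal (Y i)) *
        ((∏ j, gaussianPDF 0 ((x.2 : ℝ) * τ j).toNNReal (x.1 j) *
          exponentialPDF (lam ^ 2 / 2) (τ j)) * ENNReal.ofReal (1 / x.2)) := fun μ => by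
    rw [jointDensity, Finset.prod_mul_distrib]; ring
  simp_rw [e]
  rw [lintegral_mul_const _ ?_, lintegral_likelihood hn hX]
  · simp_rw [gaussianPDF_mul_exponentialPDF hlam]
    rw [Finset.prod_mul_distrib, ← ofReal_tauPDF lam hlam.le,
      ← ENNReal.ofReal_prod_of_nonneg fun j _ => by positivity, posteriorDensity,
      ENNReal.ofReal_mul (q := 1 / (x.2 : ℝ)) (mul_nonneg (by positivity)
        (Finset.prod_nonneg fun j _ => by positivity)), ENNReal.ofReal_mul
        (q := ∏ j, lam / (2 * √(x.2 : ℝ)) * Real.exp (-(lam * stdCoef x j))) (by positivity)]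
    ring
  · refine Finset.measurable_prod _ fun i _ => ?_
    simp only [gaussianPDF, gaussianPDFReal]
    fun_prop

theorem marginalDensity_eq (hn : n ≠ 0) (hlam : 0 < lam) (hX : ∀ j, ∑ i, X i j = 0) :
    marginalDensity X Y lam = fun x => ENNReal.ofReal (posteriorDensity X Y lam x) := by
  funext x
  rw [marginalDensity]
  simp_rw [lintegral_jointDensity hn hlam hX]
  rw [lintegral_const_mul _ (measurable_ofReal_tauPDF lam x), lintegral_tauPDF hlam, mul_one]

/-- The factor of the joint density of `(β, σ², τ)` that depends on `τ` only. -/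
def priorFactor (n : ℕ) (lam : ℝ) (τ : Fin p → ℝ) : ℝ :=
  √(2 * Real.pi / n) / √(2 * Real.pi) ^ n *
    ∏ j, lam ^ 2 / 2 / √(2 * Real.pi * τ j) * Real.exp (-(lam ^ 2 * τ j / 2))

theorem priorFactor_nonneg (n : ℕ) (lam : ℝ) (τ : Fin p → ℝ) : 0 ≤ priorFactor n lam τ := by
  unfold priorFactor
  have : 0 ≤ ∏ j, lam ^ 2 / 2 / √(2 * Real.pi * τ j) * Real.exp (-(lam ^ 2 * τ j / 2)) :=
    Finset.prod_nonneg fun j _ => by positivity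
  positivity

theorem sqrt_pow_eq_rpow {s : ℝ} (hs : 0 < s) (n : ℕ) :
    (√s ^ n)⁻¹ * √s * (1 / s) = s ^ (-(((n : ℝ) - 1) / 2) - 1) := by
  rw [Real.sqrt_eq_rpow, ← Real.rpow_natCast, ← Real.rpow_mul hs.le, ← Real.rpow_neg hs.le,
    one_div s, ← Real.rpow_neg_one s, ← Real.rpow_add hs, ← Real.rpow_add hs]
  congr 1; ring

theorem posteriorDensity_mul_tauPDF (x : State p) {τ : Fin p → ℝ}
    (hτ : ∀ j, 0 < τ j) :
    posteriorDensity X Y lam x * tauPDF lam x.1 x.2 τ =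
      priorFactor n lam τ * ((x.2 : ℝ) ^ (-(((n : ℝ) - 1) / 2) - 1) * (√(x.2 : ℝ) ^ p)⁻¹ *
        Real.exp (-((centered Y - X *ᵥ x.1) ⬝ᵥ (centered Y - X *ᵥ x.1) +
          ∑ j, x.1 j ^ 2 / τ j) / (2 * x.2))) := by
  have hs : (0 : ℝ) < x.2 := x.2.2
  set s : ℝ := (x.2 : ℝ)
  set Q := (centered Y - X *ᵥ x.1) ⬝ᵥ (centered Y - X *ᵥ x.1)
  have hr : 0 < √s := by positivity
  have hprod : (∏ j, lam / (2 * √s) * Real.exp (-(lam * stdCoef x j))) * tauPDF lam x.1 s τ =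
      (∏ j, lam ^ 2 / 2 / √(2 * Real.pi * τ j) * Real.exp (-(lam ^ 2 * τ j / 2))) *
        ((√s ^ p)⁻¹ * Real.exp (-(∑ j, x.1 j ^ 2 / τ j) / (2 * s))) := by
    have hp : (√s ^ p)⁻¹ = ∏ _j : Fin p, (√s)⁻¹ := by simp
    rw [tauPDF_eq_prod, hp, ← Finset.sum_neg_distrib, Finset.sum_div, Real.exp_sum,
      ← Finset.prod_mul_distrib, ← Finset.prod_mul_distrib, ← Finset.prod_mul_distrib]
    refine Finset.prod_congr rfl fun j _ => ?_
    have ht := hτ j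
    rw [tauFactor, if_pos ht, stdCoef_sq]
    have h4 : lam * stdCoef x j - x.1 j ^ 2 / s / (2 * τ j) - lam ^ 2 * τ j / 2 =
        lam * stdCoef x j + (-(x.1 j ^ 2 / τ j) / (2 * s) + -(lam ^ 2 * τ j / 2)) := by
      field_simp; ring
    rw [h4, Real.exp_add, Real.exp_add, Real.exp_neg (lam * stdCoef x j)]
    have := Real.exp_pos (lam * stdCoef x j)
    have h2 : 0 < √(2 * Real.pi * τ j) := by positivity
    field_simp
  have hG : (√(2 * Real.pi * s))⁻¹ ^ n * √(2 * Real.pi * s / n) * (1 / s) =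
      √(2 * Real.pi / n) / √(2 * Real.pi) ^ n * s ^ (-(((n : ℝ) - 1) / 2) - 1) := by
    rw [← sqrt_pow_eq_rpow hs]
    have h1 : √(2 * Real.pi * s / n) = √(2 * Real.pi / n) * √s := by
      rw [← Real.sqrt_mul (by positivity)]; congr 1; ring
    rw [h1, Real.sqrt_mul (by positivity) s, inv_pow, mul_pow]
    field_simp
  have hE : Real.exp (-(Q + ∑ j, x.1 j ^ 2 / τ j) / (2 * s)) =
      Real.exp (-Q / (2 * s)) * Real.exp (-(∑ j, x.1 j ^ 2 / τ j) / (2 * s)) := by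
    rw [← Real.exp_add]; congr 1; ring
  calc posteriorDensity X Y lam x * tauPDF lam x.1 s τ
      = ((√(2 * Real.pi * s))⁻¹ ^ n * √(2 * Real.pi * s / n) * (1 / s)) *
          Real.exp (-Q / (2 * s)) *
          ((∏ j, lam / (2 * √s) * Real.exp (-(lam * stdCoef x j))) * tauPDF lam x.1 s τ) := by
        rw [posteriorDensity]; ring
    _ = _ := by rw [hprod, hG, hE, priorFactor]; ring

theorem blockPDF_eq (X : Matrix (Fin n) (Fin p) ℝ) (Y : Fin n → ℝ) (x : State p) {τ : Fin p → ℝ}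
    (hτ : ∀ j, 0 < τ j) :
    blockPDF X Y τ x =
      (residual X Y τ / 2) ^ (((n : ℝ) - 1) / 2) / Real.Gamma (((n : ℝ) - 1) / 2) *
        (√(precMatrix X τ).det / √(2 * Real.pi) ^ p) *
      ((x.2 : ℝ) ^ (-(((n : ℝ) - 1) / 2) - 1) * (√(x.2 : ℝ) ^ p)⁻¹ *
        Real.exp (-((centered Y - X *ᵥ x.1) ⬝ᵥ (centered Y - X *ᵥ x.1) +
          ∑ j, x.1 j ^ 2 / τ j) / (2 * x.2))) := by
  have hs : (0 : ℝ) < x.2 := x.2.2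
  have hdet : √((x.2 : ℝ)⁻¹ • precMatrix X τ).det =
      (√(x.2 : ℝ) ^ p)⁻¹ * √(precMatrix X τ).det := by
    rw [det_smul, Fintype.card_fin, Real.sqrt_mul (by positivity), inv_pow, Real.sqrt_inv]
    congr 2
    rw [Real.sqrt_eq_iff_mul_self_eq (by positivity) (by positivity), ← mul_pow,
      Real.mul_self_sqrt hs.le]
  rw [complete_square X Y hτ, blockPDF, invGammaPDF, normalPDF, hdet, smul_mulVec,
    dotProduct_smul, smul_eq_mul]
  have hE : Real.exp (-(residual X Y τ + (x.1 - betaMean X Y τ) ⬝ᵥ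
      (precMatrix X τ *ᵥ (x.1 - betaMean X Y τ))) / (2 * x.2)) =
      Real.exp (-(residual X Y τ / 2) / x.2) * Real.exp (-((x.2 : ℝ)⁻¹ *
        (x.1 - betaMean X Y τ) ⬝ᵥ (precMatrix X τ *ᵥ (x.1 - betaMean X Y τ))) / 2) := by
    rw [← Real.exp_add]; congr 1; field_simp; ring
  rw [hE]
  ring

/-- The unnormalised posterior density of `τ`. -/
def tauMarginal (X : Matrix (Fin n) (Fin p) ℝ) (Y : Fin n → ℝ) (lam : ℝ) (τ : Fin p → ℝ) : ℝ :=
  priorFactor n lam τ /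
    ((residual X Y τ / 2) ^ (((n : ℝ) - 1) / 2) / Real.Gamma (((n : ℝ) - 1) / 2) *
        (√(precMatrix X τ).det / √(2 * Real.pi) ^ p))

/-- As functions of `(β, σ²)` both sides are multiples of the same expression, since completing the
square rewrites the exponent; `tauMarginal` is the quotient of the two prefactors. This identity
makes the Gibbs chain stationary. -/
theorem tauMarginal_spec (hY : ∃ i l, Y i ≠ Y l) (x : State p)
    {τ : Fin p → ℝ} (hτ : ∀ j, 0 < τ j) :
    posteriorDensity X Y lam x * tauPDF lam x.1 x.2 τ =
      tauMarginal X Y lam τ * blockPDF X Y τ x := by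
  have hn : (2 : ℝ) ≤ n := by exact_mod_cast two_le_of_exists_ne hY
  have h1 := residual_pos X hY hτ
  have h2 : 0 < (residual X Y τ / 2) ^ (((n : ℝ) - 1) / 2) := Real.rpow_pos_of_pos (by linarith) _
  have h3 : 0 < Real.Gamma (((n : ℝ) - 1) / 2) := Real.Gamma_pos_of_pos (by linarith)
  have h4 := (posDef_precMatrix X hτ).det_pos
  rw [posteriorDensity_mul_tauPDF x hτ, blockPDF_eq X Y x hτ, tauMarginal]
  have key : ∀ a k h : ℝ, k ≠ 0 → a * h = a / k * (k * h) := fun a k h hk => by field_simp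
  exact key _ _ _ (by positivity)

theorem tauMarginal_nonneg (hY : ∃ i l, Y i ≠ Y l) {τ : Fin p → ℝ} (hτ : ∀ j, 0 < τ j) :
    0 ≤ tauMarginal X Y lam τ := by
  have hn : (2 : ℝ) ≤ n := by exact_mod_cast two_le_of_exists_ne hY
  have h1 := residual_pos X hY hτ
  have h2 : 0 < (residual X Y τ / 2) ^ (((n : ℝ) - 1) / 2) := Real.rpow_pos_of_pos (by linarith) _
  have h3 : 0 < Real.Gamma (((n : ℝ) - 1) / 2) := Real.Gamma_pos_of_pos (by linarith)
  have := priorFactor_nonneg n lam τ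
  unfold tauMarginal; positivity

end Posterior

/-! ### Properness and stationarity of the posterior. -/

section Normalization

open Matrix

variable {X : Matrix (Fin n) (Fin p) ℝ} {Y : Fin n → ℝ} {lam : ℝ}

theorem exists_rpow_le_exp {a L η : ℝ} (ha : 0 < a) (hL : 0 ≤ L) (hη : 0 < η) :
    ∃ K, 0 ≤ K ∧ ∀ y, 0 ≤ y → (L * (1 + y)) ^ a ≤ K * Real.exp (η * y) := by
  refine ⟨(L * (a / η)) ^ a * Real.exp η, by positivity, fun y hy => ?_⟩
  have h1 : 1 + y ≤ a / η * Real.exp (η * (1 + y) / a) := by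
    have := Real.add_one_le_exp (η * (1 + y) / a)
    calc 1 + y = a / η * (η * (1 + y) / a) := by field_simp
      _ ≤ _ := by gcongr; linarith
  calc (L * (1 + y)) ^ a ≤ (L * (a / η * Real.exp (η * (1 + y) / a))) ^ a := by gcongr
    _ = (L * (a / η)) ^ a * Real.exp η * Real.exp (η * y) := by
      rw [← mul_assoc, Real.mul_rpow (by positivity) (Real.exp_nonneg _), ← Real.exp_mul,
        div_mul_cancel₀ _ ha.ne', mul_assoc, ← Real.exp_add]
      congr 2; ring

theorem lintegral_exp_neg_sq_div {v : ℝ} (hv : 0 < v) :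
    ∫⁻ t : ℝ, ENNReal.ofReal (Real.exp (-t ^ 2 / (2 * v))) =
      ENNReal.ofReal (√(2 * Real.pi * v)) := by
  have e : ∀ t : ℝ, ENNReal.ofReal (Real.exp (-t ^ 2 / (2 * v))) =
      ENNReal.ofReal (√(2 * Real.pi * v)) * gaussianPDF 0 v.toNNReal t := fun t => by
    rw [gaussianPDF, ← ENNReal.ofReal_mul (by positivity), gaussianPDFReal,
      Real.coe_toNNReal _ hv.le, sub_zero, mul_inv_cancel_left₀ (by positivity)]
  simp_rw [e]
  rw [lintegral_const_mul _ (measurable_gaussianPDF _ _),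
    lintegral_gaussianPDF_eq_one _ (by simpa using hv), mul_one]

/-- A lower bound for the residual which is uniform up to a factor linear in `τ`. -/
theorem exists_inv_residual_le (X : Matrix (Fin n) (Fin p) ℝ) (hY : ∃ i l, Y i ≠ Y l) :
    ∃ L, 0 ≤ L ∧ ∀ τ : Fin p → ℝ, (∀ j, 0 < τ j) → 1 / residual X Y τ ≤ L * (1 + ∑ j, τ j) := by
  set y := centered Y with hy
  have hyy : 0 < y ⬝ᵥ y :=
    lt_of_le_of_ne (Finset.sum_nonneg fun i _ => mul_self_nonneg _)
      fun h => centered_ne_zero hY (dotProduct_self_eq_zero.1 h.symm)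
  set F := ∑ i, ∑ j, X i j ^ 2 with hF
  have hF0 : 0 ≤ F := Finset.sum_nonneg fun i _ => Finset.sum_nonneg fun j _ => sq_nonneg _
  -- From `‖y‖² ≤ 2‖y - Xm‖² + 2‖Xm‖²`: the first norm is at most the residual, the second at most
  -- `F Σ τ_j` times the residual.
  refine ⟨2 * (1 + F) / (y ⬝ᵥ y), by positivity, fun τ hτ => ?_⟩
  have hC := residual_pos X hY hτ
  have hT : 0 ≤ ∑ j, τ j := Finset.sum_nonneg fun j _ => (hτ j).le
  set m := betaMean X Y τ with hm
  have h1 : (y - X *ᵥ m) ⬝ᵥ (y - X *ᵥ m) ≤ residual X Y τ := by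
    rw [residual_eq_add X Y hτ]
    exact le_add_of_nonneg_right (Finset.sum_nonneg fun j _ =>
      div_nonneg (sq_nonneg _) (hτ j).le)
  have h2 : (X *ᵥ m) ⬝ᵥ (X *ᵥ m) ≤ F * ((∑ j, τ j) * residual X Y τ) := by
    calc (X *ᵥ m) ⬝ᵥ (X *ᵥ m) = ∑ i, (∑ j, X i j * m j) ^ 2 := by
          simp [dotProduct, mulVec, sq]
      _ ≤ ∑ i, (∑ j, X i j ^ 2) * ∑ j, m j ^ 2 :=
          Finset.sum_le_sum fun i _ => Finset.sum_mul_sq_le_sq_mul_sq _ _ _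
      _ = F * ∑ j, m j ^ 2 := by rw [hF, Finset.sum_mul]
      _ ≤ _ := mul_le_mul_of_nonneg_left (sum_sq_betaMean_le X Y hτ) hF0
  have h3 : y ⬝ᵥ y ≤ 2 * ((y - X *ᵥ m) ⬝ᵥ (y - X *ᵥ m)) + 2 * ((X *ᵥ m) ⬝ᵥ (X *ᵥ m)) := by
    simp only [dotProduct, Finset.mul_sum]
    rw [← Finset.sum_add_distrib]
    refine Finset.sum_le_sum fun i _ => ?_
    simp only [Pi.sub_apply]
    nlinarith [sq_nonneg (y i - 2 * (X *ᵥ m) i)]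
  rw [div_le_iff₀ hC, div_mul_eq_mul_div, div_mul_eq_mul_div, le_div_iff₀ hyy, one_mul]
  refine h3.trans ?_
  have h4 : 0 ≤ (∑ j, τ j) * residual X Y τ := by positivity
  have h5 : 0 ≤ F * residual X Y τ := by positivity
  linarith

/-- The Gaussian normalizations cancel the singular factors `τ_j^(-1/2)`, leaving pure exponentials.
-/
theorem prod_sqrt_mul_priorFactor {τ : Fin p → ℝ} (hτ : ∀ j, 0 < τ j) :
    (∏ j, √(2 * Real.pi * (2 * τ j))) * priorFactor n lam τ =
      √(2 * Real.pi / n) / √(2 * Real.pi) ^ n * (√2 * (lam ^ 2 / 2)) ^ p *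
        ∏ j, Real.exp (-(lam ^ 2 * τ j / 2)) := by
  have hc : (√2 * (lam ^ 2 / 2)) ^ p = ∏ _j : Fin p, √2 * (lam ^ 2 / 2) := by simp
  rw [priorFactor, hc, mul_left_comm, ← Finset.prod_mul_distrib, mul_assoc,
    ← Finset.prod_mul_distrib]
  congr 1
  refine Finset.prod_congr rfl fun j _ => ?_
  have ht := hτ j
  have h1 : √(2 * Real.pi * (2 * τ j)) = √2 * √(2 * Real.pi * τ j) := by
    rw [← Real.sqrt_mul (by norm_num)]; congr 1; ring
  have h2 : 0 < √(2 * Real.pi * τ j) := by positivity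
  rw [h1]
  field_simp

/-- Instead of integrating exactly, which would leave `det A_τ`, the penalized sum of squares is
bounded below by half the sum of its minimum and the penalty. The integrand becomes a product of
one-dimensional Gaussians and an inverse gamma density. -/
theorem lintegral_joint_le (hY : ∃ i l, Y i ≠ Y l) {τ : Fin p → ℝ}
    (hτ : ∀ j, 0 < τ j) :
    ∫⁻ x, ENNReal.ofReal (posteriorDensity X Y lam x) * ENNReal.ofReal (tauPDF lam x.1 x.2 τ)
        ∂(stateVolume p) ≤
      ENNReal.ofReal (priorFactor n lam τ * (∏ j, √(2 * Real.pi * (2 * τ j))) *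
        (Real.Gamma (((n : ℝ) - 1) / 2) / (residual X Y τ / 4) ^ (((n : ℝ) - 1) / 2))) := by
  have hn : (2 : ℝ) ≤ n := by exact_mod_cast two_le_of_exists_ne hY
  have hC := residual_pos X hY hτ
  have hφ := priorFactor_nonneg n lam τ
  set a : ℝ := ((n : ℝ) - 1) / 2 with ha
  set C := residual X Y τ with hCdef
  set g : ℝ → (Fin p → ℝ) → ℝ≥0∞ := fun s β =>
    ENNReal.ofReal (priorFactor n lam τ * (s ^ (-a - 1) * Real.exp (-(C / 4) / s))) *
      (ENNReal.ofReal (√s ^ p)⁻¹ *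
        ∏ j, ENNReal.ofReal (Real.exp (-(β j) ^ 2 / (2 * (s * (2 * τ j)))))) with hg
  have hgm : Measurable fun x : State p => g x.2 x.1 := by
    simp only [hg]
    refine Measurable.mul (by fun_prop) (Measurable.mul (by fun_prop) ?_)
    exact Finset.measurable_prod _ fun j _ => by fun_prop
  have hle : ∀ x : State p, ENNReal.ofReal (posteriorDensity X Y lam x) *
      ENNReal.ofReal (tauPDF lam x.1 x.2 τ) ≤ g x.2 x.1 := by
    intro x
    have hs : (0 : ℝ) < x.2 := x.2.2
    have hM : 0 ≤ posteriorDensity X Y lam x * tauPDF lam x.1 x.2 τ →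
      ENNReal.ofReal (posteriorDensity X Y lam x) * ENNReal.ofReal (tauPDF lam x.1 x.2 τ) ≤
        ENNReal.ofReal (posteriorDensity X Y lam x * tauPDF lam x.1 x.2 τ) := fun h => by
      by_cases h0 : 0 ≤ posteriorDensity X Y lam x
      · rw [ENNReal.ofReal_mul h0]
      · rw [ENNReal.ofReal_of_nonpos (not_le.1 h0).le, zero_mul]; exact zero_le
    rw [posteriorDensity_mul_tauPDF x hτ] at hM
    refine (hM (by positivity)).trans ?_
    simp only [hg]
    rw [← ENNReal.ofReal_prod_of_nonneg fun j _ => Real.exp_nonneg _,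
      ← ENNReal.ofReal_mul (by positivity), ← ENNReal.ofReal_mul (by positivity), ← Real.exp_sum]
    refine ENNReal.ofReal_le_ofReal ?_
    have hS : ∑ j, -(x.1 j) ^ 2 / (2 * (x.2 * (2 * τ j))) =
        -(∑ j, x.1 j ^ 2 / τ j) / (4 * x.2) := by
      rw [← Finset.sum_neg_distrib, Finset.sum_div]
      refine Finset.sum_congr rfl fun j _ => ?_
      have := hτ j
      field_simp; ring
    have hE : Real.exp (-((centered Y - X *ᵥ x.1) ⬝ᵥ (centered Y - X *ᵥ x.1) +
          ∑ j, x.1 j ^ 2 / τ j) / (2 * x.2)) ≤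
        Real.exp (-(C / 4) / x.2) * Real.exp (-(∑ j, x.1 j ^ 2 / τ j) / (4 * x.2)) := by
      rw [← Real.exp_add, Real.exp_le_exp]
      have h1 := residual_le X Y hτ x.1
      have h2 : 0 ≤ (centered Y - X *ᵥ x.1) ⬝ᵥ (centered Y - X *ᵥ x.1) :=
        Finset.sum_nonneg fun i _ => mul_self_nonneg _
      rw [← hCdef] at h1
      have e : -(C / 4) / (x.2 : ℝ) + -(∑ j, x.1 j ^ 2 / τ j) / (4 * x.2) =
          -((C + ∑ j, x.1 j ^ 2 / τ j) / 2) / (2 * x.2) := by field_simp; ring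
      rw [e]
      gcongr
      linarith
    rw [hS]
    have h0 : 0 ≤ priorFactor n lam τ * ((x.2 : ℝ) ^ (-a - 1) * (√(x.2 : ℝ) ^ p)⁻¹) := by
      positivity
    calc _ = priorFactor n lam τ * ((x.2 : ℝ) ^ (-a - 1) * (√(x.2 : ℝ) ^ p)⁻¹) *
          Real.exp (-((centered Y - X *ᵥ x.1) ⬝ᵥ (centered Y - X *ᵥ x.1) +
          ∑ j, x.1 j ^ 2 / τ j) / (2 * x.2)) := by ring
      _ ≤ _ := mul_le_mul_of_nonneg_left hE h0
      _ = _ := by ring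
  refine (lintegral_mono hle).trans (le_of_eq ?_)
  rw [stateVolume, lintegral_prod_symm _ hgm.aemeasurable]
  have hinner : ∀ s : Set.Ioi (0 : ℝ), ∫⁻ β, g s β =
      ENNReal.ofReal (priorFactor n lam τ * ∏ j, √(2 * Real.pi * (2 * τ j))) *
        ENNReal.ofReal ((s : ℝ) ^ (-a - 1) * Real.exp (-(C / 4) / s)) := fun s => by
    have hs : (0 : ℝ) < s := s.2
    have hp : ∏ j, ENNReal.ofReal (√(2 * Real.pi * (s * (2 * τ j)))) =
        ENNReal.ofReal (√(s : ℝ) ^ p * ∏ j, √(2 * Real.pi * (2 * τ j))) := by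
      rw [← ENNReal.ofReal_prod_of_nonneg fun j _ => Real.sqrt_nonneg _]
      congr 1
      have hc : √(s : ℝ) ^ p = ∏ _j : Fin p, √(s : ℝ) := by simp
      rw [hc, ← Finset.prod_mul_distrib]
      refine Finset.prod_congr rfl fun j _ => ?_
      rw [← Real.sqrt_mul hs.le]; congr 1; ring
    simp only [hg]
    rw [lintegral_const_mul' _ _ ENNReal.ofReal_ne_top,
      lintegral_const_mul' _ _ ENNReal.ofReal_ne_top,
      lintegral_pi_prod (fun j t => ENNReal.ofReal (Real.exp (-t ^ 2 / (2 * (s * (2 * τ j))))))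
        fun j => by fun_prop]
    simp_rw [fun j => lintegral_exp_neg_sq_div (mul_pos hs (mul_pos two_pos (hτ j)))]
    have hP : 0 ≤ ∏ j, √(2 * Real.pi * (2 * τ j)) :=
      Finset.prod_nonneg fun j _ => Real.sqrt_nonneg _
    rw [hp, ← ENNReal.ofReal_mul (by positivity), ← ENNReal.ofReal_mul (by positivity),
      ← ENNReal.ofReal_mul (by positivity)]
    congr 1
    field_simp
  simp_rw [hinner]
  rw [lintegral_const_mul' _ _ ENNReal.ofReal_ne_top,
    lintegral_posVolume fun s => ENNReal.ofReal (s ^ (-a - 1) * Real.exp (-(C / 4) / s)),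
    lintegral_invGamma (by rw [ha]; linarith) (by linarith), ← ENNReal.ofReal_mul]
  exact mul_nonneg hφ (Finset.prod_nonneg fun j _ => Real.sqrt_nonneg _)

theorem exists_lintegral_joint_le (X : Matrix (Fin n) (Fin p) ℝ) (hY : ∃ i l, Y i ≠ Y l)
    (hlam : 0 < lam) :
    ∃ K : ℝ, ∀ τ : Fin p → ℝ, (∀ j, 0 < τ j) →
      ∫⁻ x, ENNReal.ofReal (posteriorDensity X Y lam x) * ENNReal.ofReal (tauPDF lam x.1 x.2 τ)
        ∂(stateVolume p) ≤ ENNReal.ofReal (K * ∏ j, Real.exp (-(lam ^ 2 / 4) * τ j)) := by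
  have hn : (2 : ℝ) ≤ n := by exact_mod_cast two_le_of_exists_ne hY
  obtain ⟨L, hL, hLC⟩ := exists_inv_residual_le X hY
  have ha : 0 < ((n : ℝ) - 1) / 2 := by linarith
  set a := ((n : ℝ) - 1) / 2
  -- The power of `1 + Σ τ_j` coming from the residual is absorbed by half of the exponential decay
  -- rate `λ²/2`.
  obtain ⟨K, hK, hKe⟩ := exists_rpow_le_exp (L := 4 * L) ha (by positivity)
    (show 0 < lam ^ 2 / 4 by positivity)
  have hΓ := Real.Gamma_pos_of_pos ha
  refine ⟨√(2 * Real.pi / n) / √(2 * Real.pi) ^ n * (√2 * (lam ^ 2 / 2)) ^ p *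
    (Real.Gamma a * K), fun τ hτ => (lintegral_joint_le hY hτ).trans ?_⟩
  refine ENNReal.ofReal_le_ofReal ?_
  have hC := residual_pos X hY hτ
  have hT : 0 ≤ ∑ j, τ j := Finset.sum_nonneg fun j _ => (hτ j).le
  have h1 : 1 / (residual X Y τ / 4) ^ a ≤ K * ∏ j, Real.exp (lam ^ 2 / 4 * τ j) := by
    rw [← Real.exp_sum, ← Finset.mul_sum]
    refine le_trans ?_ (hKe _ hT)
    rw [one_div, ← Real.inv_rpow (by positivity)]
    refine Real.rpow_le_rpow (by positivity) ?_ ha.le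
    have := hLC τ hτ
    rw [inv_div, mul_assoc]
    have e : 4 / residual X Y τ = 4 * (1 / residual X Y τ) := by ring
    rw [e]
    gcongr
  rw [mul_comm (priorFactor n lam τ), prod_sqrt_mul_priorFactor hτ]
  have hexp : ∏ j, Real.exp (-(lam ^ 2 / 4) * τ j) = (∏ j, Real.exp (-(lam ^ 2 * τ j / 2))) *
      ∏ j, Real.exp (lam ^ 2 / 4 * τ j) := by
    rw [← Finset.prod_mul_distrib]
    refine Finset.prod_congr rfl fun j _ => ?_
    rw [← Real.exp_add]; congr 1; ring
  rw [hexp]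
  have hP : 0 ≤ ∏ j, Real.exp (-(lam ^ 2 * τ j / 2)) :=
    Finset.prod_nonneg fun j _ => Real.exp_nonneg _
  set c := √(2 * Real.pi / n) / √(2 * Real.pi) ^ n * (√2 * (lam ^ 2 / 2)) ^ p
  have hc : 0 ≤ c := by positivity
  set E₁ := ∏ j, Real.exp (-(lam ^ 2 * τ j / 2))
  set E₂ := ∏ j, Real.exp (lam ^ 2 / 4 * τ j)
  calc c * E₁ * (Real.Gamma a / (residual X Y τ / 4) ^ a)
      = c * E₁ * Real.Gamma a * (1 / (residual X Y τ / 4) ^ a) := by ring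
    _ ≤ c * E₁ * Real.Gamma a * (K * E₂) := mul_le_mul_of_nonneg_left h1 (by positivity)
    _ = _ := by ring

theorem measurable_joint (X : Matrix (Fin n) (Fin p) ℝ) (Y : Fin n → ℝ) (lam : ℝ) :
    Measurable (Function.uncurry fun (x : State p) (τ : Fin p → ℝ) =>
      ENNReal.ofReal (posteriorDensity X Y lam x) * ENNReal.ofReal (tauPDF lam x.1 x.2 τ)) :=
  ((measurable_posteriorDensity X Y lam).ennreal_ofReal.comp measurable_fst).mul
    (measurable_tauPDF lam)

/-- Reinserting the `τ`-density, which has mass 1, and applying Tonelli reduces the claim to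
integrating a product of exponentials in `τ`. -/
theorem lintegral_posteriorDensity_lt_top (X : Matrix (Fin n) (Fin p) ℝ)
    (hY : ∃ i l, Y i ≠ Y l) (hlam : 0 < lam) :
    ∫⁻ x, ENNReal.ofReal (posteriorDensity X Y lam x) ∂(stateVolume p) < ∞ := by
  obtain ⟨K, hK⟩ := exists_lintegral_joint_le X hY hlam
  have e : ∀ x : State p, ENNReal.ofReal (posteriorDensity X Y lam x) =
      ∫⁻ τ, ENNReal.ofReal (posteriorDensity X Y lam x) *
        ENNReal.ofReal (tauPDF lam x.1 x.2 τ) := fun x => by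
    rw [lintegral_const_mul _ (measurable_ofReal_tauPDF lam x), lintegral_tauPDF hlam, mul_one]
  rw [lintegral_congr e]
  rw [lintegral_lintegral_swap (measurable_joint X Y lam).aemeasurable]
  have hneg : -(lam ^ 2 / 4) < 0 := by
    have : 0 < lam ^ 2 := by positivity
    linarith
  have hf : ∫⁻ t : ℝ, (Set.Ioi (0 : ℝ)).indicator
      (fun t => ENNReal.ofReal (Real.exp (-(lam ^ 2 / 4) * t))) t < ∞ := by
    rw [lintegral_indicator measurableSet_Ioi]
    rw [← ofReal_integral_eq_lintegral_ofReal (integrableOn_exp_mul_Ioi hneg 0)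
      (ae_of_all _ fun t => Real.exp_nonneg _)]
    exact ENNReal.ofReal_lt_top
  calc _ ≤ ∫⁻ τ : Fin p → ℝ, ENNReal.ofReal K * ∏ j, (Set.Ioi (0 : ℝ)).indicator
          (fun t => ENNReal.ofReal (Real.exp (-(lam ^ 2 / 4) * t))) (τ j) := by
        refine lintegral_mono fun τ => ?_
        by_cases hτ : ∀ j, 0 < τ j
        · refine (hK τ hτ).trans (le_of_eq ?_)
          rw [ENNReal.ofReal_mul' (Finset.prod_nonneg fun j _ => Real.exp_nonneg _),
            ENNReal.ofReal_prod_of_nonneg fun j _ => Real.exp_nonneg _]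
          congr 1
          exact Finset.prod_congr rfl fun j _ => by
            rw [Set.indicator_of_mem (Set.mem_Ioi.mpr (hτ j))]
        · simp [tauPDF_eq_zero hτ]
    _ < ∞ := by
        rw [lintegral_const_mul' _ _ ENNReal.ofReal_ne_top, lintegral_pi_prod
          (fun _ => (Set.Ioi (0 : ℝ)).indicator
            (fun t => ENNReal.ofReal (Real.exp (-(lam ^ 2 / 4) * t))))
          fun j => Measurable.indicator (by fun_prop) measurableSet_Ioi]
        exact ENNReal.mul_lt_top ENNReal.ofReal_lt_top (ENNReal.prod_lt_top fun j _ => hf)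

theorem stateVolume_ne_zero : stateVolume p ≠ 0 := by
  intro h
  have h1 : posVolume Set.univ = ∞ := by
    have := lintegral_posVolume fun _ => 1
    simpa using this
  have h2 : stateVolume p (Set.univ ×ˢ Set.univ) ≠ 0 := by
    rw [stateVolume, Measure.prod_prod, h1]
    exact mul_ne_zero (NeZero.ne _) ENNReal.top_ne_zero
  simp [h] at h2

theorem posterior_eq (hn : n ≠ 0) (hlam : 0 < lam) (hX : ∀ j, ∑ i, X i j = 0) :
    posterior X Y lam =
      (∫⁻ x, ENNReal.ofReal (posteriorDensity X Y lam x) ∂(stateVolume p))⁻¹ •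
        (stateVolume p).withDensity fun x => ENNReal.ofReal (posteriorDensity X Y lam x) := by
  rw [posterior, marginalDensity_eq hn hlam hX]

theorem isProbabilityMeasure_posterior (hlam : 0 < lam) (hX : ∀ j, ∑ i, X i j = 0)
    (hY : ∃ i l, Y i ≠ Y l) : IsProbabilityMeasure (posterior X Y lam) := by
  have hn : 0 < n := lt_of_lt_of_le two_pos (two_le_of_exists_ne hY)
  rw [posterior_eq hn.ne' hlam hX]
  refine ⟨?_⟩
  rw [Measure.smul_apply, withDensity_apply _ MeasurableSet.univ, Measure.restrict_univ,
    smul_eq_mul]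
  refine ENNReal.inv_mul_cancel ?_ (lintegral_posteriorDensity_lt_top X hY hlam).ne
  intro h0
  rw [lintegral_eq_zero_iff (measurable_posteriorDensity X Y lam).ennreal_ofReal] at h0
  have hfalse : ∀ᵐ x ∂(stateVolume p), False := by
    filter_upwards [h0] with x hx
    have := posteriorDensity_pos (X := X) (Y := Y) hn hlam x
    simp only [Pi.zero_apply, ENNReal.ofReal_eq_zero] at hx
    linarith
  rw [Filter.eventually_false_iff_eq_bot, ae_eq_bot] at hfalse
  exact stateVolume_ne_zero hfalse

/-- By Tonelli `τ` becomes the outer variable. There the joint density factors through the block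
density, so averaging the block kernel over the old state reproduces the joint density of the new
one. -/
theorem invariant_posterior (hlam : 0 < lam) (hX : ∀ j, ∑ i, X i j = 0)
    (hY : ∃ i l, Y i ≠ Y l) : (gibbsKernel X Y lam).Invariant (posterior X Y lam) := by
  have hn : 0 < n := lt_of_lt_of_le two_pos (two_le_of_exists_ne hY)
  have hM := (measurable_posteriorDensity X Y lam).ennreal_ofReal
  rw [posterior_eq hn.ne' hlam hX, Kernel.Invariant]
  refine Measure.ext fun A hA => ?_
  rw [Measure.bind_apply hA (gibbsKernel X Y lam).aemeasurable, lintegral_smul_measure,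
    Measure.smul_apply]
  congr 1
  rw [lintegral_withDensity_eq_lintegral_mul _ hM ((gibbsKernel X Y lam).measurable_coe hA),
    withDensity_apply _ hA]
  have hblock : Measurable fun τ : Fin p → ℝ => blockKernel X Y τ A :=
    (blockKernel X Y).measurable_coe hA
  have hjoint := measurable_joint X Y lam
  calc ∫⁻ x, ENNReal.ofReal (posteriorDensity X Y lam x) * gibbsKernel X Y lam x A ∂(stateVolume p)
      = ∫⁻ x, (∫⁻ τ : Fin p → ℝ, ENNReal.ofReal (posteriorDensity X Y lam x) *
          ENNReal.ofReal (tauPDF lam x.1 x.2 τ) * blockKernel X Y τ A) ∂(stateVolume p) := by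
        refine lintegral_congr fun x => ?_
        have h := lintegral_gibbsKernel X Y lam x (g := A.indicator 1) (measurable_one.indicator hA)
        simp only [lintegral_indicator_one hA] at h
        rw [h, ← lintegral_const_mul' _ _ ENNReal.ofReal_ne_top]
        simp_rw [mul_assoc]
    _ = ∫⁻ τ, ∫⁻ x, ENNReal.ofReal (posteriorDensity X Y lam x) *
          ENNReal.ofReal (tauPDF lam x.1 x.2 τ) * blockKernel X Y τ A ∂(stateVolume p) :=
        lintegral_lintegral_swap (hjoint.mul (hblock.comp measurable_snd)).aemeasurable
    _ = ∫⁻ τ, ∫⁻ x in A, ENNReal.ofReal (posteriorDensity X Y lam x) *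
          ENNReal.ofReal (tauPDF lam x.1 x.2 τ) ∂(stateVolume p) := by
        refine lintegral_congr fun τ => ?_
        by_cases hτ : ∀ j, 0 < τ j
        · have hN := tauMarginal_nonneg (X := X) (lam := lam) hY hτ
          have hspec : ∀ x : State p, ENNReal.ofReal (posteriorDensity X Y lam x) *
              ENNReal.ofReal (tauPDF lam x.1 x.2 τ) =
              ENNReal.ofReal (tauMarginal X Y lam τ) * ENNReal.ofReal (blockPDF X Y τ x) :=
            fun x => by
              rw [← ENNReal.ofReal_mul (posteriorDensity_pos hn hlam x).le,
                tauMarginal_spec hY x hτ, ENNReal.ofReal_mul hN]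
          have := isProbabilityMeasure_blockKernel (X := X) hY hτ
          have h1 : ∫⁻ x, ENNReal.ofReal (blockPDF X Y τ x) ∂(stateVolume p) = 1 := by
            have h2 : blockKernel X Y τ Set.univ = 1 := measure_univ
            rwa [blockKernel_apply, withDensity_apply _ MeasurableSet.univ,
              Measure.restrict_univ] at h2
          have h3 : blockKernel X Y τ A =
              ∫⁻ x in A, ENNReal.ofReal (blockPDF X Y τ x) ∂(stateVolume p) := by
            rw [blockKernel_apply, withDensity_apply _ hA]
          simp_rw [hspec]
          rw [lintegral_mul_const' _ _ (measure_ne_top _ _),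
            lintegral_const_mul' _ _ ENNReal.ofReal_ne_top, h1, mul_one,
            lintegral_const_mul' _ _ ENNReal.ofReal_ne_top, h3]
        · simp [tauPDF_eq_zero hτ]
    _ = ∫⁻ x in A, (∫⁻ τ : Fin p → ℝ, ENNReal.ofReal (posteriorDensity X Y lam x) *
          ENNReal.ofReal (tauPDF lam x.1 x.2 τ)) ∂(stateVolume p) :=
        (lintegral_lintegral_swap hjoint.aemeasurable).symm
    _ = _ := by
        refine lintegral_congr fun x => ?_
        rw [lintegral_const_mul _ (measurable_ofReal_tauPDF lam x), lintegral_tauPDF hlam, mul_one]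

end Normalization

/-! ### Choice of constants and assembly. -/

/-- Young's inequality in the variable `(k/N)v_j` costs `k²/(4γ)` per coordinate, and `k²/N ≤ k`
accounts for the rest, so `b = p(k²/(4γ) + k)`. Scaling by `k/N` thus replaces `N` by the smaller
`k` in `b`. -/
theorem drift_function_le {N γ b k : ℝ} (hN : 1 ≤ N) (hk : k = (N + 3) / 4) (hγ0 : 0 < γ)
    (hb : b = ((N + 3) * p) * (16 * γ + (N + 3)) / (64 * γ)) (v : Fin p → ℝ) :
    k ^ 2 / N * ∑ j, (v j + 1) ≤ γ * ((k / N) ^ 2 * ∑ j, v j ^ 2) + b := by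
  have hb' : b = ∑ _j : Fin p, (k ^ 2 / (4 * γ) + k) := by
    rw [Finset.sum_const, Finset.card_univ, Fintype.card_fin, nsmul_eq_mul, hb, hk]
    field_simp
    ring
  rw [hb', Finset.mul_sum, Finset.mul_sum, Finset.mul_sum, ← Finset.sum_add_distrib]
  refine Finset.sum_le_sum fun j _ => ?_
  have hN0 : 0 < N := by linarith
  have h1 : k ^ 2 / N ≤ k := by
    rw [div_le_iff₀ hN0]
    subst hk
    nlinarith
  have h2 : k * (k / N * v j) ≤ γ * (k / N * v j) ^ 2 + k ^ 2 / (4 * γ) := by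
    have h3 : γ * (k / N * v j) ^ 2 + k ^ 2 / (4 * γ) - k * (k / N * v j) =
        γ * (k / N * v j - k / (2 * γ)) ^ 2 := by
      field_simp
      ring
    have h4 : 0 ≤ γ * (k / N * v j - k / (2 * γ)) ^ 2 := by positivity
    linarith
  calc k ^ 2 / N * (v j + 1) = k * (k / N * v j) + k ^ 2 / N := by ring
    _ ≤ γ * (k / N * v j) ^ 2 + k ^ 2 / (4 * γ) + k := by linarith
    _ = _ := by ring

theorem exists_split_le {q U α r : ℝ} (hq0 : 0 ≤ q) (hq1 : q ≤ 1) (hα1 : 1 ≤ α) (hU : 1 ≤ U)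
    (hr0 : 0 < r) {k : ℕ} (hk : 1 ≤ k) :
    ∃ j : ℕ, q ^ (j + 1) ≤ q ^ (r * (k : ℝ)) ∧
      (α * U) ^ j / α ^ k ≤ (U ^ r / α ^ (1 - r)) ^ k := by
  have hα : 0 < α := by linarith
  have hU0 : 0 < U := by linarith
  have hrk : 0 < r * k := mul_pos hr0 (by exact_mod_cast hk)
  -- With `j + 1 = ⌈rk⌉` one has `j ≤ rk ≤ j + 1`, so the overlap factor has at least `rk` powers
  -- and the drift term at most `rk` powers of `αU`.
  obtain ⟨j, hj⟩ : ∃ j, ⌈r * k⌉₊ = j + 1 :=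
    Nat.exists_eq_succ_of_ne_zero (Nat.ceil_pos.mpr hrk).ne'
  have hj1 : r * k ≤ ((j + 1 : ℕ) : ℝ) := hj ▸ Nat.le_ceil _
  have hj2 : (j : ℝ) ≤ r * k := by
    have := Nat.ceil_lt_add_one hrk.le
    rw [hj] at this
    push_cast at this
    linarith
  refine ⟨j, ?_, ?_⟩
  · rw [← Real.rpow_natCast]
    -- In the application `q = 0` means `ε = 1`, that is `p = 0`; both exponents must then be
    -- positive, which uses `k ≥ 1`.
    rcases hq0.eq_or_lt with rfl | hq
    · rw [Real.zero_rpow hrk.ne', Real.zero_rpow (by positivity)]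
    · exact Real.rpow_le_rpow_of_exponent_ge hq hq1 hj1
  · have hαU : 1 ≤ α * U := one_le_mul_of_one_le_of_one_le hα1 hU
    calc (α * U) ^ j / α ^ k = (α * U) ^ (j : ℝ) / α ^ k := by rw [Real.rpow_natCast]
      _ ≤ (α * U) ^ (r * k) / α ^ k := by gcongr
      _ = (U ^ r / α ^ (1 - r)) ^ k := by
        rw [Real.rpow_mul (by positivity), Real.rpow_natCast, ← div_pow,
          Real.mul_rpow hα.le hU0.le, Real.rpow_sub hα, Real.rpow_one]
        congr 1
        field_simp

theorem gibbsKernel_abs_sub_le {X : Matrix (Fin n) (Fin p) ℝ} {Y : Fin n → ℝ} {lam : ℝ}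
    (hlam : 0 < lam) (hX : ∀ j, ∑ i, X i j = 0) (hY : ∃ i l, Y i ≠ Y l)
    {γ b d r ε U α : ℝ} (hγ0 : 0 < γ) (hγ1 : γ < 1)
    (hb : b = (((n : ℝ) + 3) * p) * (16 * γ + ((n : ℝ) + 3)) / (64 * γ))
    (hd : 2 * b / (1 - γ) < d) (hr0 : 0 < r)
    (hε : ε = Real.exp (-((p : ℝ) * √d)))
    (hU : U = 1 + 2 * (γ * d + b))
    (hα : α = (1 + d) / (1 + 2 * b + γ * d))
    (x : State p) {k : ℕ} (hk : 1 ≤ k) {A : Set (State p)} (hA : MeasurableSet A) :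
    |((gibbsKernel X Y lam ^ k) x).real A - (posterior X Y lam).real A| ≤
      (1 - ε) ^ (r * (k : ℝ)) + (U ^ r / α ^ (1 - r)) ^ k *
        (1 + b / (1 - γ) + lam ^ 2 * (∑ j, x.1 j ^ 2) / (x.2 : ℝ)) := by
  have hn : (2 : ℝ) ≤ n := by exact_mod_cast two_le_of_exists_ne hY
  have hblock : ∀ τ : Fin p → ℝ, (∀ j, 0 < τ j) → IsProbabilityMeasure (blockKernel X Y τ) :=
    fun τ hτ => isProbabilityMeasure_blockKernel hY hτ
  have := isMarkovKernel_gibbsKernel hlam hblock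
  have := isProbabilityMeasure_posterior hlam hX hY
  have hinv := invariant_posterior hlam hX hY
  have hγ : 0 < 1 - γ := by linarith
  have hb0 : 0 ≤ b := by rw [hb]; positivity
  have hd0 : 0 < d := lt_of_le_of_lt (by positivity) hd
  have hα1 : 1 ≤ α := by
    rw [div_lt_iff₀ hγ] at hd
    rw [hα, le_div_iff₀ (by positivity)]
    linarith
  have hU1 : 1 ≤ U := by
    have : 0 ≤ 2 * (γ * d + b) := by positivity
    linarith
  have hε1 : ε ≤ 1 := by
    rw [hε, Real.exp_le_one_iff]
    have : 0 ≤ (p : ℝ) * √d := by positivity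
    linarith
  have hε0 : 0 < ε := hε ▸ Real.exp_pos _
  obtain ⟨c, hc⟩ : ∃ c : ℝ, c = ((n : ℝ) + 3) / 4 := ⟨_, rfl⟩
  let v : State p → Fin p → ℝ := fun x j => lam * stdCoef x j
  have hv0 : ∀ x j, 0 ≤ v x j := fun x j => mul_nonneg hlam.le (stdCoef_nonneg x j)
  let W : State p → ℝ := fun x => (c / n) ^ 2 * ∑ j, v x j ^ 2
  let w : State p → ℝ := fun x => c ^ 2 / n * ∑ j, (v x j + 1)
  have hW : Measurable W := by
    refine Measurable.const_mul (Finset.measurable_sum _ fun j _ => ?_) _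
    exact ((measurable_stdCoef j).const_mul lam).pow_const 2
  have hW0 : ∀ x, 0 ≤ W x := fun x =>
    mul_nonneg (sq_nonneg _) (Finset.sum_nonneg fun j _ => sq_nonneg _)
  have hw0 : ∀ x, 0 ≤ w x := fun x =>
    mul_nonneg (by positivity) (Finset.sum_nonneg fun j _ => by have := hv0 x j; linarith)
  have hdrift : ∀ x, ∫⁻ y, ENNReal.ofReal (W y) ∂(gibbsKernel X Y lam x) ≤
      ENNReal.ofReal (w x) := by
    refine lintegral_gibbsKernel_le hlam hW (by positivity) fun τ hτ => ?_
    have e : ∀ y : State p, ENNReal.ofReal (W y) =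
        ENNReal.ofReal ((c / n) ^ 2 * lam ^ 2) * ENNReal.ofReal (∑ j, stdCoef y j ^ 2) :=
      fun y => by
        rw [← ENNReal.ofReal_mul (by positivity)]
        congr 1
        simp only [W, v, mul_pow, ← Finset.mul_sum]
        ring
    rw [lintegral_congr e, lintegral_const_mul' _ _ ENNReal.ofReal_ne_top]
    refine (mul_le_mul_right (lintegral_sum_stdCoef_sq_le hY hτ) _).trans (le_of_eq ?_)
    rw [← ENNReal.ofReal_mul (by positivity)]
    congr 1
    rw [← Finset.mul_sum]
    field_simp
  have hpair : ∀ x y, α * (1 + w x + w y) ≤ 1 + W x + W y ∨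
      (1 + w x + w y ≤ U ∧ ∃ μ : Measure (State p), μ ≤ gibbsKernel X Y lam x ∧
        μ ≤ gibbsKernel X Y lam y ∧ ε ≤ μ.real Set.univ) := by
    intro x y
    have h := drift_or_overlap hn hγ0 hγ1 hb hd hU hα (v x) (v y)
    rw [← hc] at h
    refine h.imp id fun ⟨h1, h2⟩ => ⟨h1, ?_⟩
    obtain ⟨μ, hx, hy, hm⟩ := exists_common_component hlam hblock x y
    refine ⟨μ, hx, hy, le_trans ?_ hm⟩
    rw [hε]
    exact Real.exp_le_exp.mpr (neg_le_neg h2)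
  have hWπ : ∫⁻ x, ENNReal.ofReal (W x) ∂(posterior X Y lam) ≤ ENNReal.ofReal (b / (1 - γ)) :=
    lintegral_le_of_invariant _ _ hinv W hW hW0 hγ0.le hγ1 hb0 fun x =>
      (hdrift x).trans (ENNReal.ofReal_le_ofReal
        (drift_function_le (by linarith) hc hγ0 hb (v x)))
  obtain ⟨j, hj1, hj2⟩ := exists_split_le (q := 1 - ε) (by linarith) (by linarith) hα1 hU1 hr0 hk
  have hα0 : 0 < α := by linarith
  have hU0 : 0 < U := by linarith
  -- The scale `c/n` is at most 1, so the unscaled drift function in the final bound dominates `W`.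
  have hWx : W x ≤ lam ^ 2 * (∑ j, x.1 j ^ 2) / (x.2 : ℝ) := by
    have h1 : ∑ j, v x j ^ 2 = lam ^ 2 * (∑ j, x.1 j ^ 2) / (x.2 : ℝ) := by
      simp only [v, mul_pow, stdCoef_sq, ← Finset.mul_sum, ← Finset.sum_div]
      ring
    rw [← h1]
    refine mul_le_of_le_one_left (Finset.sum_nonneg fun j _ => sq_nonneg _) ?_
    refine pow_le_one₀ (by rw [hc]; positivity) ?_
    rw [hc, div_le_one (by linarith)]
    linarith
  calc _ ≤ (1 - ε) ^ (j + 1) + (α * U) ^ j / α ^ k * (1 + b / (1 - γ) + W x) :=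
        abs_pow_sub_invariant_le _ _ hinv W hW hW0 hA k (by positivity) (by positivity) hWπ
          (abs_pow_sub_pow_le _ W w hW hW0 hw0 hdrift hε1 hα0 hα1 hU1 hpair hA k j) x
    _ ≤ _ := by
        refine add_le_add hj1 (mul_le_mul hj2 (by linarith) ?_ (by positivity))
        have := hW0 x
        positivity

end BayesianLasso

end

theorem theorem1 {n p : ℕ} (X : Matrix (Fin n) (Fin p) ℝ) (Y : Fin n → ℝ) (lam : ℝ)
    (hlam : 0 < lam)
    (hX : ∀ j, ∑ i, X i j = 0)
    (hY : ∃ i l, Y i ≠ Y l)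
    (γ b d r ε U α : ℝ) (hγ0 : 0 < γ) (hγ1 : γ < 1)
    (hb : b = (((n : ℝ) + 3) * p) * (16 * γ + ((n : ℝ) + 3)) / (64 * γ))
    (hd : 2 * b / (1 - γ) < d)
    (hr0 : 0 < r) (hr1 : r < 1)
    (hε : ε = Real.exp (-((p : ℝ) * √d)))
    (hU : U = 1 + 2 * (γ * d + b))
    (hα : α = (1 + d) / (1 + 2 * b + γ * d)) :
    IsMarkovKernel (BayesianLasso.gibbsKernel X Y lam) ∧
    IsProbabilityMeasure (BayesianLasso.posterior X Y lam) ∧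
    (BayesianLasso.gibbsKernel X Y lam).Invariant (BayesianLasso.posterior X Y lam) ∧
    ∀ (β₀ : Fin p → ℝ) (σ₀sq : Set.Ioi (0 : ℝ)) (k : ℕ), 1 ≤ k →
      BayesianLasso.tvDist ((BayesianLasso.gibbsKernel X Y lam ^ k) (β₀, σ₀sq))
          (BayesianLasso.posterior X Y lam) ≤
        (1 - ε) ^ (r * (k : ℝ)) +
          (U ^ r / α ^ (1 - r)) ^ k *
            (1 + b / (1 - γ) + lam ^ 2 * (∑ j, β₀ j ^ 2) / (σ₀sq : ℝ)) := by
  refine ⟨BayesianLasso.isMarkovKernel_gibbsKernel hlam fun τ hτ =>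
      BayesianLasso.isProbabilityMeasure_blockKernel hY hτ,
    BayesianLasso.isProbabilityMeasure_posterior hlam hX hY,
    BayesianLasso.invariant_posterior hlam hX hY, fun β₀ σ₀sq k hk => ?_⟩
  have : Nonempty {A : Set (BayesianLasso.State p) // MeasurableSet A} :=
    ⟨⟨Set.univ, MeasurableSet.univ⟩⟩
  exact ciSup_le fun A => BayesianLasso.gibbsKernel_abs_sub_le hlam hX hY hγ0 hγ1 hb hd hr0 hε hU
    hα (β₀, σ₀sq) hk A.2
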